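/- **Setting.** For each $n\ge 1$ let $Y=\mathbb{X}\boldsymbol\beta_0+\boldsymbol U\in\mathbb{R}^n$, where the (random or fixed) design $\mathbb{X}\in\mathbb{R}^{n\times p}$, $p=p_n$, is independent of $\boldsymbol U\sim N(\mathbf 0,\sigma_0^2 I_n)$, $\sigma_0>0$ is fixed, and $\boldsymbol\beta_0=\boldsymbol\beta_{0,n}\in\mathbb{R}^p$. Let $S=\{j:\beta_{0j}\neq0\}$, $N=S^c$, $s=s_n=|S|\ge1$, $d_n=\frac12\min_{j\in S}|\beta_{0j}|$. Fix $\alpha\ge0$. With $r_i(\boldsymbol\beta,\sigma)=(y_i-\boldsymbol x_i^T\boldsymbol\beta)/\sigma$ let $L_n^\alpha(\boldsymbol\beta,\sigma)=-\frac1n\sum_i\sigma^{-\alpha/(\alpha+1)}e^{-\alpha r_i^2/2}$ if $\alpha>0$, $L^0_n(\boldsymbol\beta,\sigma)=\log(\sigma\sqrt{2\pi})+\frac1{2n}\sum_i r_i^2$, and $$Q(\boldsymbol\beta,\sigma)=L_n^\alpha(\boldsymbol\beta,\sigma)+\sum_{j=1}^p p_{\lambda_n}(|\beta_j|),\qquad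 \boldsymbol\beta\in\mathbb{R}^p,\ \sigma>0 .$$ **Penalty (C1).** For every $\lambda>0$, $p_\lambda$ is nondecreasing, continuously differentiable and concave on $[0,\infty)$; for each $t\ge 0$, $p'_\lambda(t)/\lambda$ is nondecreasing in $\lambda>0$; and $\rho=p'_\lambda(0+)/\lambda$ is positive and independent of $\lambda$. The local concavity at $\boldsymbol\delta\in\mathbb{R}^s$ is $$\xi(p_\lambda,\boldsymbol\delta)=\lim_{\varepsilon\downarrow0}\max_j\sup\Big\{-\tfrac{p_\lambda'(t_2)-p_\lambda'(t_1)}{t_2-t_1}: 0\le t_1<t_2,\ t_1,t_2\in(|\delta_j|-\varepsilon,|\delta_j|+\varepsilon)\Big\}.$$ **Matrices.** Let $\phi_{1}(u)=ue^{-\alpha u^2/2}$, $\phi_{2}(u)=(u^2-\frac1{\alpha+1})e^{-\alpha u^2/2}$, $w(\sigma)=c_\alpha\sigma^{-(2\alpha+1)/(\alpha+1)}$ with $c_\alpha=\alpha$ for $\alpha>0$ and $c_0=1$. For $(\boldsymbol\delta,\sigma)\in\mathbb{R}^s\times(0,\infty)$, with residuals $r_i$ at $((\boldsymbol\delta,\mathbf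 0),\sigma)$, i.e. at the coefficient vector equal to $\boldsymbol\delta$ on $S$ and to $0$ on $N$, put $\gamma_j(\boldsymbol\delta,\sigma)=w(\sigma)\sum_i\phi_1(r_i)x_{ij}$ for $1\le j\le p$ and $\gamma_{p+1}(\boldsymbol\delta,\sigma)=w(\sigma)\sum_i\phi_2(r_i)$. Let $\boldsymbol\Sigma$ be the $2n\times2n$ matrix with diagonal $n\times n$ blocks $\mathbf J_{ab}$, $a,b\in\{1,2\}$, whose $i$-th diagonal entry is minus the derivative of $w(\sigma)\phi_a((y_i-m)/\sigma)$ in $m$ (if $b=1$) or in $\sigma$ (if $b=2$) at $m=\boldsymbol x_i^T(\boldsymbol\delta,\mathbf 0)$. Let $\mathbb{X}_h^*=\operatorname{Block-diag}(\mathbb{X}_h,\mathbf 1_n)$ for $h=S,N$, where $\mathbb X_h$ consists of the columns of $\mathbb X$ in $h$, and $M=\mathbb{X}_S^{*T}\boldsymbol\Sigma\,\mathbb{X}_S^*$ (the Hessian of $nL_n^\alpha$ in $(\boldsymbol\beta_S,\sigma)$), $M_N=\mathbb{X}_N^{*T}\boldsymbol\Sigma\,\mathbb{X}_S^*$; $M^0,M_N^0$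 are their values at $(\boldsymbol\beta_{S0},\sigma_0)$. For matrices $\|\cdot\|_\infty$ is the maximal $\ell_1$ norm of a row. Let $\mathcal N_0=\{(\boldsymbol\delta,\sigma):\sigma>0,\ \|\boldsymbol\delta-\boldsymbol\beta_{S0}\|_\infty\le d_n,\ |\sigma-\sigma_0|\le d_n\}$. **Deterministic assumptions.** $s=o(n)$, $s=O(n^{\tau_0})$, $\tau\in(0,\frac12]$, $\tau_1\in[0,\frac12]$, $\tau^*=\min(\frac12,2\tau-\tau_0)-\tau_1$, $\log p=O(n^{1-2\tau^*})$; $0<b_n\to\infty$ with $b_n=o\big(\min(n^{1/2-\tau}\sqrt{\log n},\ \frac{n^\tau}{(s+1)\log n})\big)$; for all large $n$, $d_n\ge n^{-\tau}\log n$ and $\lambda_n\ge n^{-\tau^*}(\log n)^2$; and $p'_{\lambda_n}(d_n)=o(b_n^{-1}n^{-\tau}\log n)$. **Assumptions on the data.** Fix $C\in(0,1)$, a constant $K$ and positive numbers $\varepsilon_n\to0$. Let $E_n$ be the event that the observed $(\mathbb{X},Y)$ satisfies: * (A1) every column of $\mathbb{X}$ has Euclidean norm at most $K\sqrt n$; *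 (A2) $M^0$ is invertible with $\|(M^0)^{-1}\|_\infty\le Kb_n/n$; $\|M_N^0(M^0)^{-1}\|_\infty\,p'_{\lambda_n}(d_n)<C\,p'_{\lambda_n}(0+)$ and $\|M_N^0(M^0)^{-1}\|_\infty\le Kn^{\tau_1}$; and for all $(\boldsymbol\delta,\sigma)\in\mathcal N_0$ and $1\le j\le p+1$ the eigenvalues of $\nabla^2_{(\boldsymbol\delta,\sigma)}\gamma_j(\boldsymbol\delta,\sigma)$ are at most $Kn$ in absolute value; * (A3) $\max_{(\boldsymbol\delta,\sigma)\in\mathcal N_0}\xi(p_{\lambda_n},\boldsymbol\delta)\le\varepsilon_n\min_{(\boldsymbol\delta,\sigma)\in\mathcal N_0}\Lambda_{\min}\big(\frac1nM(\boldsymbol\delta,\sigma)\big)$, and all entries satisfy $|x_{ij}|\le\varepsilon_n n^{\tau^*}/\sqrt{\log n}$. **Theorem (weak oracle property).** There are estimators $(\widehat{\boldsymbol\beta},\widehat\sigma)$ (functions of $(\mathbb{X},Y)$, for every $n$) and a constant $A$ such that, for all sufficiently large $n$, except on a set of probability at most $$2\Big[\frac{1+s}{n}+(p-s)\exp\big(-n^{1-2\tau^*}\log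 n\big)\Big],$$ whenever $E_n$ occurs, $(\widehat{\boldsymbol\beta},\widehat\sigma)$ is a strict local minimizer of $Q$ on $\mathbb{R}^p\times(0,\infty)$ with 1. $\widehat{\boldsymbol\beta}_N=\mathbf 0$; 2. $\|\widehat{\boldsymbol\beta}_S-\boldsymbol\beta_{S0}\|_\infty\le A\,n^{-\tau}\log n$ and $|\widehat\sigma-\sigma_0|\le A\,n^{-\tau}\log n$. In particular, if the data satisfy the assumptions almost surely, this holds with probability at least $1-2[\frac{1+s}{n}+(p-s)\exp(-n^{1-2\tau^*}\log n)]$. -/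

import Mathlib

open Filter Topology MeasureTheory ProbabilityTheory

noncomputable section

namespace RPRegression

/-! ### Elementary notions: eigenvalues, norms, strict local minimizers -/

/-- Smallest eigenvalue of a (symmetric) real matrix. -/
def minEig {ι : Type*} [Fintype ι] [DecidableEq ι] (A : Matrix ι ι ℝ) : ℝ :=
  sInf (spectrum ℝ A)

/-- Largest eigenvalue, in absolute value, of a (symmetric) real matrix. -/
def maxAbsEig {ι : Type*} [Fintype ι] [DecidableEq ι] (A : Matrix ι ι ℝ) : ℝ :=
  sSup ((fun e : ℝ => |e|) '' spectrum ℝ A)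

/-- `‖A‖_∞`: the maximum of the `ℓ₁` norms of the rows of `A`. -/
def rowSumNorm {ι κ : Type*} [Fintype ι] [Fintype κ] (A : Matrix ι κ ℝ) : ℝ :=
  ⨆ i, ∑ j, |A i j|

/-- `x` is a strict local minimizer of `f`. -/
def IsStrictLocalMin {E : Type*} [TopologicalSpace E] (f : E → ℝ) (x : E) : Prop :=
  ∀ᶠ z in 𝓝[≠] x, f x < f z

/-! ### The loss function and the penalized objective -/

/-- Standardized residual `r_i(β, σ) = (y_i - x_iᵀ β) / σ`. -/
def resid {n p : ℕ} (X : Matrix (Fin n) (Fin p) ℝ) (y : Fin n → ℝ)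
    (β : Fin p → ℝ) (σ : ℝ) (i : Fin n) : ℝ :=
  (y i - (X.mulVec β) i) / σ

/-- The loss function based on the Rényi pseudodistance with tuning parameter `α ≥ 0`. -/
def rpLoss {n p : ℕ} (α : ℝ) (X : Matrix (Fin n) (Fin p) ℝ) (y : Fin n → ℝ)
    (β : Fin p → ℝ) (σ : ℝ) : ℝ :=
  if α = 0 then
    Real.log (σ * √(2 * Real.pi)) + (1 / (n : ℝ)) * ∑ i, (1 / 2) * resid X y β σ i ^ 2
  else
    (1 / (n : ℝ)) *
      ∑ i, -(σ ^ (-α / (α + 1)) * Real.exp (-(α / 2) * resid X y β σ i ^ 2))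

/-- The penalized objective `Q(β, σ) = L(β, σ) + ∑ⱼ p_λ(|βⱼ|)`; `pen l` is the penalty `p_l`. -/
def objective {n p : ℕ} (α : ℝ) (pen : ℝ → ℝ → ℝ) (l : ℝ)
    (X : Matrix (Fin n) (Fin p) ℝ) (y : Fin n → ℝ) (θ : (Fin p → ℝ) × ℝ) : ℝ :=
  rpLoss α X y θ.1 θ.2 + ∑ j, pen l |θ.1 j|

/-! ### The penalty -/

/-- The derivative `p_l'(t)` of the penalty on `[0, ∞)`; its value at `t = 0` is the
right derivative `p_l'(0+)`. -/
def dpen (pen : ℝ → ℝ → ℝ) (l t : ℝ) : ℝ :=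
  derivWithin (pen l) (Set.Ici 0) t

/-- Condition on the family of penalties `p_l`, `l > 0`. -/
structure PenaltyCondition (pen : ℝ → ℝ → ℝ) : Prop where
  monotone : ∀ l > 0, MonotoneOn (pen l) (Set.Ici 0)
  contDiff : ∀ l > 0, ContDiffOn ℝ 1 (pen l) (Set.Ici 0)
  concave : ∀ l > 0, ConcaveOn ℝ (Set.Ici 0) (pen l)
  mono_param : ∀ t ≥ 0, MonotoneOn (fun l => dpen pen l t / l) (Set.Ioi 0)
  slope : ∃ ρ > 0, ∀ l > 0, dpen pen l 0 / l = ρ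

/-- The local concavity `ξ(p_l, b)`: the limit as `ε ↓ 0` of the maximum over `j` of the
suprema of `-(p_l'(t₂) - p_l'(t₁)) / (t₂ - t₁)` over `t₁ < t₂` in `(|b_j| - ε, |b_j| + ε)`.
The quantity is monotone in `ε`, so that the limit is the infimum. -/
def localConcavity {ι : Type*} (pen : ℝ → ℝ → ℝ) (l : ℝ) (b : ι → ℝ) : EReal :=
  ⨅ (ε : ℝ) (_ : 0 < ε), ⨆ (j : ι) (t₁ : ℝ) (t₂ : ℝ)
    (_ : 0 ≤ t₁ ∧ t₁ < t₂ ∧ |t₁ - abs (b j)| < ε ∧ |t₂ - abs (b j)| < ε),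
    ((-((dpen pen l t₂ - dpen pen l t₁) / (t₂ - t₁)) : ℝ) : EReal)

/-! ### Scores, their derivatives, and the matrices built from them -/

/-- `φ_{1,α}(u) = u exp(-α u² / 2)`. -/
def phi1 (α u : ℝ) : ℝ := u * Real.exp (-(α / 2) * u ^ 2)

/-- `φ_{2,α}(u) = (u² - 1 / (α + 1)) exp(-α u² / 2)`. -/
def phi2 (α u : ℝ) : ℝ := (u ^ 2 - 1 / (α + 1)) * Real.exp (-(α / 2) * u ^ 2)

/-- The weight `α σ^{-(2α+1)/(α+1)}` of the scores; for `α = 0` (the Gaussian likelihood) it is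
`σ⁻¹`, so that in all cases the gradient of `n L` is minus the sum of the weighted scores. -/
def weight (α σ : ℝ) : ℝ :=
  (if α = 0 then 1 else α) * σ ^ (-((2 * α + 1) / (α + 1)))

/-- Weighted score of one observation `v` for its linear predictor `m = xᵀβ`. -/
def score1 (α v m σ : ℝ) : ℝ := weight α σ * phi1 α ((v - m) / σ)

/-- Weighted score of one observation `v` for the scale `σ`. -/
def score2 (α v m σ : ℝ) : ℝ := weight α σ * phi2 α ((v - m) / σ)

/-- `J₁₁`: second derivative of the loss of one observation in `m, m`. -/
def J11 (α v m σ : ℝ) : ℝ := -deriv (fun t => score1 α v t σ) m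
/-- `J₁₂`: second derivative of the loss of one observation in `m, σ`. -/
def J12 (α v m σ : ℝ) : ℝ := -deriv (fun t => score1 α v m t) σ
/-- `J₂₁`: second derivative of the loss of one observation in `σ, m`. -/
def J21 (α v m σ : ℝ) : ℝ := -deriv (fun t => score2 α v t σ) m
/-- `J₂₂`: second derivative of the loss of one observation in `σ, σ`. -/
def J22 (α v m σ : ℝ) : ℝ := -deriv (fun t => score2 α v m t) σ

/-- The `2n × 2n` matrix `Σ_α(β, σ)`: four diagonal `n × n` blocks. -/
def sigmaMat {n p : ℕ} (α : ℝ) (X : Matrix (Fin n) (Fin p) ℝ) (y : Fin n → ℝ)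
    (β : Fin p → ℝ) (σ : ℝ) : Matrix (Fin n ⊕ Fin n) (Fin n ⊕ Fin n) ℝ :=
  Matrix.fromBlocks
    (Matrix.diagonal fun i => J11 α (y i) (X.mulVec β i) σ)
    (Matrix.diagonal fun i => J12 α (y i) (X.mulVec β i) σ)
    (Matrix.diagonal fun i => J21 α (y i) (X.mulVec β i) σ)
    (Matrix.diagonal fun i => J22 α (y i) (X.mulVec β i) σ)

/-- Indices of the nonzero coefficients. -/
abbrev Supp {p : ℕ} (β₀ : Fin p → ℝ) : Type := {j : Fin p // β₀ j ≠ 0}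

/-- Indices of the zero coefficients. -/
abbrev Null {p : ℕ} (β₀ : Fin p → ℝ) : Type := {j : Fin p // β₀ j = 0}

/-- Number `s` of nonzero coefficients. -/
def sparsity {p : ℕ} (β₀ : Fin p → ℝ) : ℕ := Fintype.card (Supp β₀)

/-- `d = min_{j ∈ S} |β₀ⱼ| / 2`. -/
def halfMinSignal {p : ℕ} (β₀ : Fin p → ℝ) : ℝ := (⨅ j : Supp β₀, |β₀ j|) / 2

/-- `X*_h = Block-diag(X_h, 1_n)`, where `X_h` consists of the columns of `X` indexed by `h`. -/
def designStar {n p : ℕ} (X : Matrix (Fin n) (Fin p) ℝ) (q : Fin p → Prop) :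
    Matrix (Fin n ⊕ Fin n) ({j : Fin p // q j} ⊕ Unit) ℝ :=
  Matrix.fromBlocks (X.submatrix id Subtype.val) 0 0 (Matrix.of fun _ _ => 1)

/-- The coefficient vector `(δ, 0)` encoded in `z = (δ, σ)`. -/
def extend {p : ℕ} (β₀ : Fin p → ℝ) (z : Supp β₀ ⊕ Unit → ℝ) (j : Fin p) : ℝ :=
  if h : β₀ j ≠ 0 then z (Sum.inl ⟨j, h⟩) else 0

/-- The true value `(β_{S0}, σ₀)`. -/
def trueParam {p : ℕ} (β₀ : Fin p → ℝ) (σ₀ : ℝ) : Supp β₀ ⊕ Unit → ℝ :=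
  Sum.elim (fun j => β₀ j) (fun _ => σ₀)

/-- `X*_Sᵀ Σ_α(δ, 0, σ) X*_S` at `z = (δ, σ)`. -/
def infoSS {n p : ℕ} (α : ℝ) (X : Matrix (Fin n) (Fin p) ℝ) (y : Fin n → ℝ) (β₀ : Fin p → ℝ)
    (z : Supp β₀ ⊕ Unit → ℝ) : Matrix (Supp β₀ ⊕ Unit) (Supp β₀ ⊕ Unit) ℝ :=
  (designStar X fun j => β₀ j ≠ 0).transpose *
    sigmaMat α X y (extend β₀ z) (z (Sum.inr ())) * designStar X fun j => β₀ j ≠ 0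

/-- `X*_Nᵀ Σ_α(δ, 0, σ) X*_S` at `z = (δ, σ)`. -/
def infoNS {n p : ℕ} (α : ℝ) (X : Matrix (Fin n) (Fin p) ℝ) (y : Fin n → ℝ) (β₀ : Fin p → ℝ)
    (z : Supp β₀ ⊕ Unit → ℝ) : Matrix (Null β₀ ⊕ Unit) (Supp β₀ ⊕ Unit) ℝ :=
  (designStar X fun j => β₀ j = 0).transpose *
    sigmaMat α X y (extend β₀ z) (z (Sum.inr ())) * designStar X fun j => β₀ j ≠ 0

/-- The functions `γ_j(δ, σ)`, `j = 1, …, p + 1` (the last one is indexed by `Sum.inr ()`). -/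
def gammaFun {n p : ℕ} (α : ℝ) (X : Matrix (Fin n) (Fin p) ℝ) (y : Fin n → ℝ) (β₀ : Fin p → ℝ)
    (j : Fin p ⊕ Unit) (z : Supp β₀ ⊕ Unit → ℝ) : ℝ :=
  match j with
  | Sum.inl k => weight α (z (Sum.inr ())) *
      ∑ i, phi1 α (resid X y (extend β₀ z) (z (Sum.inr ())) i) * X i k
  | Sum.inr _ => weight α (z (Sum.inr ())) *
      ∑ i, phi2 α (resid X y (extend β₀ z) (z (Sum.inr ())) i)

/-- Matrix of second order partial derivatives. -/
def hessian {ι : Type*} [Fintype ι] [DecidableEq ι] (f : (ι → ℝ) → ℝ) (z : ι → ℝ) :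
    Matrix ι ι ℝ :=
  Matrix.of fun a b =>
    fderiv ℝ (fun w => fderiv ℝ f w (Pi.single a 1)) z (Pi.single b 1)

/-- The neighbourhood `N₀` of `(β_{S0}, σ₀)`: all `(δ, σ)` with `σ > 0`,
`‖δ - β_{S0}‖_∞ ≤ d` and `|σ - σ₀| ≤ d`. -/
def nbhd {p : ℕ} (β₀ : Fin p → ℝ) (σ₀ : ℝ) : Set (Supp β₀ ⊕ Unit → ℝ) :=
  {z | (∀ j : Supp β₀, |z (Sum.inl j) - β₀ j| ≤ halfMinSignal β₀) ∧
    |z (Sum.inr ()) - σ₀| ≤ halfMinSignal β₀ ∧ 0 < z (Sum.inr ())}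

/-- `τ* = min(1/2, 2τ - τ₀) - τ₁`. -/
def tauStar (τ τ₀ τ₁ : ℝ) : ℝ := min (1 / 2) (2 * τ - τ₀) - τ₁

/-- The conditions that concern the observed design `X` and response `y` at sample size `n`. The implied constant of every `O` is `K`, and `ε` bounds the ratio in
every `o`. -/
structure DataConditions {n p : ℕ} (α : ℝ) (pen : ℝ → ℝ → ℝ) (l b τ₁ τs C K ε : ℝ)
    (β₀ : Fin p → ℝ) (σ₀ : ℝ) (X : Matrix (Fin n) (Fin p) ℝ) (y : Fin n → ℝ) : Prop where
  /-- The columns have Euclidean norm `O(√n)`. -/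
  column_norm : ∀ j, √(∑ i, X i j ^ 2) ≤ K * √(n : ℝ)
  /-- The matrix `X*_Sᵀ Σ_α(θ₀) X*_S` is invertible and its inverse is `O(b / n)`. -/
  det_isUnit : IsUnit (infoSS α X y β₀ (trueParam β₀ σ₀)).det
  inv_bound : rowSumNorm (infoSS α X y β₀ (trueParam β₀ σ₀))⁻¹ ≤ K * (b / n)
  /-- Bound of `‖(X*_Nᵀ Σ_α X*_S)(X*_Sᵀ Σ_α X*_S)⁻¹‖_∞` at `θ₀` by `C p'(0+) / p'(d)`
  (no constraint if `p'(d) = 0`) ... -/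
  irrep_slope :
    rowSumNorm (infoNS α X y β₀ (trueParam β₀ σ₀) * (infoSS α X y β₀ (trueParam β₀ σ₀))⁻¹) *
      dpen pen l (halfMinSignal β₀) < C * dpen pen l 0
  /-- ... and the bound by `O(n ^ τ₁)`. -/
  irrep_rate :
    rowSumNorm (infoNS α X y β₀ (trueParam β₀ σ₀) * (infoSS α X y β₀ (trueParam β₀ σ₀))⁻¹)
      ≤ K * (n : ℝ) ^ τ₁
  /-- The Hessians of all `γ_j` are `O(n)` on `N₀`. -/
  hessian_bound : ∀ z ∈ nbhd β₀ σ₀, ∀ j : Fin p ⊕ Unit,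
    maxAbsEig (hessian (gammaFun α X y β₀ j) z) ≤ K * n
  /-- On `N₀` the local concavity of the penalty is negligible with respect to the smallest
  eigenvalue of `n⁻¹ X*_Sᵀ Σ_α X*_S`. -/
  concavity : ∀ z ∈ nbhd β₀ σ₀, ∀ w ∈ nbhd β₀ σ₀,
    localConcavity pen l (fun j : Supp β₀ => z (Sum.inl j)) ≤
      ((ε * minEig ((1 / (n : ℝ)) • infoSS α X y β₀ w) : ℝ) : EReal)
  /-- The entries of the design are `o(n ^ τ* / √(log n))`. -/
  entries : ∀ i j, |X i j| ≤ ε * ((n : ℝ) ^ τs / √(Real.log n))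

/-- `(β̂, σ̂)` is a strict local minimizer of the objective, `σ̂ > 0`, with `β̂_N = 0` and with
errors at most `R` in sup norm. -/
structure OracleMinimizer {n p : ℕ} (α : ℝ) (pen : ℝ → ℝ → ℝ) (l R : ℝ)
    (β₀ : Fin p → ℝ) (σ₀ : ℝ) (X : Matrix (Fin n) (Fin p) ℝ) (y : Fin n → ℝ)
    (θ : (Fin p → ℝ) × ℝ) : Prop where
  scale_pos : 0 < θ.2
  strict_min : IsStrictLocalMin (objective α pen l X y) θ
  zeros : ∀ j, β₀ j = 0 → θ.1 j = 0
  coef_error : ∀ j, β₀ j ≠ 0 → |θ.1 j - β₀ j| ≤ R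
  scale_error : |θ.2 - σ₀| ≤ R

end RPRegression

end

open RPRegression

/-!
# Weak oracle property of penalized Rényi-pseudodistance regression

Fix `n` and a data set satisfying the conditions on the data, and let `r = n ^ (-τ) log n`. Write
`z₀ = (β_{S0}, σ₀)`, `M₀` for the information matrix `infoSS` at `z₀`, and `F` for the objective
restricted to the coefficients of the support and the scale.

**A stationary point of `F` near `z₀`.** On the sup-norm cube of radius `r` around `z₀` all
coefficients of the support are nonzero, so `F` is differentiable there. By Taylor's formula, with
the Hessians of the scores bounded by condition (A2), `z - z₀ = n M₀⁻¹ ∇F(z) + e(z)`, where the sup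
norm of `e(z)` is at most `η r` with `η < 1` as soon as the scores at the truth are of order
`√(n log n)`. No fixed-point theorem is needed: take a minimizer `z` of `F` over the cube. There
`∇F(z) ⬝ (w - z) ≥ 0` for all `w` in the cube, and choosing the corner `w = z₀ - r sign ∇F(z)` and
using that `M₀⁻¹` is positive semidefinite yields `∇F(z) = 0` (`exists_stationary`). Positive
semidefiniteness of the information matrix comes from (A3), because the local concavity of a concave
penalty is nonnegative. It follows that `z - z₀ = e(z)` is at most `η r`.

**Strict local minimality.** The information matrix at `z` differs little from `M₀`, hence it is
still nonsingular and so positive definite; its smallest eigenvalue beats the local concavity of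
the penalty by (A3), which makes `z` a strict local minimizer of `F`
(`DataConditions.isStrictLocalMin_reduced`). In the directions off the support the linearization
bounds the scores at `z` by those at `z₀` plus `M_N⁰ M₀⁻¹` applied to an error and to the slope of
the penalty; by the irrepresentability condition they stay strictly below `n p'(0+)`, so `z`,
completed by zeros, is a strict local minimizer of the full objective
(`isStrictLocalMin_objective`).
The two parts are combined in `DataConditions.exists_oracleMinimizer`.

**Probability.** The scores at the truth are, up to a constant factor, `∑ φ₁(uᵢ/σ₀) xᵢⱼ` and
`∑ φ₂(uᵢ/σ₀)`. The function `φ₁` is odd and dominated by the identity, so that `φ₁` of a standard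
Gaussian is subgaussian with variance proxy `1` (`hasSubgaussianMGF_phi1`); `φ₂` of a standard
Gaussian is centred and subexponential (`exists_mgf_phi2_le`). For a random design the bounds for
fixed design are integrated over the law of the design, and a union bound over the parameters gives
the stated probability (`measure_no_oracleMinimizer_le`). The rate conditions make the deterministic
inequalities hold for all large `n` (`eventually_rates`). The estimator is any point with the
required properties when there is one, and the constant in front of the rate can be taken to be `1`.
-/

namespace RPRegression

/-! ### Loss of a single observation -/

/-- Chain rule for a function of the linear predictor and the scale along a curve, in terms of the
two partial derivatives. -/
theorem hasDerivAt_comp_curve {f : ℝ → ℝ → ℝ} {m s : ℝ → ℝ} {m' s' t : ℝ}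
    (hf : DifferentiableAt ℝ (fun q : ℝ × ℝ => f q.1 q.2) (m t, s t))
    (hm : HasDerivAt m m' t) (hs : HasDerivAt s s' t) :
    HasDerivAt (fun t => f (m t) (s t))
      (deriv (fun x => f x (s t)) (m t) * m' + deriv (fun x => f (m t) x) (s t) * s') t := by
  have h := hf.hasFDerivAt
  have hc : HasDerivAt (fun t => (m t, s t)) (m', s') t := hm.prodMk hs
  have h1 := h.comp_hasDerivAt t hc
  have h2 : HasDerivAt (fun x => f x (s t))
      (fderiv ℝ (fun q : ℝ × ℝ => f q.1 q.2) (m t, s t) (1, 0)) (m t) :=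
    h.comp_hasDerivAt (f := fun x => (x, s t)) (m t)
      ((hasDerivAt_id' (m t)).prodMk (hasDerivAt_const (m t) (s t)))
  have h3 : HasDerivAt (fun x => f (m t) x)
      (fderiv ℝ (fun q : ℝ × ℝ => f q.1 q.2) (m t, s t) (0, 1)) (s t) :=
    h.comp_hasDerivAt (f := fun x => (m t, x)) (s t)
      ((hasDerivAt_const (s t) (m t)).prodMk (hasDerivAt_id' (s t)))
  rw [h2.deriv, h3.deriv]
  have e : ((m', s') : ℝ × ℝ) = m' • (1, 0) + s' • (0, 1) := by simp
  rw [e, map_add, map_smul, map_smul, smul_eq_mul, smul_eq_mul, mul_comm m', mul_comm s'] at h1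
  exact h1

/-- Loss of a single observation `v` with linear predictor `m` and scale `σ`. -/
noncomputable def obsLoss (α v m σ : ℝ) : ℝ :=
  if α = 0 then Real.log (σ * √(2 * Real.pi)) + 1 / 2 * ((v - m) / σ) ^ 2
  else -(σ ^ (-α / (α + 1)) * Real.exp (-(α / 2) * ((v - m) / σ) ^ 2))

theorem rpLoss_eq_sum_obsLoss {n p : ℕ} (hn : n ≠ 0) (α : ℝ) (X : Matrix (Fin n) (Fin p) ℝ)
    (y : Fin n → ℝ) (β : Fin p → ℝ) (σ : ℝ) :
    rpLoss α X y β σ = (1 / (n : ℝ)) * ∑ i, obsLoss α (y i) (X.mulVec β i) σ := by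
  have hn' : (n : ℝ) ≠ 0 := Nat.cast_ne_zero.mpr hn
  unfold rpLoss obsLoss resid
  split_ifs
  · rw [Finset.sum_add_distrib, Finset.sum_const, Finset.card_univ, Fintype.card_fin, nsmul_eq_mul,
      mul_add, ← mul_assoc, one_div_mul_cancel hn', one_mul]
  · rfl

section Smooth

variable {α v : ℝ} {q : ℝ × ℝ}

theorem contDiffAt_score1 (hq : 0 < q.2) :
    ContDiffAt ℝ 2 (fun q : ℝ × ℝ => score1 α v q.1 q.2) q := by
  unfold score1 phi1 weight
  have h0 : q.2 ≠ 0 := hq.ne'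
  have h1 : ContDiffAt ℝ 2 (fun q : ℝ × ℝ => q.2 ^ (-((2 * α + 1) / (α + 1)))) q :=
    contDiffAt_snd.rpow_const_of_ne h0
  have h2 : ContDiffAt ℝ 2 (fun q : ℝ × ℝ => (v - q.1) / q.2) q :=
    (contDiffAt_const.sub contDiffAt_fst).div contDiffAt_snd h0
  fun_prop

theorem contDiffAt_score2 (hq : 0 < q.2) :
    ContDiffAt ℝ 2 (fun q : ℝ × ℝ => score2 α v q.1 q.2) q := by
  unfold score2 phi2 weight
  have h0 : q.2 ≠ 0 := hq.ne'
  have h1 : ContDiffAt ℝ 2 (fun q : ℝ × ℝ => q.2 ^ (-((2 * α + 1) / (α + 1)))) q :=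
    contDiffAt_snd.rpow_const_of_ne h0
  have h2 : ContDiffAt ℝ 2 (fun q : ℝ × ℝ => (v - q.1) / q.2) q :=
    (contDiffAt_const.sub contDiffAt_fst).div contDiffAt_snd h0
  fun_prop

theorem differentiableAt_obsLoss (hq : 0 < q.2) :
    DifferentiableAt ℝ (fun q : ℝ × ℝ => obsLoss α v q.1 q.2) q := by
  unfold obsLoss
  have h0 : q.2 ≠ 0 := hq.ne'
  have h1 : DifferentiableAt ℝ (fun q : ℝ × ℝ => q.2 ^ (-α / (α + 1))) q :=
    differentiableAt_snd.rpow_const (Or.inl h0)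
  have h2 : DifferentiableAt ℝ (fun q : ℝ × ℝ => (v - q.1) / q.2) q := by
    fun_prop (disch := assumption)
  have h3 : DifferentiableAt ℝ (fun q : ℝ × ℝ => Real.log (q.2 * √(2 * Real.pi))) q := by
    have : q.2 * √(2 * Real.pi) ≠ 0 := by positivity
    fun_prop (disch := assumption)
  split_ifs <;> fun_prop

end Smooth

section Partial

variable {α v m σ : ℝ}

theorem hasDerivAt_resid_mean (σ : ℝ) :
    HasDerivAt (fun t => (v - t) / σ) (-1 / σ) m := by
  simpa using ((hasDerivAt_id m).const_sub v).div_const σ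

theorem hasDerivAt_resid_scale (hσ : 0 < σ) :
    HasDerivAt (fun t => (v - m) / t) (-((v - m) / σ) / σ) σ := by
  have := (hasDerivAt_const σ (v - m)).fun_div (hasDerivAt_id' σ) hσ.ne'
  refine this.congr_deriv ?_
  field_simp
  ring

theorem hasDerivAt_expFactor {g : ℝ → ℝ} {g' x : ℝ} (hg : HasDerivAt g g' x) :
    HasDerivAt (fun t => Real.exp (-(α / 2) * g t ^ 2))
      (-α * g x * g' * Real.exp (-(α / 2) * g x ^ 2)) x := by
  convert ((hg.fun_pow 2).const_mul (-(α / 2))).exp using 1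
  ring

theorem deriv_obsLoss_mean (hσ : 0 < σ) (hα : 0 ≤ α) :
    deriv (fun t => obsLoss α v t σ) m = -score1 α v m σ := by
  have hr := hasDerivAt_resid_mean (v := v) (m := m) σ
  unfold obsLoss score1 weight phi1
  split_ifs with h
  · subst h
    have := ((hr.fun_pow 2).const_mul (1 / 2)).const_add (Real.log (σ * √(2 * Real.pi)))
    refine this.deriv.trans ?_
    simp [Real.rpow_neg_one]
    field_simp
  · have := ((hasDerivAt_expFactor (α := α) hr).const_mul (σ ^ (-α / (α + 1)))).neg
    refine this.deriv.trans ?_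
    have e : σ ^ (-((2 * α + 1) / (α + 1))) = σ ^ (-α / (α + 1)) / σ := by
      rw [← Real.rpow_sub_one hσ.ne']
      congr 1
      field_simp
      ring
    rw [e]
    field_simp

theorem deriv_obsLoss_scale (hσ : 0 < σ) (hα : 0 ≤ α) :
    deriv (fun t => obsLoss α v m t) σ = -score2 α v m σ := by
  have hr := hasDerivAt_resid_scale (v := v) (m := m) hσ
  have hα1 : α + 1 ≠ 0 := by positivity
  unfold obsLoss score2 weight phi2
  split_ifs with h
  · subst h
    have hpi : √(2 * Real.pi) ≠ 0 := by positivity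
    have h1 : HasDerivAt (fun t => Real.log (t * √(2 * Real.pi))) σ⁻¹ σ := by
      have := ((hasDerivAt_id' σ).mul_const (√(2 * Real.pi))).log
        (by simpa using ⟨hσ.ne', by positivity⟩)
      convert this using 1
      field_simp
    refine (h1.add ((hr.fun_pow 2).const_mul (1 / 2))).deriv.trans ?_
    simp [Real.rpow_neg_one]
    field_simp
    ring
  · have h1 := Real.hasDerivAt_rpow_const (x := σ) (p := -α / (α + 1)) (Or.inl hσ.ne')
    refine (h1.fun_mul (hasDerivAt_expFactor (α := α) hr)).neg.deriv.trans ?_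
    have e : σ ^ (-((2 * α + 1) / (α + 1))) = σ ^ (-α / (α + 1)) / σ := by
      rw [← Real.rpow_sub_one hσ.ne']
      congr 1
      field_simp
      ring
    rw [e, Real.rpow_sub_one hσ.ne']
    field_simp
    ring

/-- The mixed second derivatives of the loss of one observation agree. -/
theorem J12_eq_J21 (hσ : 0 < σ) (hα : 0 ≤ α) : J12 α v m σ = J21 α v m σ := by
  have hr := hasDerivAt_resid_scale (v := v) (m := m) hσ
  have hm := hasDerivAt_resid_mean (v := v) (m := m) σ
  have hα1 : α + 1 ≠ 0 := by positivity
  unfold J12 J21 score1 score2 weight phi1 phi2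
  have h1 := (Real.hasDerivAt_rpow_const (x := σ) (p := -((2 * α + 1) / (α + 1)))
    (Or.inl hσ.ne')).const_mul (if α = 0 then 1 else α)
  have h2 := h1.fun_mul (hr.fun_mul (hasDerivAt_expFactor (α := α) hr))
  have h3 := ((((hm.fun_pow 2).sub_const (1 / (α + 1))).fun_mul
    (hasDerivAt_expFactor (α := α) hm))).const_mul
      ((if α = 0 then 1 else α) * σ ^ (-((2 * α + 1) / (α + 1))))
  refine congrArg Neg.neg (h2.deriv.trans (Eq.trans ?_ h3.deriv.symm))
  rw [Real.rpow_sub_one hσ.ne', Nat.add_one_sub_one, pow_one, Nat.cast_ofNat]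
  field_simp
  ring

end Partial

/-! ### Eigenvalues and sup-norm bounds of matrices -/

section Matrices

variable {ι κ : Type*} [Fintype ι] [Fintype κ]

theorem sum_abs_row_le_rowSumNorm (A : Matrix ι κ ℝ) (i : ι) :
    ∑ j, |A i j| ≤ rowSumNorm A :=
  le_ciSup (f := fun i => ∑ j, |A i j|) (Set.finite_range _).bddAbove i

theorem rowSumNorm_nonneg (A : Matrix ι κ ℝ) : 0 ≤ rowSumNorm A :=
  Real.iSup_nonneg fun _ => Finset.sum_nonneg fun _ _ => abs_nonneg _

theorem abs_mulVec_le (A : Matrix ι κ ℝ) {v : κ → ℝ} {c : ℝ} (hv : ∀ j, |v j| ≤ c) (i : ι) :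
    |(A.mulVec v) i| ≤ rowSumNorm A * c := by
  rcases isEmpty_or_nonempty κ with hκ | ⟨⟨j₀⟩⟩
  · have : rowSumNorm A = 0 := by simp [rowSumNorm]
    simp [Matrix.mulVec, dotProduct, this]
  have hc : 0 ≤ c := (abs_nonneg _).trans (hv j₀)
  calc |(A.mulVec v) i| ≤ ∑ j, |A i j * v j| := Finset.abs_sum_le_sum_abs _ _
    _ ≤ ∑ j, |A i j| * c := by
        gcongr with j
        rw [abs_mul]
        gcongr
        exact hv j
    _ = (∑ j, |A i j|) * c := by rw [Finset.sum_mul]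
    _ ≤ rowSumNorm A * c := by
        gcongr
        exact sum_abs_row_le_rowSumNorm A i

theorem dotProduct_self_le (v : ι → ℝ) : v ⬝ᵥ v ≤ Fintype.card ι * ‖v‖ ^ 2 := by
  calc v ⬝ᵥ v = ∑ i, v i ^ 2 := by simp [dotProduct, sq]
    _ ≤ ∑ _i : ι, ‖v‖ ^ 2 := by
        refine Finset.sum_le_sum fun i _ => ?_
        exact sq_le_sq' (neg_le_of_abs_le (norm_le_pi_norm v i))
          (le_of_abs_le (norm_le_pi_norm v i))
    _ = _ := by simp

variable [DecidableEq ι]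

theorem spectrum_finite (A : Matrix ι ι ℝ) : (spectrum ℝ A).Finite :=
  Matrix.finite_real_spectrum

/-- Rayleigh bound: a symmetric matrix dominates its smallest eigenvalue times the identity. -/
theorem minEig_mul_dotProduct_le {A : Matrix ι ι ℝ} (hA : A.IsSymm) (v : ι → ℝ) :
    minEig A * (v ⬝ᵥ v) ≤ v ⬝ᵥ A.mulVec v := by
  have hpsd : (A - algebraMap ℝ _ (minEig A)).PosSemidef := by
    rw [Matrix.posSemidef_iff_isHermitian_and_spectrum_nonneg]
    refine ⟨?_, ?_⟩
    · ext i j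
      have := congrFun (congrFun hA.eq i) j
      simp [Matrix.algebraMap_matrix_apply, eq_comm] at this ⊢
      rw [this]
    · rw [← spectrum.sub_singleton_eq]
      rintro _ ⟨a, ha, _, rfl, rfl⟩
      exact sub_nonneg.mpr (csInf_le (spectrum_finite A).bddBelow ha)
  have := hpsd.dotProduct_mulVec_nonneg v
  simp only [star_trivial, Matrix.sub_mulVec, dotProduct_sub, Algebra.algebraMap_eq_smul_one,
    Matrix.smul_mulVec, Matrix.one_mulVec, dotProduct_smul, smul_eq_mul] at this
  linarith

theorem minEig_mem_spectrum [Nonempty ι] {A : Matrix ι ι ℝ} (hA : A.IsSymm) :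
    minEig A ∈ spectrum ℝ A := by
  have hA' : A.IsHermitian := by
    rw [Matrix.IsHermitian, Matrix.conjTranspose_eq_transpose_of_trivial]; exact hA
  refine Set.Nonempty.csInf_mem ?_ (spectrum_finite A)
  rw [hA'.spectrum_real_eq_range_eigenvalues]
  exact Set.range_nonempty _

theorem minEig_pos [Nonempty ι] {A : Matrix ι ι ℝ} (hA : A.IsSymm) (h0 : 0 ≤ minEig A)
    (hinj : ∀ v, A.mulVec v = 0 → v = 0) : 0 < minEig A := by
  refine lt_of_le_of_ne h0 fun h => ?_
  have hmem := minEig_mem_spectrum hA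
  rw [← h, spectrum.zero_mem_iff] at hmem
  apply hmem
  rw [← Matrix.mulVec_injective_iff_isUnit]
  intro v w hvw
  have := hinj (v - w) (by rw [Matrix.mulVec_sub]; exact sub_eq_zero.mpr hvw)
  exact sub_eq_zero.mp this

theorem abs_quadForm_le {H : Matrix ι ι ℝ} (hH : H.IsSymm) {c : ℝ} (hc : maxAbsEig H ≤ c)
    (v : ι → ℝ) : |v ⬝ᵥ H.mulVec v| ≤ c * (v ⬝ᵥ v) := by
  have hspec : ∀ a ∈ spectrum ℝ H, |a| ≤ c := fun a ha =>
    (le_csSup ((spectrum_finite H).image _).bddAbove (Set.mem_image_of_mem _ ha)).trans hc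
  have key : ∀ B : Matrix ι ι ℝ, B.IsSymm → (∀ a ∈ spectrum ℝ B, |a| ≤ c) →
      -(c * (v ⬝ᵥ v)) ≤ v ⬝ᵥ B.mulVec v := by
    intro B hB hs
    rcases isEmpty_or_nonempty ι with hι | hι
    · simp [dotProduct]
    have h1 := minEig_mul_dotProduct_le hB v
    have h2 := (abs_le.mp (hs _ (minEig_mem_spectrum hB))).1
    have h3 : 0 ≤ v ⬝ᵥ v := by simpa using dotProduct_star_self_nonneg v
    nlinarith
  have hneg := key (-H) hH.neg (by
    rw [← spectrum.neg_eq]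
    intro a ha
    simpa using hspec _ ha)
  rw [Matrix.neg_mulVec, dotProduct_neg] at hneg
  exact abs_le.mpr ⟨key H hH hspec, by linarith⟩

/-- A bound on the eigenvalues of a symmetric matrix bounds its bilinear form, here with respect
to the sup norm. -/
theorem abs_bilinForm_le {H : Matrix ι ι ℝ} (hH : H.IsSymm) {c : ℝ} (hc0 : 0 ≤ c)
    (hc : maxAbsEig H ≤ c) (v u : ι → ℝ) :
    |v ⬝ᵥ H.mulVec u| ≤ c * Fintype.card ι * ‖v‖ * ‖u‖ := by
  have hsymm : u ⬝ᵥ H.mulVec v = v ⬝ᵥ H.mulVec u := by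
    rw [Matrix.dotProduct_mulVec, ← Matrix.mulVec_transpose, hH.eq, dotProduct_comm]
  -- polarization, for vectors of norm at most one
  have unit : ∀ v u : ι → ℝ, u ⬝ᵥ H.mulVec v = v ⬝ᵥ H.mulVec u → ‖v‖ = 1 → ‖u‖ = 1 →
      |v ⬝ᵥ H.mulVec u| ≤ c * Fintype.card ι := by
    intro v u hs hv hu
    have h1 := abs_quadForm_le hH hc (v + u)
    have h2 := abs_quadForm_le hH hc (v - u)
    have h3 := dotProduct_self_le v
    have h4 := dotProduct_self_le u
    rw [hv] at h3
    rw [hu] at h4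
    simp only [Matrix.mulVec_add, Matrix.mulVec_sub, dotProduct_add, add_dotProduct,
      dotProduct_sub, sub_dotProduct, abs_le] at h1 h2
    rw [abs_le]
    have h5 := mul_le_mul_of_nonneg_left h3 hc0
    have h6 := mul_le_mul_of_nonneg_left h4 hc0
    constructor <;> linarith [h1.1, h1.2, h2.1, h2.2]
  rcases eq_or_ne v 0 with rfl | hv
  · simp
  rcases eq_or_ne u 0 with rfl | hu
  · simp
  have hv' : 0 < ‖v‖ := norm_pos_iff.mpr hv
  have hu' : 0 < ‖u‖ := norm_pos_iff.mpr hu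
  have h := unit (‖v‖⁻¹ • v) (‖u‖⁻¹ • u)
    (by simp only [Matrix.mulVec_smul, dotProduct_smul, smul_dotProduct, hsymm, smul_eq_mul]; ring)
    (by rw [norm_smul, norm_inv, norm_norm, inv_mul_cancel₀ hv'.ne'])
    (by rw [norm_smul, norm_inv, norm_norm, inv_mul_cancel₀ hu'.ne'])
  simp only [Matrix.mulVec_smul, dotProduct_smul, smul_dotProduct, smul_eq_mul, abs_mul,
    abs_inv, abs_norm] at h
  rw [← mul_assoc, ← mul_inv, inv_mul_le_iff₀ (by positivity)] at h
  linarith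

end Matrices

/-! ### Scores and their derivatives -/

section Scores

variable {n p : ℕ} {α : ℝ} {X : Matrix (Fin n) (Fin p) ℝ} {y : Fin n → ℝ} {β₀ : Fin p → ℝ}

/-- The weighted scores at an arbitrary parameter `(β, σ)`: minus `n` times the gradient of the
loss. The last component, for the scale, is indexed by `Sum.inr ()`. -/
noncomputable def fullScore (α : ℝ) (X : Matrix (Fin n) (Fin p) ℝ) (y : Fin n → ℝ) :
    Fin p ⊕ Unit → (Fin p → ℝ) × ℝ → ℝ
  | Sum.inl k, θ => ∑ i, score1 α (y i) (X.mulVec θ.1 i) θ.2 * X i k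
  | Sum.inr _, θ => ∑ i, score2 α (y i) (X.mulVec θ.1 i) θ.2

theorem gammaFun_eq_fullScore (j : Fin p ⊕ Unit) (z : Supp β₀ ⊕ Unit → ℝ) :
    gammaFun α X y β₀ j z = fullScore α X y j (extend β₀ z, z (Sum.inr ())) := by
  rcases j with k | k <;>
    simp only [gammaFun, fullScore, score1, score2, resid, Finset.mul_sum, mul_assoc]

theorem hasDerivAt_linearPredictor (β h : Fin p → ℝ) (i : Fin n) (t : ℝ) :
    HasDerivAt (fun t : ℝ => X.mulVec (β + t • h) i) (X.mulVec h i) t := by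
  simp only [Matrix.mulVec_add, Matrix.mulVec_smul, Pi.add_apply, Pi.smul_apply, smul_eq_mul]
  simpa using ((hasDerivAt_id' t).mul_const (X.mulVec h i)).const_add (X.mulVec β i)

theorem hasDerivAt_scale_line (σ k t : ℝ) : HasDerivAt (fun t : ℝ => σ + t * k) k t := by
  simpa using ((hasDerivAt_id' t).mul_const k).const_add σ

theorem hasDerivAt_rpLoss_line (hn : n ≠ 0) (hα : 0 ≤ α) (β h : Fin p → ℝ) {σ k t : ℝ}
    (hσ : 0 < σ + t * k) :
    HasDerivAt (fun t : ℝ => rpLoss α X y (β + t • h) (σ + t * k))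
      (-(1 / (n : ℝ)) * ((∑ j, fullScore α X y (Sum.inl j) (β + t • h, σ + t * k) * h j) +
        fullScore α X y (Sum.inr ()) (β + t • h, σ + t * k) * k)) t := by
  simp only [rpLoss_eq_sum_obsLoss hn]
  have hi : ∀ i ∈ (Finset.univ : Finset (Fin n)), HasDerivAt
      (fun t : ℝ => obsLoss α (y i) (X.mulVec (β + t • h) i) (σ + t * k))
      (-score1 α (y i) (X.mulVec (β + t • h) i) (σ + t * k) * X.mulVec h i +
        -score2 α (y i) (X.mulVec (β + t • h) i) (σ + t * k) * k) t := by
    intro i _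
    have := hasDerivAt_comp_curve (f := obsLoss α (y i))
      (m := fun t : ℝ => X.mulVec (β + t • h) i) (s := fun t : ℝ => σ + t * k)
      (differentiableAt_obsLoss hσ) (hasDerivAt_linearPredictor β h i t)
      (hasDerivAt_scale_line σ k t)
    rwa [deriv_obsLoss_mean hσ hα, deriv_obsLoss_scale hσ hα] at this
  refine ((HasDerivAt.fun_sum hi).const_mul (1 / (n : ℝ))).congr_deriv ?_
  simp only [fullScore, Finset.sum_add_distrib, Finset.sum_mul, neg_mul, Finset.sum_neg_distrib]
  rw [Finset.sum_comm (γ := Fin p)]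
  simp only [Matrix.mulVec, dotProduct, Finset.mul_sum]
  have : ∀ (i : Fin n) (j : Fin p) (a : ℝ), a * (X i j * h j) = a * X i j * h j :=
    fun i j a => (mul_assoc _ _ _).symm
  simp only [this]
  ring

theorem extend_add_smul (z v : Supp β₀ ⊕ Unit → ℝ) (t : ℝ) :
    extend β₀ (z + t • v) = extend β₀ z + t • extend β₀ v := by
  ext j
  by_cases h : β₀ j = 0 <;> simp [extend, h]

theorem contDiff_extend : ContDiff ℝ 2 (extend β₀) := by
  refine contDiff_pi.mpr fun j => ?_
  by_cases h : β₀ j = 0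
  · simpa [extend, h] using contDiff_const
  · simpa [extend, h] using contDiff_apply ℝ ℝ (Sum.inl ⟨j, h⟩ : Supp β₀ ⊕ Unit)

theorem contDiffAt_fullScore (j : Fin p ⊕ Unit) {θ : (Fin p → ℝ) × ℝ} (hθ : 0 < θ.2) :
    ContDiffAt ℝ 2 (fullScore α X y j) θ := by
  have hpair : ∀ i, ContDiffAt ℝ 2
      (fun θ : (Fin p → ℝ) × ℝ => (X.mulVec θ.1 i, θ.2)) θ := by
    intro i
    refine ContDiffAt.prodMk ?_ contDiffAt_snd
    simp only [Matrix.mulVec, dotProduct]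
    fun_prop
  rcases j with k | k
  · refine ContDiffAt.sum fun i _ => ContDiffAt.mul ?_ contDiffAt_const
    exact (contDiffAt_score1 (α := α) (v := y i) (q := (X.mulVec θ.1 i, θ.2)) hθ).comp θ (hpair i)
  · refine ContDiffAt.sum fun i _ => ?_
    exact (contDiffAt_score2 (α := α) (v := y i) (q := (X.mulVec θ.1 i, θ.2)) hθ).comp θ (hpair i)

theorem contDiffAt_gammaFun (j : Fin p ⊕ Unit) {z : Supp β₀ ⊕ Unit → ℝ} (hz : 0 < z (Sum.inr ())) :
    ContDiffAt ℝ 2 (gammaFun α X y β₀ j) z := by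
  have : gammaFun α X y β₀ j = fun z => fullScore α X y j (extend β₀ z, z (Sum.inr ())) :=
    funext fun z => gammaFun_eq_fullScore j z
  rw [this]
  exact (contDiffAt_fullScore (α := α) (X := X) (y := y) j
    (θ := (extend β₀ z, z (Sum.inr ()))) hz).comp z
      (contDiff_extend.contDiffAt.prodMk (contDiff_apply ℝ ℝ _).contDiffAt)

theorem sum_mul_extend (a : Fin p → ℝ) (v : Supp β₀ ⊕ Unit → ℝ) :
    ∑ j, a j * extend β₀ v j = ∑ k : Supp β₀, a k * v (Sum.inl k) := by
  rw [← Fintype.sum_subtype_add_sum_subtype (fun j => β₀ j ≠ 0) fun j => a j * extend β₀ v j]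
  rw [Finset.sum_eq_zero (s := (Finset.univ : Finset {j // ¬ β₀ j ≠ 0})), add_zero]
  · refine Finset.sum_congr rfl fun k _ => ?_
    simp [extend, k.2]
  · rintro k -
    simp [extend, k.2]

/-- The position of an index of `q` (or of the scale) among all parameters. -/
abbrev paramIdx {p : ℕ} {q : Fin p → Prop} : {j : Fin p // q j} ⊕ Unit → Fin p ⊕ Unit :=
  Sum.map Subtype.val id

theorem designStar_mulVec (v : Supp β₀ ⊕ Unit → ℝ) :
    (designStar X fun j => β₀ j ≠ 0).mulVec v =
      Sum.elim (X.mulVec (extend β₀ v)) (fun _ => v (Sum.inr ())) := by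
  ext i
  rcases i with i | i
  · simp only [designStar, Matrix.fromBlocks_mulVec, Sum.elim_inl, Matrix.zero_mulVec, add_zero]
    simp only [Matrix.mulVec, dotProduct, Matrix.submatrix_apply, Function.comp]
    exact (sum_mul_extend (X i) v).symm
  · simp [designStar, Matrix.mulVec, dotProduct]

/-- The derivatives of the scores are minus the entries of `X*ᵀ Σ X*_S`. -/
theorem fderiv_gammaFun (q : Fin p → Prop) (k : {j : Fin p // q j} ⊕ Unit)
    {z : Supp β₀ ⊕ Unit → ℝ} (hz : 0 < z (Sum.inr ())) (v : Supp β₀ ⊕ Unit → ℝ) :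
    fderiv ℝ (gammaFun α X y β₀ (paramIdx k)) z v =
      -(((designStar X q).transpose * sigmaMat α X y (extend β₀ z) (z (Sum.inr ())) *
        designStar X fun j => β₀ j ≠ 0).mulVec v) k := by
  have hd : DifferentiableAt ℝ (gammaFun α X y β₀ (paramIdx k)) z :=
    (contDiffAt_gammaFun _ hz).differentiableAt (by norm_num)
  have hline : HasDerivAt (fun t : ℝ => z + t • v) v 0 := by
    simpa using ((hasDerivAt_id' (0 : ℝ)).smul_const v).const_add z
  have h1 : HasDerivAt (fun t : ℝ => gammaFun α X y β₀ (paramIdx k) (z + t • v))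
      (fderiv ℝ (gammaFun α X y β₀ (paramIdx k)) z v) 0 := by
    have := (show DifferentiableAt ℝ (gammaFun α X y β₀ (paramIdx k)) (z + (0 : ℝ) • v) by
      simpa using hd).hasFDerivAt.comp_hasDerivAt 0 hline
    rw [zero_smul, add_zero] at this
    exact this
  -- the same derivative along the line, computed observation by observation
  refine h1.unique ?_
  have hσ : 0 < z (Sum.inr ()) + 0 * v (Sum.inr ()) := by simpa using hz
  simp only [gammaFun_eq_fullScore, extend_add_smul, Pi.add_apply, Pi.smul_apply, smul_eq_mul,
    ← Matrix.mulVec_mulVec, designStar_mulVec, sigmaMat, Matrix.fromBlocks_mulVec]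
  have hm := fun i => hasDerivAt_linearPredictor (X := X) (extend β₀ z) (extend β₀ v) i 0
  have hs := hasDerivAt_scale_line (z (Sum.inr ())) (v (Sum.inr ())) 0
  rcases k with k | k
  · simp only [Sum.map_inl, fullScore, designStar, Matrix.fromBlocks_transpose,
      Matrix.fromBlocks_mulVec, Sum.elim_inl]
    refine (HasDerivAt.fun_sum fun i _ => ((hasDerivAt_comp_curve (f := score1 α (y i))
      ((contDiffAt_score1 hσ).differentiableAt (by norm_num)) (hm i) hs).mul_const
        (X i k))).congr_deriv ?_
    simp only [zero_smul, add_zero, zero_mul]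
    generalize X.mulVec (extend β₀ v) = w
    generalize X.mulVec (extend β₀ z) = m
    simp [Matrix.mulVec, dotProduct, Matrix.diagonal_apply, J11, J12, ← Finset.sum_neg_distrib]
    refine Finset.sum_congr rfl fun i _ => ?_
    ring
  · simp only [Sum.map_inr, fullScore, designStar, Matrix.fromBlocks_transpose,
      Matrix.fromBlocks_mulVec, Sum.elim_inr]
    refine (HasDerivAt.fun_sum fun i _ => (hasDerivAt_comp_curve (f := score2 α (y i))
      ((contDiffAt_score2 hσ).differentiableAt (by norm_num)) (hm i) hs)).congr_deriv ?_
    simp only [zero_smul, add_zero, zero_mul]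
    generalize X.mulVec (extend β₀ v) = w
    generalize X.mulVec (extend β₀ z) = m
    simp [Matrix.mulVec, dotProduct, Matrix.diagonal_apply, J21, J22, ← Finset.sum_neg_distrib]
    refine Finset.sum_congr rfl fun i _ => ?_
    ring

theorem isSymm_infoSS (hα : 0 ≤ α) {z : Supp β₀ ⊕ Unit → ℝ} (hz : 0 < z (Sum.inr ())) :
    (infoSS α X y β₀ z).IsSymm := by
  have hS : (sigmaMat α X y (extend β₀ z) (z (Sum.inr ()))).transpose =
      sigmaMat α X y (extend β₀ z) (z (Sum.inr ())) := by
    simp only [sigmaMat, Matrix.fromBlocks_transpose, Matrix.diagonal_transpose,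
      J12_eq_J21 hz hα]
  simp only [Matrix.IsSymm, infoSS, Matrix.transpose_mul, Matrix.transpose_transpose, hS,
    Matrix.mul_assoc]

end Scores

/-! ### Stationary points and strict local minimizers of smooth functions -/

section LineCalculus

theorem exists_deriv_eq_sub {φ φ' : ℝ → ℝ} (h : ∀ t ∈ Set.Icc (0 : ℝ) 1, HasDerivAt φ (φ' t) t) :
    ∃ t ∈ Set.Ioo (0 : ℝ) 1, φ 1 - φ 0 = φ' t := by
  obtain ⟨t, ht, hs⟩ := exists_hasDerivAt_eq_slope φ φ' zero_lt_one
    (fun t ht => (h t ht).continuousAt.continuousWithinAt)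
    (fun t ht => h t (Set.Ioo_subset_Icc_self ht))
  exact ⟨t, ht, by simpa using hs.symm⟩

variable {E : Type*} [NormedAddCommGroup E] [NormedSpace ℝ E]

theorem hasDerivAt_line_of_hasDerivAt_zero {F : E → ℝ} {a v : E} {t d : ℝ}
    (h : HasDerivAt (fun s : ℝ => F ((a + t • v) + s • v)) d 0) :
    HasDerivAt (fun s : ℝ => F (a + s • v)) d t := by
  rw [← sub_self t] at h
  refine (h.comp_sub_const t t).congr_of_eventuallyEq (Eventually.of_forall fun s => ?_)
  simp only [sub_smul]
  congr 1
  abel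

theorem hasDerivAt_line {F : E → ℝ} {a v : E} {t : ℝ} (h : DifferentiableAt ℝ F (a + t • v)) :
    HasDerivAt (fun s : ℝ => F (a + s • v)) (fderiv ℝ F (a + t • v) v) t := by
  have hline : HasDerivAt (fun t : ℝ => a + t • v) v t := by
    simpa using ((hasDerivAt_id' t).smul_const v).const_add a
  exact h.hasFDerivAt.comp_hasDerivAt t hline

end LineCalculus

section Hessian

variable {ι : Type*} [Fintype ι] [DecidableEq ι]

theorem hessian_bilin {f : (ι → ℝ) → ℝ} {z : ι → ℝ} (hf : ContDiffAt ℝ 2 f z) (v u : ι → ℝ) :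
    v ⬝ᵥ (hessian f z).mulVec u = fderiv ℝ (fderiv ℝ f) z u v := by
  have hd : DifferentiableAt ℝ (fderiv ℝ f) z :=
    (hf.fderiv_right (m := 1) (by norm_num)).differentiableAt (by norm_num)
  have h1 : ∀ a b, hessian f z a b =
      fderiv ℝ (fderiv ℝ f) z (Pi.single b 1) (Pi.single a 1) := by
    intro a b
    simp only [hessian, Matrix.of_apply]
    rw [fderiv_clm_apply hd (differentiableAt_const _)]
    simp
  have hsum : ∀ w : ι → ℝ, w = ∑ i, w i • (Pi.single i 1 : ι → ℝ) := fun w =>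
    (pi_eq_sum_univ' w).trans (by simp [Pi.single])
  conv_rhs => rw [hsum v, hsum u]
  simp only [map_sum, map_smul, sum_apply, smul_apply,
    smul_eq_mul, dotProduct, Matrix.mulVec, h1, Finset.mul_sum]
  refine Finset.sum_congr rfl fun i _ => Finset.sum_congr rfl fun j _ => ?_
  ring

theorem hessian_isSymm {f : (ι → ℝ) → ℝ} {z : ι → ℝ} (hf : ContDiffAt ℝ 2 f z) :
    (hessian f z).IsSymm := by
  have hd : DifferentiableAt ℝ (fderiv ℝ f) z :=
    (hf.fderiv_right (m := 1) (by norm_num)).differentiableAt (by norm_num)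
  ext a b
  simp only [Matrix.transpose_apply, hessian, Matrix.of_apply]
  rw [fderiv_clm_apply hd (differentiableAt_const _),
    fderiv_clm_apply hd (differentiableAt_const _)]
  simpa using hf.isSymmSndFDerivAt (by simp) (Pi.single a 1) (Pi.single b 1)

/-- A bound on the eigenvalues of the Hessian makes the derivative Lipschitz. -/
theorem abs_fderiv_sub_le {f : (ι → ℝ) → ℝ} {s : Set (ι → ℝ)} (hs : Convex ℝ s)
    (hf : ∀ z ∈ s, ContDiffAt ℝ 2 f z) {c : ℝ} (hc0 : 0 ≤ c)
    (hc : ∀ z ∈ s, maxAbsEig (hessian f z) ≤ c) {a w : ι → ℝ} (ha : a ∈ s) (hw : w ∈ s)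
    (v : ι → ℝ) :
    |fderiv ℝ f w v - fderiv ℝ f a v| ≤ c * Fintype.card ι * ‖v‖ * ‖w - a‖ := by
  have hmem : ∀ t ∈ Set.Icc (0 : ℝ) 1, a + t • (w - a) ∈ s := fun t ht =>
    hs.add_smul_sub_mem ha hw ht
  have hder : ∀ t ∈ Set.Icc (0 : ℝ) 1, HasDerivAt (fun t : ℝ => fderiv ℝ f (a + t • (w - a)) v)
      (fderiv ℝ (fderiv ℝ f) (a + t • (w - a)) (w - a) v) t := by
    intro t ht
    have hd : DifferentiableAt ℝ (fderiv ℝ f) (a + t • (w - a)) :=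
      ((hf _ (hmem t ht)).fderiv_right (m := 1) (by norm_num)).differentiableAt (by norm_num)
    have := hasDerivAt_line (F := fun z => fderiv ℝ f z v) (a := a) (v := w - a) (t := t)
      (hd.clm_apply (differentiableAt_const v))
    rw [fderiv_clm_apply hd (differentiableAt_const _)] at this
    simpa using this
  obtain ⟨t, ht, h⟩ := exists_deriv_eq_sub hder
  have ht' := Set.Ioo_subset_Icc_self ht
  simp only [one_smul, zero_smul, add_zero, add_sub_cancel] at h
  rw [h, ← hessian_bilin (hf _ (hmem t ht'))]
  exact abs_bilinForm_le (hessian_isSymm (hf _ (hmem t ht'))) hc0 (hc _ (hmem t ht')) _ _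

theorem abs_taylor_remainder_le {f : (ι → ℝ) → ℝ} {s : Set (ι → ℝ)} (hs : Convex ℝ s)
    (hf : ∀ z ∈ s, ContDiffAt ℝ 2 f z) {c : ℝ} (hc0 : 0 ≤ c)
    (hc : ∀ z ∈ s, maxAbsEig (hessian f z) ≤ c) {a w : ι → ℝ} (ha : a ∈ s) (hw : w ∈ s) :
    |f w - f a - fderiv ℝ f a (w - a)| ≤ c * Fintype.card ι * ‖w - a‖ ^ 2 := by
  have hmem : ∀ t ∈ Set.Icc (0 : ℝ) 1, a + t • (w - a) ∈ s := fun t ht =>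
    hs.add_smul_sub_mem ha hw ht
  obtain ⟨t, ht, h⟩ := exists_deriv_eq_sub fun t ht =>
    hasDerivAt_line (F := f) (a := a) (v := w - a) (t := t)
      ((hf _ (hmem t ht)).differentiableAt (by norm_num))
  have ht' := Set.Ioo_subset_Icc_self ht
  simp only [one_smul, zero_smul, add_zero, add_sub_cancel] at h
  rw [h]
  refine (abs_fderiv_sub_le hs hf hc0 hc ha (hmem t ht') (w - a)).trans ?_
  have h1 : ‖a + t • (w - a) - a‖ ≤ ‖w - a‖ := by
    rw [add_sub_cancel_left, norm_smul, Real.norm_eq_abs, abs_of_nonneg ht'.1]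
    exact mul_le_of_le_one_left (norm_nonneg (w - a)) ht'.2
  calc c * Fintype.card ι * ‖w - a‖ * ‖a + t • (w - a) - a‖
      ≤ c * Fintype.card ι * ‖w - a‖ * ‖w - a‖ := by gcongr
    _ = _ := by ring

end Hessian

section Stationary

variable {ι : Type*} [Fintype ι]

/-- Existence of a stationary point in a cube. At a minimizer over the cube the gradient `g` points
inwards, so that `g ⬝ (z - z₀) ≤ -r ‖g‖₁`; if `A g` is close to `z - z₀` for a positive semidefinite
`A`, this forces `g = 0`. -/
theorem exists_stationary [Nonempty ι] {F : (ι → ℝ) → ℝ} {g : (ι → ℝ) → ι → ℝ} {z₀ : ι → ℝ}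
    {r η : ℝ} (hr : 0 < r) (hη : η < 1) (hF : ContinuousOn F (Metric.closedBall z₀ r))
    (hg : ∀ z ∈ Metric.closedBall z₀ r, ∀ v : ι → ℝ,
      HasDerivAt (fun t : ℝ => F (z + t • v)) (g z ⬝ᵥ v) 0)
    {A : Matrix ι ι ℝ} (hA : ∀ v, 0 ≤ v ⬝ᵥ A.mulVec v)
    (happrox : ∀ z ∈ Metric.closedBall z₀ r, ∀ k, |(z - z₀) k - A.mulVec (g z) k| ≤ η * r) :
    ∃ z ∈ Metric.closedBall z₀ r, g z = 0 ∧ ‖z - z₀‖ ≤ η * r := by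
  obtain ⟨z, hz, hmin⟩ := (isCompact_closedBall z₀ r).exists_isMinOn
    ⟨z₀, Metric.mem_closedBall_self hr.le⟩ hF
  have happ := happrox z hz
  have hvar : ∀ w ∈ Metric.closedBall z₀ r, 0 ≤ g z ⬝ᵥ (w - z) := by
    intro w hw
    have hd := hg z hz (w - z)
    have hmin' : IsLocalMinOn (fun t : ℝ => F (z + t • (w - z))) (Set.Icc 0 1) 0 := by
      refine IsMinOn.localize fun t ht => ?_
      simpa using hmin ((convex_closedBall z₀ r).add_smul_sub_mem hz hw ht)
    have := hmin'.hasFDerivWithinAt_nonneg hd.hasDerivWithinAt.hasFDerivWithinAt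
      (y := 1 - 0) (sub_mem_posTangentConeAt_of_segment_subset
        (by rw [segment_eq_Icc zero_le_one]))
    simpa using this
  set w : ι → ℝ := fun k => z₀ k - r * SignType.sign (g z k) with hw
  have hwmem : w ∈ Metric.closedBall z₀ r := by
    rw [Metric.mem_closedBall, dist_pi_le_iff hr.le]
    intro k
    rw [Real.dist_eq, hw]
    rcases lt_trichotomy (g z k) 0 with h | h | h <;> simp [h, abs_of_pos hr, hr.le]
  have h1 := hvar w hwmem
  have h2 := hA (g z)
  have h3 : ∀ k, g z k * (w - z) k ≤
      -(g z k * (A.mulVec (g z)) k) - (1 - η) * r * |g z k| := by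
    intro k
    have hs : g z k * (SignType.sign (g z k) : ℝ) = |g z k| := self_mul_sign (g z k)
    have hb : -(g z k * ((z - z₀) k - A.mulVec (g z) k)) ≤ |g z k| * (η * r) := by
      refine (neg_le_abs _).trans ?_
      rw [abs_mul]
      gcongr
      exact happ k
    have : g z k * (w - z) k = -r * (g z k * SignType.sign (g z k)) -
        g z k * ((z - z₀) k - A.mulVec (g z) k) - g z k * A.mulVec (g z) k := by
      simp only [hw, Pi.sub_apply]
      ring
    rw [this, hs]
    linarith
  have h4 : g z ⬝ᵥ (w - z) ≤ -(g z ⬝ᵥ A.mulVec (g z)) - (1 - η) * r * ∑ k, |g z k| := by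
    refine (Finset.sum_le_sum fun k _ => h3 k).trans_eq ?_
    rw [Finset.sum_sub_distrib, Finset.sum_neg_distrib, Finset.mul_sum]
    rfl
  have hpos : 0 < (1 - η) * r := mul_pos (by linarith) hr
  have h5 : ∑ k, |g z k| ≤ 0 := by
    by_contra! h
    have := mul_pos hpos h
    linarith
  have hg0 : g z = 0 := by
    funext k
    have := Finset.single_le_sum (f := fun k => |g z k|) (fun k _ => abs_nonneg _)
      (Finset.mem_univ k)
    exact abs_nonpos_iff.mp (this.trans h5)
  refine ⟨z, hz, hg0, ?_⟩
  have hnn : 0 ≤ η * r := (abs_nonneg _).trans (happ (Classical.arbitrary ι))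
  rw [pi_norm_le_iff_of_nonneg hnn]
  intro k
  simpa [hg0] using happ k

/-- If the gradient `g` of `F` satisfies `g z ⬝ (z - z₁) > 0` near `z₁`, then `z₁` is a strict
local minimizer. -/
theorem isStrictLocalMin_of_gradient {F : (ι → ℝ) → ℝ} {g : (ι → ℝ) → ι → ℝ} {z₁ : ι → ℝ}
    (hg : ∀ᶠ z in 𝓝 z₁, ∀ v : ι → ℝ, HasDerivAt (fun t : ℝ => F (z + t • v)) (g z ⬝ᵥ v) 0)
    (hpos : ∀ᶠ z in 𝓝 z₁, z ≠ z₁ → 0 < g z ⬝ᵥ (z - z₁)) : IsStrictLocalMin F z₁ := by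
  obtain ⟨δ, hδ, hball⟩ := Metric.eventually_nhds_iff_ball.mp (hg.and hpos)
  refine eventually_nhdsWithin_iff.mpr ?_
  filter_upwards [Metric.ball_mem_nhds z₁ hδ] with z hz hne
  have hmem : ∀ t ∈ Set.Icc (0 : ℝ) 1, z₁ + t • (z - z₁) ∈ Metric.ball z₁ δ := fun t ht =>
    (convex_ball z₁ δ).add_smul_sub_mem (Metric.mem_ball_self hδ) hz ht
  obtain ⟨t, ht, h⟩ := exists_deriv_eq_sub fun t ht => hasDerivAt_line_of_hasDerivAt_zero
    ((hball _ (hmem t ht)).1 (z - z₁))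
  simp only [one_smul, zero_smul, add_zero, add_sub_cancel] at h
  have hne' : z₁ + t • (z - z₁) ≠ z₁ := by
    simpa [sub_eq_zero, ht.1.ne'] using hne
  have h2 := (hball _ (hmem t (Set.Ioo_subset_Icc_self ht))).2 hne'
  rw [add_sub_cancel_left, dotProduct_smul, smul_eq_mul] at h2
  have h3 := pos_of_mul_pos_right h2 ht.1.le
  linarith

end Stationary

/-! ### The penalty and the objective on the support -/

section Penalty

variable {pen : ℝ → ℝ → ℝ} {l : ℝ}

theorem PenaltyCondition.differentiableOn (hpen : PenaltyCondition pen) (hl : 0 < l) :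
    DifferentiableOn ℝ (pen l) (Set.Ici 0) :=
  (hpen.contDiff l hl).differentiableOn (by norm_num)

theorem PenaltyCondition.antitoneOn_dpen (hpen : PenaltyCondition pen) (hl : 0 < l) :
    AntitoneOn (dpen pen l) (Set.Ici 0) :=
  (hpen.concave l hl).antitoneOn_derivWithin (hpen.differentiableOn hl)

theorem PenaltyCondition.dpen_nonneg (hpen : PenaltyCondition pen) (hl : 0 < l) (t : ℝ) :
    0 ≤ dpen pen l t :=
  (hpen.monotone l hl).derivWithin_nonneg

theorem PenaltyCondition.hasDerivAt_abs (hpen : PenaltyCondition pen) (hl : 0 < l) {x : ℝ}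
    (hx : x ≠ 0) :
    HasDerivAt (fun x => pen l |x|) (dpen pen l |x| * SignType.sign x) x := by
  have hx' : 0 < |x| := abs_pos.mpr hx
  have h1 : HasDerivAt (pen l) (dpen pen l |x|) |x| :=
    ((hpen.differentiableOn hl) |x| hx'.le).hasDerivWithinAt.hasDerivAt (Ici_mem_nhds hx')
  exact h1.comp x (_root_.hasDerivAt_abs hx)

/-- The local concavity of a concave penalty is nonnegative. -/
theorem PenaltyCondition.localConcavity_nonneg {ι : Type*} [Nonempty ι]
    (hpen : PenaltyCondition pen) (hl : 0 < l) (b : ι → ℝ) : 0 ≤ localConcavity pen l b := by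
  refine le_iInf₂ fun e he => ?_
  have j := Classical.arbitrary ι
  have h0 : 0 ≤ |b j| := abs_nonneg _
  refine le_trans ?_ (le_iSup₂_of_le j |b j| (le_iSup₂_of_le (|b j| + e / 2)
    ⟨h0, by linarith, by simpa using he, by rw [add_sub_cancel_left, abs_of_pos] <;> linarith⟩
    le_rfl))
  rw [EReal.coe_nonneg, neg_nonneg]
  exact div_nonpos_of_nonpos_of_nonneg
    (sub_nonpos.mpr (hpen.antitoneOn_dpen hl h0 (by simp; linarith) (by linarith))) (by linarith)

/-- A bound on the local concavity is a one-sided Lipschitz bound for the penalty derivative. -/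
theorem exists_dpen_lipschitz_of_localConcavity_lt {ι : Type*} {b : ι → ℝ} {x : ℝ}
    (h : localConcavity pen l b < (x : EReal)) :
    ∃ e > 0, ∀ (j : ι) (t : ℝ), 0 ≤ t → |t - abs (b j)| < e →
      -(x * (t - abs (b j)) ^ 2) ≤ (dpen pen l t - dpen pen l (abs (b j))) * (t - abs (b j)) := by
  simp only [localConcavity, iInf_lt_iff] at h
  obtain ⟨e, he, hlt⟩ := h
  have key : ∀ j t₁ t₂, 0 ≤ t₁ → t₁ < t₂ → |t₁ - abs (b j)| < e → |t₂ - abs (b j)| < e →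
      -(x * (t₂ - t₁) ^ 2) ≤ (dpen pen l t₂ - dpen pen l t₁) * (t₂ - t₁) := by
    intro j t₁ t₂ h0 h12 h1 h2
    have hle := (le_iSup₂_of_le (f := fun (j : ι) (t₁ : ℝ) => ⨆ (t₂ : ℝ)
      (_ : 0 ≤ t₁ ∧ t₁ < t₂ ∧ |t₁ - abs (b j)| < e ∧ |t₂ - abs (b j)| < e),
      ((-((dpen pen l t₂ - dpen pen l t₁) / (t₂ - t₁)) : ℝ) : EReal)) j t₁
      (le_iSup₂_of_le t₂ ⟨h0, h12, h1, h2⟩ le_rfl)).trans hlt.le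
    rw [EReal.coe_le_coe_iff] at hle
    have hpos : 0 < t₂ - t₁ := by linarith
    have h3 : -(x * (t₂ - t₁)) ≤ dpen pen l t₂ - dpen pen l t₁ := by
      have := (le_div_iff₀ hpos).mp (neg_le.mp hle)
      linarith
    calc -(x * (t₂ - t₁) ^ 2) = -(x * (t₂ - t₁)) * (t₂ - t₁) := by ring
      _ ≤ _ := by gcongr
  refine ⟨e, he, fun j t ht hte => ?_⟩
  have hbj : |abs (b j) - abs (b j)| < e := by simpa using he
  rcases lt_trichotomy t (abs (b j)) with h | h | h
  · have := key j t (abs (b j)) ht h hte hbj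
    calc _ = -(x * (abs (b j) - t) ^ 2) := by ring
      _ ≤ _ := this
      _ = _ := by ring
  · simp [h]
  · exact key j (abs (b j)) t (abs_nonneg _) h hbj hte

theorem PenaltyCondition.eventually_lt_sub (hpen : PenaltyCondition pen) (hl : 0 < l) {c : ℝ}
    (hc : c < dpen pen l 0) : ∀ᶠ t in 𝓝[>] (0 : ℝ), c * t < pen l t - pen l 0 := by
  have h := ((hpen.differentiableOn hl) 0 Set.self_mem_Ici).hasDerivWithinAt
  have h1 := hasDerivWithinAt_iff_tendsto_slope.mp h
  rw [Set.Ici_sdiff_left] at h1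
  filter_upwards [h1.eventually_const_lt hc, self_mem_nhdsWithin] with t ht hpos
  rw [slope_def_field, sub_zero] at ht
  exact (lt_div_iff₀ hpos).mp ht

end Penalty

section Objective

variable {n p : ℕ} {α : ℝ} {X : Matrix (Fin n) (Fin p) ℝ} {y : Fin n → ℝ} {β₀ : Fin p → ℝ}
  {pen : ℝ → ℝ → ℝ} {l : ℝ}

/-- The gradient of the objective in `(δ, σ)`, at points all of whose coefficients are nonzero. -/
noncomputable def reducedGradient (α : ℝ) (pen : ℝ → ℝ → ℝ) (l : ℝ)
    (X : Matrix (Fin n) (Fin p) ℝ) (y : Fin n → ℝ) (β₀ : Fin p → ℝ)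
    (z : Supp β₀ ⊕ Unit → ℝ) (k : Supp β₀ ⊕ Unit) : ℝ :=
  -(1 / (n : ℝ)) * gammaFun α X y β₀ (paramIdx k) z +
    Sum.elim (fun j => dpen pen l |z (Sum.inl j)| * SignType.sign (z (Sum.inl j)))
      (fun _ => 0) k

theorem hasDerivAt_reducedObjective (hn : n ≠ 0) (hα : 0 ≤ α) (hpen : PenaltyCondition pen)
    (hl : 0 < l) {z : Supp β₀ ⊕ Unit → ℝ} (hz : 0 < z (Sum.inr ()))
    (hz0 : ∀ j, z (Sum.inl j) ≠ 0) (v : Supp β₀ ⊕ Unit → ℝ) :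
    HasDerivAt (fun t : ℝ => objective α pen l X y
        (extend β₀ (z + t • v), (z + t • v) (Sum.inr ())))
      (reducedGradient α pen l X y β₀ z ⬝ᵥ v) 0 := by
  simp only [objective, extend_add_smul, Pi.add_apply, Pi.smul_apply, smul_eq_mul]
  have hσ : 0 < z (Sum.inr ()) + 0 * v (Sum.inr ()) := by simpa using hz
  have h1 := hasDerivAt_rpLoss_line (X := X) (y := y) hn hα (extend β₀ z) (extend β₀ v) hσ
  have h2 : ∀ j ∈ (Finset.univ : Finset (Fin p)), HasDerivAt
      (fun t : ℝ => pen l |extend β₀ z j + t * extend β₀ v j|)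
      (dpen pen l |extend β₀ z j| * SignType.sign (extend β₀ z j) * extend β₀ v j) 0 := by
    intro j _
    by_cases h : β₀ j = 0
    · simpa [extend, h] using hasDerivAt_const (0 : ℝ) (pen l 0)
    · have hne : extend β₀ z j ≠ 0 := by simpa [extend, h] using hz0 ⟨j, h⟩
      have hne' : extend β₀ z j + 0 * extend β₀ v j ≠ 0 := by simpa using hne
      have := (hpen.hasDerivAt_abs hl hne').comp 0
        (hasDerivAt_scale_line (extend β₀ z j) (extend β₀ v j) 0)
      simp only [zero_mul, add_zero] at this
      exact this
  refine (h1.add (HasDerivAt.fun_sum h2)).congr_deriv ?_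
  rw [sum_mul_extend, sum_mul_extend]
  simp only [zero_smul, zero_mul, add_zero, dotProduct, Fintype.sum_sum_type, reducedGradient,
    gammaFun_eq_fullScore, Sum.map_inl, Sum.map_inr, Sum.elim_inl, Sum.elim_inr, id,
    Finset.univ_unique, Finset.sum_singleton, add_mul, Finset.sum_add_distrib, mul_add,
    Finset.mul_sum, mul_assoc]
  have : ∀ k : Supp β₀, extend β₀ z k = z (Sum.inl k) := fun k => by simp [extend, k.2]
  simp only [this, PUnit.default_eq_unit]

theorem continuousOn_reducedObjective (hn : n ≠ 0) (hpen : PenaltyCondition pen) (hl : 0 < l)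
    {s : Set (Supp β₀ ⊕ Unit → ℝ)} (hs : ∀ z ∈ s, 0 < z (Sum.inr ())) :
    ContinuousOn (fun z : Supp β₀ ⊕ Unit → ℝ =>
      objective α pen l X y (extend β₀ z, z (Sum.inr ()))) s := by
  have hext : Continuous (extend β₀) := contDiff_extend.continuous
  refine ContinuousOn.add ?_ ?_
  · simp only [rpLoss_eq_sum_obsLoss hn]
    refine continuousOn_const.mul (continuousOn_finsetSum _ fun i _ z hz => ?_)
    have h1 : ContinuousAt (fun q : ℝ × ℝ => obsLoss α (y i) q.1 q.2)
        (X.mulVec (extend β₀ z) i, z (Sum.inr ())) :=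
      (differentiableAt_obsLoss (hs z hz)).continuousAt
    have h2 : ContinuousAt (fun z => (X.mulVec (extend β₀ z) i, z (Sum.inr ()))) z := by
      refine ContinuousAt.prodMk ?_ (continuous_apply _).continuousAt
      simp only [Matrix.mulVec, dotProduct]
      fun_prop
    exact (ContinuousAt.comp (f := fun z => (X.mulVec (extend β₀ z) i, z (Sum.inr ()))) h1
      h2).continuousWithinAt
  · refine continuousOn_finsetSum _ fun j _ => ?_
    refine (hpen.differentiableOn hl).continuousOn.comp (f := fun z => |extend β₀ z j|) ?_
      fun z _ => abs_nonneg (extend β₀ z j)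
    fun_prop

end Objective

/-! ### From the support to the full parameter space -/

section FullSpace

variable {n p : ℕ} {α : ℝ} {X : Matrix (Fin n) (Fin p) ℝ} {y : Fin n → ℝ} {β₀ : Fin p → ℝ}
  {pen : ℝ → ℝ → ℝ} {l : ℝ}

/-- A strict local minimizer in the coordinates of the support stays one in the full parameter
space if the remaining scores are below the slope of the penalty at `0`: moving a null coefficient
away from `0` then costs more penalty than it can gain in loss. -/
theorem isStrictLocalMin_objective (hn : n ≠ 0) (hα : 0 ≤ α) (hpen : PenaltyCondition pen)
    (hl : 0 < l) {z : Supp β₀ ⊕ Unit → ℝ} (hz : 0 < z (Sum.inr ()))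
    (hmin : IsStrictLocalMin (fun w : Supp β₀ ⊕ Unit → ℝ =>
      objective α pen l X y (extend β₀ w, w (Sum.inr ()))) z)
    (hN : ∀ k : Null β₀, |gammaFun α X y β₀ (paramIdx (Sum.inl k)) z| < n * dpen pen l 0) :
    IsStrictLocalMin (objective α pen l X y) (extend β₀ z, z (Sum.inr ())) := by
  have hn' : (0 : ℝ) < n := Nat.cast_pos.mpr (Nat.pos_of_ne_zero hn)
  set θ₁ : (Fin p → ℝ) × ℝ := (extend β₀ z, z (Sum.inr ())) with hθ₁
  set res : (Fin p → ℝ) × ℝ → (Supp β₀ ⊕ Unit → ℝ) := fun θ =>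
    Sum.elim (fun j => θ.1 j) (fun _ => θ.2) with hres
  have hres₁ : res θ₁ = z := by
    funext k
    rcases k with k | k
    · simp [hres, hθ₁, extend, k.2]
    · rfl
  have hrescont : Continuous res := by
    refine continuous_pi fun k => ?_
    rcases k with k | k
    · exact (continuous_apply _).comp continuous_fst
    · exact continuous_snd
  have hF : ∀ᶠ θ in 𝓝 θ₁, res θ ≠ z → objective α pen l X y θ₁ <
      objective α pen l X y (extend β₀ (res θ), θ.2) := by
    have h1 := eventually_nhdsWithin_iff.mp hmin
    rw [← hres₁] at h1
    have h2 := hrescont.continuousAt.eventually h1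
    simp only [hres₁] at h2
    exact h2
  -- a slope strictly between the score and the slope of the penalty at `0`
  have hslope : ∀ k : Null β₀, ∃ c < dpen pen l 0,
      (1 / (n : ℝ)) * |fullScore α X y (Sum.inl k) θ₁| < c := by
    intro k
    have h1 := hN k
    rw [gammaFun_eq_fullScore, ← hθ₁] at h1
    have h2 : (1 / (n : ℝ)) * |fullScore α X y (Sum.inl k) θ₁| < dpen pen l 0 := by
      rw [one_div, inv_mul_lt_iff₀ hn']
      exact h1
    obtain ⟨c, hc1, hc2⟩ := exists_between h2
    exact ⟨c, hc2, hc1⟩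
  choose c hc1 hc2 using hslope
  have hscore : ∀ᶠ θ in 𝓝 θ₁, ∀ k : Null β₀,
      (1 / (n : ℝ)) * |fullScore α X y (Sum.inl k) θ| < c k := by
    refine eventually_all.mpr fun k => ?_
    have hc : ContinuousAt (fun θ => (1 / (n : ℝ)) * |fullScore α X y (Sum.inl k) θ|) θ₁ :=
      continuousAt_const.mul (contDiffAt_fullScore (Sum.inl k) (θ := θ₁) hz).continuousAt.abs
    exact hc.eventually_lt_const (hc2 k)
  have hpenalty : ∀ᶠ θ in 𝓝 θ₁, ∀ k : Null β₀, θ.1 k ≠ 0 →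
      c k * |θ.1 k| < pen l |θ.1 k| - pen l 0 := by
    refine eventually_all.mpr fun k => ?_
    have h1 := eventually_nhdsWithin_iff.mp (hpen.eventually_lt_sub hl (hc1 k))
    have h2 : Tendsto (fun θ : (Fin p → ℝ) × ℝ => |θ.1 k|) (𝓝 θ₁) (𝓝 0) := by
      have hc : Continuous fun θ : (Fin p → ℝ) × ℝ => |θ.1 k| := by fun_prop
      have := hc.tendsto θ₁
      simpa [hθ₁, extend, k.2] using this
    filter_upwards [h2.eventually h1] with θ hθ hne
    exact hθ (abs_pos.mpr hne)
  have hσ : ∀ᶠ θ in 𝓝 θ₁, 0 < θ.2 := continuousAt_snd.eventually_const_lt (v := θ₁.2) hz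
  obtain ⟨δ, hδ, hball⟩ := Metric.eventually_nhds_iff_ball.mp
    (hF.and (hscore.and (hpenalty.and hσ)))
  refine eventually_nhdsWithin_iff.mpr ?_
  filter_upwards [Metric.ball_mem_nhds θ₁ hδ] with θ hθ hne
  obtain ⟨hF', -, hpen', hσ'⟩ := hball θ hθ
  set β' : Fin p → ℝ := extend β₀ (res θ) with hβ'
  have hβ'S : ∀ j, β₀ j ≠ 0 → β' j = θ.1 j := fun j hj => by simp [hβ', hres, extend, hj]
  have hβ'N : ∀ j, β₀ j = 0 → β' j = 0 := fun j hj => by simp [hβ', extend, hj]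
  by_cases hcase : θ.1 = β'
  · have hθ' : θ = (β', θ.2) := Prod.ext hcase rfl
    have hrne : res θ ≠ z := fun hzeq => hne (by
      rw [hθ', hβ', hzeq, hθ₁, ← hzeq]
      rfl)
    have := hF' hrne
    rwa [← hθ'] at this
  · have hle : objective α pen l X y θ₁ ≤ objective α pen l X y (β', θ.2) := by
      by_cases hzeq : res θ = z
      · have : θ₁ = (β', θ.2) := by
          rw [hβ', hθ₁, hzeq, ← hzeq]
          rfl
        rw [this]
      · exact (hF' hzeq).le
    refine hle.trans_lt ?_
    -- mean value theorem on the segment from `(β', θ.2)` to `θ`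
    have hmem' : (β', θ.2) ∈ Metric.ball θ₁ δ := by
      rw [Metric.mem_ball] at hθ ⊢
      refine lt_of_le_of_lt ?_ hθ
      rw [Prod.dist_eq, Prod.dist_eq]
      refine max_le_max ((dist_pi_le_iff dist_nonneg).mpr fun j => ?_) le_rfl
      by_cases hj : β₀ j = 0
      · simp [hβ'N j hj, hθ₁, extend, hj]
      · simp only [hβ'S j hj]
        exact dist_le_pi_dist θ.1 θ₁.1 j
    have hseg : ∀ t ∈ Set.Icc (0 : ℝ) 1, (β' + t • (θ.1 - β'), θ.2) ∈ Metric.ball θ₁ δ := by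
      intro t ht
      have := (convex_ball θ₁ δ).add_smul_sub_mem hmem' hθ ht
      have e : (β', θ.2) + t • (θ - (β', θ.2)) = (β' + t • (θ.1 - β'), θ.2) := by
        ext <;> simp
      rwa [e] at this
    obtain ⟨t, ht, hmvt⟩ := exists_deriv_eq_sub fun t (_ : t ∈ Set.Icc (0 : ℝ) 1) =>
      hasDerivAt_rpLoss_line (X := X) (y := y) (t := t) (σ := θ.2) (k := 0) hn hα β' (θ.1 - β')
        (by simpa using hσ')
    have hsc := (hball _ (hseg t (Set.Ioo_subset_Icc_self ht))).2.1
    simp only [one_smul, zero_smul, add_zero, add_sub_cancel, mul_zero] at hmvt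
    have hterm : ∀ j, 0 ≤ (pen l |θ.1 j| - pen l |β' j|) -
        (1 / (n : ℝ)) * (fullScore α X y (Sum.inl j) (β' + t • (θ.1 - β'), θ.2) *
          (θ.1 - β') j) ∧ (θ.1 j ≠ β' j → 0 < (pen l |θ.1 j| - pen l |β' j|) -
        (1 / (n : ℝ)) * (fullScore α X y (Sum.inl j) (β' + t • (θ.1 - β'), θ.2) *
          (θ.1 - β') j)) := by
      intro j
      by_cases hj : β₀ j = 0
      · by_cases hj0 : θ.1 j = 0
        · simp [hβ'N j hj, hj0]
        · have h1 := hpen' ⟨j, hj⟩ hj0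
          have h2 := hsc ⟨j, hj⟩
          have h3 : (1 / (n : ℝ)) * (fullScore α X y (Sum.inl j)
              (β' + t • (θ.1 - β'), θ.2) * θ.1 j) ≤ c ⟨j, hj⟩ * |θ.1 j| := by
            calc _ ≤ (1 / (n : ℝ)) * |fullScore α X y (Sum.inl j)
                  (β' + t • (θ.1 - β'), θ.2) * θ.1 j| := by
                  gcongr
                  exact le_abs_self _
              _ = (1 / (n : ℝ)) * |fullScore α X y (Sum.inl j)
                  (β' + t • (θ.1 - β'), θ.2)| * |θ.1 j| := by rw [abs_mul, mul_assoc]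
              _ ≤ _ := by gcongr
          have h4 : 0 < (pen l |θ.1 j| - pen l |β' j|) -
              (1 / (n : ℝ)) * (fullScore α X y (Sum.inl j) (β' + t • (θ.1 - β'), θ.2) *
                (θ.1 - β') j) := by
            rw [Pi.sub_apply, hβ'N j hj, abs_zero, sub_zero]
            dsimp only at h1 h3
            linarith
          exact ⟨h4.le, fun _ => h4⟩
      · simp [hβ'S j hj]
    have hsum : 0 < ∑ j, ((pen l |θ.1 j| - pen l |β' j|) -
        (1 / (n : ℝ)) * (fullScore α X y (Sum.inl j) (β' + t • (θ.1 - β'), θ.2) *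
          (θ.1 - β') j)) := by
      obtain ⟨j, hj⟩ := Function.ne_iff.mp hcase
      exact Finset.sum_pos' (fun j _ => (hterm j).1) ⟨j, Finset.mem_univ j, (hterm j).2 hj⟩
    rw [Finset.sum_sub_distrib, Finset.sum_sub_distrib, ← Finset.mul_sum] at hsum
    simp only [objective]
    linarith

end FullSpace

/-! ### Information matrix and linearization near the truth -/

section Oracle

variable {n p : ℕ} {α : ℝ} {X : Matrix (Fin n) (Fin p) ℝ} {y : Fin n → ℝ} {β₀ : Fin p → ℝ}
  {pen : ℝ → ℝ → ℝ} {l b τ₁ τs C K ε σ₀ r : ℝ}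

theorem halfMinSignal_le {p : ℕ} (β₀ : Fin p → ℝ) (j : Supp β₀) :
    2 * halfMinSignal β₀ ≤ |β₀ j| := by
  have := ciInf_le (f := fun j : Supp β₀ => |β₀ j|) (Set.finite_range _).bddBelow j
  unfold halfMinSignal
  linarith

theorem card_param (β₀ : Fin p → ℝ) :
    (Fintype.card (Supp β₀ ⊕ Unit) : ℝ) = sparsity β₀ + 1 := by
  simp [sparsity]

theorem nonempty_supp (hs : 1 ≤ sparsity β₀) : Nonempty (Supp β₀) :=
  Fintype.card_pos_iff.mp hs

theorem abs_sub_le_of_mem_closedBall {z : Supp β₀ ⊕ Unit → ℝ}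
    (hz : z ∈ Metric.closedBall (trueParam β₀ σ₀) r) (k : Supp β₀ ⊕ Unit) :
    |z k - trueParam β₀ σ₀ k| ≤ r :=
  (dist_le_pi_dist z (trueParam β₀ σ₀) k).trans (Metric.mem_closedBall.mp hz)

theorem scale_pos_of_mem_closedBall (hrσ : r < σ₀) {z : Supp β₀ ⊕ Unit → ℝ}
    (hz : z ∈ Metric.closedBall (trueParam β₀ σ₀) r) : 0 < z (Sum.inr ()) := by
  have h1 := (abs_le.mp (abs_sub_le_of_mem_closedBall hz (Sum.inr ()))).1
  simp only [trueParam, Sum.elim_inr] at h1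
  linarith

theorem closedBall_subset_nbhd (hrd : r ≤ halfMinSignal β₀) (hrσ : r < σ₀) :
    Metric.closedBall (trueParam β₀ σ₀) r ⊆ nbhd β₀ σ₀ := fun _ hz =>
  ⟨fun j => (abs_sub_le_of_mem_closedBall hz (Sum.inl j)).trans hrd,
    (abs_sub_le_of_mem_closedBall hz (Sum.inr ())).trans hrd, scale_pos_of_mem_closedBall hrσ hz⟩

theorem halfMinSignal_le_abs (hrd : r ≤ halfMinSignal β₀) {z : Supp β₀ ⊕ Unit → ℝ}
    (hz : z ∈ Metric.closedBall (trueParam β₀ σ₀) r) (j : Supp β₀) :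
    halfMinSignal β₀ ≤ |z (Sum.inl j)| := by
  have h1 := abs_sub_le_of_mem_closedBall hz (Sum.inl j)
  have h2 := halfMinSignal_le β₀ j
  have h3 := abs_sub_abs_le_abs_sub (β₀ j) (z (Sum.inl j))
  rw [abs_sub_comm] at h3
  simp only [trueParam, Sum.elim_inl] at h1
  linarith

/-- By the concavity condition the information matrix is positive semidefinite on `N₀`. -/
theorem DataConditions.minEig_nonneg (h : DataConditions α pen l b τ₁ τs C K ε β₀ σ₀ X y)
    (hpen : PenaltyCondition pen) (hl : 0 < l) (hs : 1 ≤ sparsity β₀) (hε : 0 < ε)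
    {w : Supp β₀ ⊕ Unit → ℝ} (hw : w ∈ nbhd β₀ σ₀) :
    0 ≤ minEig ((1 / (n : ℝ)) • infoSS α X y β₀ w) := by
  have := nonempty_supp hs
  have h1 := (hpen.localConcavity_nonneg hl _).trans (h.concavity w hw w hw)
  rw [EReal.coe_nonneg] at h1
  exact nonneg_of_mul_nonneg_right h1 hε

theorem isSymm_smul_infoSS (hα : 0 ≤ α) {z : Supp β₀ ⊕ Unit → ℝ} (hz : 0 < z (Sum.inr ())) :
    ((1 / (n : ℝ)) • infoSS α X y β₀ z).IsSymm :=
  (isSymm_infoSS hα hz).smul _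

theorem DataConditions.quadForm_infoSS_nonneg
    (h : DataConditions α pen l b τ₁ τs C K ε β₀ σ₀ X y) (hn : n ≠ 0) (hα : 0 ≤ α)
    (hpen : PenaltyCondition pen) (hl : 0 < l) (hs : 1 ≤ sparsity β₀) (hε : 0 < ε)
    {w : Supp β₀ ⊕ Unit → ℝ} (hw : w ∈ nbhd β₀ σ₀) (v : Supp β₀ ⊕ Unit → ℝ) :
    0 ≤ v ⬝ᵥ (infoSS α X y β₀ w).mulVec v := by
  have hn' : (0 : ℝ) < n := Nat.cast_pos.mpr (Nat.pos_of_ne_zero hn)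
  have h1 := minEig_mul_dotProduct_le (isSymm_smul_infoSS (n := n) (X := X) (y := y) hα hw.2.2) v
  have h2 := h.minEig_nonneg hpen hl hs hε hw
  have h3 : 0 ≤ v ⬝ᵥ v := by simpa using dotProduct_star_self_nonneg v
  rw [Matrix.smul_mulVec, dotProduct_smul, smul_eq_mul] at h1
  exact nonneg_of_mul_nonneg_right ((mul_nonneg h2 h3).trans h1) (by positivity)

/-- Lipschitz bound for the derivatives of the scores. -/
theorem DataConditions.abs_fderiv_sub_le (h : DataConditions α pen l b τ₁ τs C K ε β₀ σ₀ X y)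
    (hK : 0 ≤ K) (hr : 0 ≤ r) (hrd : r ≤ halfMinSignal β₀) (hrσ : r < σ₀) (j : Fin p ⊕ Unit)
    {z : Supp β₀ ⊕ Unit → ℝ} (hz : z ∈ Metric.closedBall (trueParam β₀ σ₀) r)
    (v : Supp β₀ ⊕ Unit → ℝ) :
    |fderiv ℝ (gammaFun α X y β₀ j) z v -
      fderiv ℝ (gammaFun α X y β₀ j) (trueParam β₀ σ₀) v| ≤
      K * n * (sparsity β₀ + 1) * ‖v‖ * ‖z - trueParam β₀ σ₀‖ := by
  rw [← card_param]
  exact RPRegression.abs_fderiv_sub_le (convex_closedBall (trueParam β₀ σ₀) r)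
    (fun z hz => contDiffAt_gammaFun j (scale_pos_of_mem_closedBall hrσ hz)) (by positivity)
    (fun z hz => h.hessian_bound z (closedBall_subset_nbhd hrd hrσ hz) j)
    (Metric.mem_closedBall_self hr) hz v

theorem DataConditions.abs_remainder_le (h : DataConditions α pen l b τ₁ τs C K ε β₀ σ₀ X y)
    (hK : 0 ≤ K) (hr : 0 ≤ r) (hrd : r ≤ halfMinSignal β₀) (hrσ : r < σ₀) (j : Fin p ⊕ Unit)
    {z : Supp β₀ ⊕ Unit → ℝ} (hz : z ∈ Metric.closedBall (trueParam β₀ σ₀) r) :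
    |gammaFun α X y β₀ j z - gammaFun α X y β₀ j (trueParam β₀ σ₀) -
      fderiv ℝ (gammaFun α X y β₀ j) (trueParam β₀ σ₀) (z - trueParam β₀ σ₀)| ≤
      K * n * (sparsity β₀ + 1) * ‖z - trueParam β₀ σ₀‖ ^ 2 := by
  rw [← card_param]
  exact abs_taylor_remainder_le (convex_closedBall (trueParam β₀ σ₀) r)
    (fun z hz => contDiffAt_gammaFun j (scale_pos_of_mem_closedBall hrσ hz)) (by positivity)
    (fun z hz => h.hessian_bound z (closedBall_subset_nbhd hrd hrσ hz) j)
    (Metric.mem_closedBall_self hr) hz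

theorem DataConditions.inv_mulVec_mulVec (h : DataConditions α pen l b τ₁ τs C K ε β₀ σ₀ X y)
    (v : Supp β₀ ⊕ Unit → ℝ) :
    (infoSS α X y β₀ (trueParam β₀ σ₀))⁻¹.mulVec
      ((infoSS α X y β₀ (trueParam β₀ σ₀)).mulVec v) = v := by
  rw [Matrix.mulVec_mulVec, Matrix.nonsing_inv_mul _ h.det_isUnit, Matrix.one_mulVec]

theorem DataConditions.mulVec_inv_mulVec (h : DataConditions α pen l b τ₁ τs C K ε β₀ σ₀ X y)
    (v : Supp β₀ ⊕ Unit → ℝ) :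
    (infoSS α X y β₀ (trueParam β₀ σ₀)).mulVec
      ((infoSS α X y β₀ (trueParam β₀ σ₀))⁻¹.mulVec v) = v := by
  rw [Matrix.mulVec_mulVec, Matrix.mul_nonsing_inv _ h.det_isUnit, Matrix.one_mulVec]

/-- The information matrix stays invertible near the truth: relative to its value at the truth it
is a small perturbation of the identity. -/
theorem DataConditions.infoSS_injective (h : DataConditions α pen l b τ₁ τs C K ε β₀ σ₀ X y)
    (hK : 0 ≤ K) (hr : 0 ≤ r) (hrd : r ≤ halfMinSignal β₀) (hrσ : r < σ₀) (hσ₀ : 0 < σ₀)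
    (hsmall : K * (b / n) * (K * n * (sparsity β₀ + 1) * r) < 1)
    {z : Supp β₀ ⊕ Unit → ℝ} (hz : z ∈ Metric.closedBall (trueParam β₀ σ₀) r)
    (v : Supp β₀ ⊕ Unit → ℝ) (hv : (infoSS α X y β₀ z).mulVec v = 0) : v = 0 := by
  by_contra hne
  have hpos : 0 < ‖v‖ := norm_pos_iff.mpr hne
  have hzr : ‖z - trueParam β₀ σ₀‖ ≤ r := by simpa [dist_eq_norm] using hz
  have hbound : ∀ k, |(infoSS α X y β₀ (trueParam β₀ σ₀)).mulVec v k| ≤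
      K * n * (sparsity β₀ + 1) * ‖v‖ * r := by
    intro k
    have h1 := h.abs_fderiv_sub_le hK hr hrd hrσ (paramIdx k) hz v
    have e1 := fderiv_gammaFun (α := α) (X := X) (y := y) (β₀ := β₀) _ k
      (scale_pos_of_mem_closedBall hrσ hz) v
    have e2 := fderiv_gammaFun (α := α) (X := X) (y := y) (β₀ := β₀) _ k
      (z := trueParam β₀ σ₀) hσ₀ v
    rw [e1, e2] at h1
    change |-((infoSS α X y β₀ z).mulVec v k) -
      -((infoSS α X y β₀ (trueParam β₀ σ₀)).mulVec v k)| ≤ _ at h1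
    rw [hv, Pi.zero_apply, neg_zero, sub_neg_eq_add, zero_add] at h1
    refine h1.trans ?_
    gcongr
  have hle : ‖v‖ ≤ K * (b / n) * (K * n * (sparsity β₀ + 1) * ‖v‖ * r) := by
    have hnn : 0 ≤ K * n * (sparsity β₀ + 1) * ‖v‖ * r := by positivity
    have hinv := (rowSumNorm_nonneg _).trans h.inv_bound
    rw [pi_norm_le_iff_of_nonneg (mul_nonneg hinv hnn)]
    intro k
    rw [← h.inv_mulVec_mulVec v]
    refine (abs_mulVec_le _ hbound k).trans ?_
    rw [h.inv_mulVec_mulVec v]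
    exact mul_le_mul_of_nonneg_right h.inv_bound hnn
  have : K * (b / n) * (K * n * (sparsity β₀ + 1) * ‖v‖ * r) =
    K * (b / n) * (K * n * (sparsity β₀ + 1) * r) * ‖v‖ := by ring
  rw [this] at hle
  nlinarith

/-- The linearization error `M₀ (z - z₀) - n ∇F(z)` of the reduced gradient, where `M₀` is the
information matrix at the true value `z₀`. It consists of the scores at the truth, their Taylor
remainders and the slope of the penalty, see `linError_apply`. -/
noncomputable def linError (α : ℝ) (pen : ℝ → ℝ → ℝ) (l : ℝ)
    (X : Matrix (Fin n) (Fin p) ℝ) (y : Fin n → ℝ) (β₀ : Fin p → ℝ) (σ₀ : ℝ)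
    (z : Supp β₀ ⊕ Unit → ℝ) : Supp β₀ ⊕ Unit → ℝ :=
  (infoSS α X y β₀ (trueParam β₀ σ₀)).mulVec (z - trueParam β₀ σ₀) -
    (n : ℝ) • reducedGradient α pen l X y β₀ z

theorem abs_penaltySlope_le (hpen : PenaltyCondition pen) (hl : 0 < l) (hr : 0 ≤ r)
    (hrd : r ≤ halfMinSignal β₀) {z : Supp β₀ ⊕ Unit → ℝ}
    (hz : z ∈ Metric.closedBall (trueParam β₀ σ₀) r) (k : Supp β₀ ⊕ Unit) :
    |Sum.elim (fun j => dpen pen l |z (Sum.inl j)| * SignType.sign (z (Sum.inl j)))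
      (fun _ => (0 : ℝ)) k| ≤ dpen pen l (halfMinSignal β₀) := by
  rcases k with j | j
  · have h1 := halfMinSignal_le_abs hrd hz j
    have h2 : dpen pen l |z (Sum.inl j)| ≤ dpen pen l (halfMinSignal β₀) :=
      hpen.antitoneOn_dpen hl (hr.trans hrd) (abs_nonneg (z (Sum.inl j))) h1
    have h3 : |(SignType.sign (z (Sum.inl j)) : ℝ)| ≤ 1 := by
      rcases lt_trichotomy (z (Sum.inl j)) 0 with h | h | h <;> simp [h]
    rw [Sum.elim_inl, abs_mul, abs_of_nonneg (hpen.dpen_nonneg hl _)]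
    calc _ ≤ dpen pen l |z (Sum.inl j)| * 1 := by
          gcongr
          exact hpen.dpen_nonneg hl _
      _ ≤ _ := by rwa [mul_one]
  · simpa using hpen.dpen_nonneg hl _

theorem linError_apply (hn : n ≠ 0) (hσ₀ : 0 < σ₀) (z : Supp β₀ ⊕ Unit → ℝ)
    (k : Supp β₀ ⊕ Unit) :
    linError α pen l X y β₀ σ₀ z k =
      (gammaFun α X y β₀ (paramIdx k) (trueParam β₀ σ₀) +
        (gammaFun α X y β₀ (paramIdx k) z -
          gammaFun α X y β₀ (paramIdx k) (trueParam β₀ σ₀) -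
          fderiv ℝ (gammaFun α X y β₀ (paramIdx k)) (trueParam β₀ σ₀)
            (z - trueParam β₀ σ₀))) -
      n * Sum.elim (fun j => dpen pen l |z (Sum.inl j)| * SignType.sign (z (Sum.inl j)))
        (fun _ => (0 : ℝ)) k := by
  have hn' : (n : ℝ) ≠ 0 := Nat.cast_ne_zero.mpr hn
  rw [fderiv_gammaFun (fun j => β₀ j ≠ 0) k (z := trueParam β₀ σ₀) hσ₀]
  change (infoSS α X y β₀ (trueParam β₀ σ₀)).mulVec (z - trueParam β₀ σ₀) k -
    n * reducedGradient α pen l X y β₀ z k = (_ + (_ - _ -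
      -((infoSS α X y β₀ (trueParam β₀ σ₀)).mulVec (z - trueParam β₀ σ₀) k))) - _
  rw [reducedGradient, mul_add, ← mul_assoc, mul_neg, mul_one_div_cancel hn']
  ring

end Oracle

/-! ### Existence of an oracle minimizer -/

section Oracle

variable {n p : ℕ} {α : ℝ} {X : Matrix (Fin n) (Fin p) ℝ} {y : Fin n → ℝ} {β₀ : Fin p → ℝ}
  {pen : ℝ → ℝ → ℝ} {l b τ₁ τs C K ε σ₀ r : ℝ}

/-- A stationary point at which the information matrix is nonsingular is a strict local minimizer
in the coordinates of the support: the local concavity of the penalty is dominated by the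
curvature of the loss. -/
theorem DataConditions.isStrictLocalMin_reduced
    (h : DataConditions α pen l b τ₁ τs C K ε β₀ σ₀ X y) (hn : n ≠ 0) (hα : 0 ≤ α)
    (hpen : PenaltyCondition pen) (hl : 0 < l) (hs : 1 ≤ sparsity β₀) (hε0 : 0 < ε)
    (hε : ε < 1 / 2) {z : Supp β₀ ⊕ Unit → ℝ} (hz : z ∈ nbhd β₀ σ₀)
    (hz0 : ∀ j, z (Sum.inl j) ≠ 0) (hstat : reducedGradient α pen l X y β₀ z = 0)
    (hinj : ∀ v, (infoSS α X y β₀ z).mulVec v = 0 → v = 0) :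
    IsStrictLocalMin (fun w : Supp β₀ ⊕ Unit → ℝ =>
      objective α pen l X y (extend β₀ w, w (Sum.inr ()))) z := by
  have hn' : (0 : ℝ) < n := Nat.cast_pos.mpr (Nat.pos_of_ne_zero hn)
  have := nonempty_supp hs
  have hzσ : 0 < z (Sum.inr ()) := hz.2.2
  have hsymm := isSymm_smul_infoSS (n := n) (X := X) (y := y) hα hzσ
  set m := minEig ((1 / (n : ℝ)) • infoSS α X y β₀ z) with hm
  have hmpos : 0 < m := by
    refine minEig_pos hsymm (h.minEig_nonneg hpen hl hs hε0 hz) fun v hv => hinj v ?_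
    rw [Matrix.smul_mulVec] at hv
    exact (smul_eq_zero.mp hv).resolve_left (by positivity)
  obtain ⟨e, he, hlip⟩ := exists_dpen_lipschitz_of_localConcavity_lt (pen := pen) (l := l)
    (b := fun j : Supp β₀ => z (Sum.inl j)) (x := m / 2)
    ((h.concavity z hz z hz).trans_lt (by
      rw [EReal.coe_lt_coe_iff]
      nlinarith))
  have hnz : ∀ᶠ w in 𝓝 z, ∀ j, w (Sum.inl j) ≠ 0 := eventually_all.mpr fun j =>
    (continuous_apply (Sum.inl j : Supp β₀ ⊕ Unit)).continuousAt.eventually_ne (hz0 j)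
  have hσev : ∀ᶠ w in 𝓝 z, 0 < w (Sum.inr ()) :=
    (continuous_apply (Sum.inr () : Supp β₀ ⊕ Unit)).continuousAt.eventually_const_lt hzσ
  refine isStrictLocalMin_of_gradient (g := reducedGradient α pen l X y β₀) ?_ ?_
  · filter_upwards [hnz, hσev] with w hw hwσ v
    exact hasDerivAt_reducedObjective hn hα hpen hl hwσ hw v
  -- same sign near `z`, and the absolute values are close
  have hsign : ∀ᶠ w in 𝓝 z, ∀ j : Supp β₀,
      SignType.sign (w (Sum.inl j)) = SignType.sign (z (Sum.inl j)) := by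
    refine eventually_all.mpr fun j => ?_
    have hc := (continuous_apply (Sum.inl j : Supp β₀ ⊕ Unit)).continuousAt (x := z)
    rcases lt_or_gt_of_ne (hz0 j) with hneg | hpos
    · filter_upwards [hc.eventually_lt_const hneg] with w hw
      rw [sign_neg hneg, sign_neg hw]
    · filter_upwards [hc.eventually_const_lt hpos] with w hw
      rw [sign_pos hpos, sign_pos hw]
  have hclose : ∀ᶠ w in 𝓝 z, ∀ j : Supp β₀, |abs (w (Sum.inl j)) - abs (z (Sum.inl j))| < e := by
    refine eventually_all.mpr fun j => ?_
    have hc : Continuous fun w : Supp β₀ ⊕ Unit → ℝ =>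
      |abs (w (Sum.inl j)) - abs (z (Sum.inl j))| := by fun_prop
    refine hc.continuousAt.eventually_lt_const ?_
    simpa using he
  -- the scores are differentiable at `z`
  set N : ℝ := ((Fintype.card (Supp β₀ ⊕ Unit) : ℕ) : ℝ) with hN
  have hNpos : 0 < N := Nat.cast_pos.mpr Fintype.card_pos
  have hrem : ∀ᶠ w in 𝓝 z, ∀ k : Supp β₀ ⊕ Unit,
      |gammaFun α X y β₀ (paramIdx k) w - gammaFun α X y β₀ (paramIdx k) z -
        fderiv ℝ (gammaFun α X y β₀ (paramIdx k)) z (w - z)| ≤ n * m / (4 * N) * ‖w - z‖ := by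
    refine eventually_all.mpr fun k => ?_
    have hd := ((contDiffAt_gammaFun (α := α) (X := X) (y := y) (paramIdx k)
      hzσ).differentiableAt (by norm_num)).hasFDerivAt.isLittleO
    exact hd.bound (by positivity)
  filter_upwards [hsign, hclose, hrem] with w hws hwc hwr hne
  set d := w - z with hd
  have hdpos : 0 < d ⬝ᵥ d := by
    have h1 : 0 ≤ d ⬝ᵥ d := by simpa using dotProduct_star_self_nonneg d
    refine lt_of_le_of_ne h1 fun h0 => hne ?_
    exact sub_eq_zero.mp (dotProduct_self_eq_zero.mp h0.symm)
  have hnormsq : ‖d‖ ^ 2 ≤ d ⬝ᵥ d := by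
    have h1 : ‖d‖ ≤ √(d ⬝ᵥ d) := by
      rw [pi_norm_le_iff_of_nonneg (Real.sqrt_nonneg _)]
      intro k
      rw [Real.norm_eq_abs]
      refine Real.abs_le_sqrt ?_
      rw [sq]
      exact Finset.single_le_sum (f := fun k => d k * d k) (fun k _ => mul_self_nonneg _)
        (Finset.mem_univ k)
    calc ‖d‖ ^ 2 ≤ √(d ⬝ᵥ d) ^ 2 := by gcongr
      _ = d ⬝ᵥ d := Real.sq_sqrt hdpos.le
  -- contribution of the loss
  have hloss : (3 / 4) * m * (d ⬝ᵥ d) ≤ ∑ k, -(1 / (n : ℝ)) *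
      (gammaFun α X y β₀ (paramIdx k) w - gammaFun α X y β₀ (paramIdx k) z) * d k := by
    have hquad := minEig_mul_dotProduct_le hsymm d
    rw [← hm, Matrix.smul_mulVec, dotProduct_smul, smul_eq_mul] at hquad
    have hk : ∀ k, (1 / (n : ℝ)) * (d k * (infoSS α X y β₀ z).mulVec d k) -
        m / (4 * N) * ‖d‖ ^ 2 ≤ -(1 / (n : ℝ)) *
      (gammaFun α X y β₀ (paramIdx k) w - gammaFun α X y β₀ (paramIdx k) z) * d k := by
      intro k
      have h1 := hwr k
      rw [fderiv_gammaFun (fun j => β₀ j ≠ 0) k hzσ] at h1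
      change |_ - _ - -((infoSS α X y β₀ z).mulVec d k)| ≤ _ at h1
      rw [sub_neg_eq_add] at h1
      have h2 : |d k| ≤ ‖d‖ := norm_le_pi_norm d k
      have h3 : |(1 / (n : ℝ)) * (gammaFun α X y β₀ (paramIdx k) w -
          gammaFun α X y β₀ (paramIdx k) z + (infoSS α X y β₀ z).mulVec d k) * d k| ≤
          (1 / (n : ℝ)) * (n * m / (4 * N) * ‖d‖) * ‖d‖ := by
        rw [abs_mul, abs_mul, abs_of_pos (one_div_pos.mpr hn')]
        gcongr
      have h4 := (abs_le.mp h3).2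
      have e1 : (1 / (n : ℝ)) * (n * m / (4 * N) * ‖d‖) * ‖d‖ = m / (4 * N) * ‖d‖ ^ 2 := by
        field_simp
      rw [e1] at h4
      linarith
    have hsum := Finset.sum_le_sum fun k (_ : k ∈ Finset.univ) => hk k
    rw [Finset.sum_sub_distrib, ← Finset.mul_sum, Finset.sum_const, Finset.card_univ,
      nsmul_eq_mul, ← hN] at hsum
    have e2 : N * (m / (4 * N) * ‖d‖ ^ 2) = m / 4 * ‖d‖ ^ 2 := by field_simp
    rw [e2] at hsum
    have h5 : m / 4 * ‖d‖ ^ 2 ≤ m / 4 * (d ⬝ᵥ d) := by gcongr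
    refine le_trans ?_ hsum
    change _ ≤ (1 / (n : ℝ)) * (d ⬝ᵥ (infoSS α X y β₀ z).mulVec d) - _
    linarith
  -- contribution of the penalty
  have hpenal : ∀ k, -(m / 2) * (d k * d k) ≤
      (Sum.elim (fun j => dpen pen l |w (Sum.inl j)| * SignType.sign (w (Sum.inl j)))
        (fun _ => (0 : ℝ)) k -
      Sum.elim (fun j => dpen pen l |z (Sum.inl j)| * SignType.sign (z (Sum.inl j)))
        (fun _ => (0 : ℝ)) k) * d k := by
    intro k
    rcases k with j | j
    · have h1 := hlip j |w (Sum.inl j)| (abs_nonneg _) (hwc j)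
      have hsz : (SignType.sign (z (Sum.inl j)) : ℝ) * (SignType.sign (z (Sum.inl j)) : ℝ) = 1 := by
        rcases lt_or_gt_of_ne (hz0 j) with h | h <;> simp [h]
      have ew : w (Sum.inl j) = SignType.sign (z (Sum.inl j)) * |w (Sum.inl j)| := by
        rw [← hws j, sign_mul_abs]
      have ez : z (Sum.inl j) = SignType.sign (z (Sum.inl j)) * |z (Sum.inl j)| := by
        rw [sign_mul_abs]
      have ed : d (Sum.inl j) = SignType.sign (z (Sum.inl j)) *
          (|w (Sum.inl j)| - abs (z (Sum.inl j))) := by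
        rw [mul_sub, ← ew, ← ez]
        rfl
      rw [Sum.elim_inl, Sum.elim_inl, ed, hws j]
      calc _ = -(m / 2 * (|w (Sum.inl j)| - abs (z (Sum.inl j))) ^ 2) *
            ((SignType.sign (z (Sum.inl j)) : ℝ) * SignType.sign (z (Sum.inl j))) := by ring
        _ ≤ (dpen pen l |w (Sum.inl j)| - dpen pen l |z (Sum.inl j)|) *
            (|w (Sum.inl j)| - abs (z (Sum.inl j))) *
            ((SignType.sign (z (Sum.inl j)) : ℝ) * SignType.sign (z (Sum.inl j))) := by
          rw [hsz, mul_one, mul_one]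
          exact h1
        _ = _ := by ring
    · simp only [Sum.elim_inr, sub_zero, zero_mul]
      have := mul_nonneg (half_pos hmpos).le (mul_self_nonneg (d (Sum.inr j)))
      linarith
  have hpenal' := Finset.sum_le_sum fun k (_ : k ∈ Finset.univ) => hpenal k
  rw [← Finset.mul_sum] at hpenal'
  change -(m / 2) * (d ⬝ᵥ d) ≤ _ at hpenal'
  have htot := add_le_add hloss hpenal'
  rw [← Finset.sum_add_distrib] at htot
  have e3 : reducedGradient α pen l X y β₀ w ⬝ᵥ d =
      (reducedGradient α pen l X y β₀ w - reducedGradient α pen l X y β₀ z) ⬝ᵥ d := by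
    rw [hstat, sub_zero]
  rw [e3]
  refine lt_of_lt_of_le ?_ (htot.trans_eq (Finset.sum_congr rfl fun k _ => ?_))
  · nlinarith
  · simp only [reducedGradient, Pi.sub_apply]
    ring

/-- The deterministic part of the weak oracle property: bounds on the scores at the truth, `a` on
the support and the scale and `aN` off the support, yield a minimizer within `r`. -/
theorem DataConditions.exists_oracleMinimizer
    (h : DataConditions α pen l b τ₁ τs C K ε β₀ σ₀ X y) (hn : n ≠ 0) (hα : 0 ≤ α)
    (hpen : PenaltyCondition pen) (hl : 0 < l) (hs : 1 ≤ sparsity β₀) (hσ₀ : 0 < σ₀) (hK : 0 ≤ K)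
    (hε0 : 0 < ε) (hε : ε < 1 / 2) (hr : 0 < r) (hrd : r ≤ halfMinSignal β₀) (hrσ : r < σ₀)
    {a aN η : ℝ} (hη : η < 1)
    (hS : ∀ k : Supp β₀ ⊕ Unit,
      |gammaFun α X y β₀ (paramIdx k) (trueParam β₀ σ₀)| ≤ a)
    (hN : ∀ k : Null β₀, |gammaFun α X y β₀ (Sum.inl k) (trueParam β₀ σ₀)| ≤ aN)
    (h1 : K * (b / n) * (a + K * n * (sparsity β₀ + 1) * r ^ 2 +
      n * dpen pen l (halfMinSignal β₀)) ≤ η * r)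
    (h2 : K * (b / n) * (K * n * (sparsity β₀ + 1) * r) < 1)
    (h3 : aN + K * n * (sparsity β₀ + 1) * (η * r) ^ 2 + K * (n : ℝ) ^ τ₁ *
      (a + K * n * (sparsity β₀ + 1) * (η * r) ^ 2) < (1 - C) * n * dpen pen l 0) :
    ∃ θ, OracleMinimizer α pen l r β₀ σ₀ X y θ := by
  have hn' : (0 : ℝ) < n := Nat.cast_pos.mpr (Nat.pos_of_ne_zero hn)
  have := nonempty_supp hs
  have ha : 0 ≤ a := (abs_nonneg _).trans (hS (Sum.inr ()))
  have hd : 0 < halfMinSignal β₀ := hr.trans_le hrd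
  set M₀ := infoSS α X y β₀ (trueParam β₀ σ₀) with hM₀
  have hsub := closedBall_subset_nbhd (β₀ := β₀) hrd hrσ
  have hne : ∀ z ∈ Metric.closedBall (trueParam β₀ σ₀) r, ∀ j : Supp β₀, z (Sum.inl j) ≠ 0 :=
    fun z hz j => abs_pos.mp (hd.trans_le (halfMinSignal_le_abs hrd hz j))
  have hpos := fun z (hz : z ∈ Metric.closedBall (trueParam β₀ σ₀) r) =>
    scale_pos_of_mem_closedBall hrσ hz
  have hinvnn : 0 ≤ K * (b / n) := (rowSumNorm_nonneg _).trans h.inv_bound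
  -- bound of the linearization error
  have hslope := fun z (hz : z ∈ Metric.closedBall (trueParam β₀ σ₀) r) =>
    abs_penaltySlope_le hpen hl hr.le hrd hz
  have hsmooth : ∀ z ∈ Metric.closedBall (trueParam β₀ σ₀) r, ∀ ρ, ‖z - trueParam β₀ σ₀‖ ≤ ρ →
      ∀ k : Supp β₀ ⊕ Unit, |gammaFun α X y β₀ (paramIdx k) (trueParam β₀ σ₀) +
        (gammaFun α X y β₀ (paramIdx k) z -
          gammaFun α X y β₀ (paramIdx k) (trueParam β₀ σ₀) -
          fderiv ℝ (gammaFun α X y β₀ (paramIdx k)) (trueParam β₀ σ₀)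
            (z - trueParam β₀ σ₀))| ≤ a + K * n * (sparsity β₀ + 1) * ρ ^ 2 := by
    intro z hz ρ hρ k
    refine (abs_add_le _ _).trans (add_le_add (hS k) ?_)
    refine (h.abs_remainder_le hK hr.le hrd hrσ (paramIdx k) hz).trans ?_
    gcongr
  have hlin : ∀ z ∈ Metric.closedBall (trueParam β₀ σ₀) r, ∀ k,
      |linError α pen l X y β₀ σ₀ z k| ≤ a + K * n * (sparsity β₀ + 1) * r ^ 2 +
        n * dpen pen l (halfMinSignal β₀) := by
    intro z hz k
    rw [linError_apply hn hσ₀]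
    refine (abs_sub _ _).trans (add_le_add
      (hsmooth z hz r (by simpa [dist_eq_norm] using hz) k) ?_)
    rw [abs_mul, abs_of_pos hn']
    exact mul_le_mul_of_nonneg_left (hslope z hz k) hn'.le
  have hlin' : ∀ z, (z - trueParam β₀ σ₀) - M₀⁻¹.mulVec ((n : ℝ) •
      reducedGradient α pen l X y β₀ z) = M₀⁻¹.mulVec (linError α pen l X y β₀ σ₀ z) := by
    intro z
    rw [linError, Matrix.mulVec_sub, h.inv_mulVec_mulVec]
  obtain ⟨z, hz, hstat, hzη⟩ := exists_stationary (F := fun z : Supp β₀ ⊕ Unit → ℝ =>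
      objective α pen l X y (extend β₀ z, z (Sum.inr ())))
    (g := reducedGradient α pen l X y β₀) (A := (n : ℝ) • M₀⁻¹) hr hη
    (continuousOn_reducedObjective hn hpen hl hpos)
    (fun z hz v => hasDerivAt_reducedObjective hn hα hpen hl (hpos z hz) (hne z hz) v)
    (by
      intro v
      have hq := h.quadForm_infoSS_nonneg hn hα hpen hl hs hε0
        (hsub (Metric.mem_closedBall_self hr.le)) (M₀⁻¹.mulVec v)
      rw [h.mulVec_inv_mulVec, dotProduct_comm] at hq
      rw [Matrix.smul_mulVec, dotProduct_smul, smul_eq_mul]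
      positivity)
    (by
      intro z hz k
      rw [Matrix.smul_mulVec, ← Matrix.mulVec_smul, ← Pi.sub_apply, hlin' z]
      refine (abs_mulVec_le _ (hlin z hz) k).trans (le_trans ?_ h1)
      have := hpen.dpen_nonneg hl (halfMinSignal β₀)
      have hi := h.inv_bound
      gcongr)
  have hzmin := h.isStrictLocalMin_reduced hn hα hpen hl hs hε0 hε (hsub hz) (hne z hz) hstat
    (h.infoSS_injective hK hr.le hrd hrσ hσ₀ h2 hz)
  have hzN : ∀ k : Null β₀, |gammaFun α X y β₀ (Sum.inl k) z| < n * dpen pen l 0 := by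
    intro k
    set W := infoNS α X y β₀ (trueParam β₀ σ₀) * M₀⁻¹ with hW
    set q := K * n * (sparsity β₀ + 1) * (η * r) ^ 2 with hq
    have hqnn : 0 ≤ q := by positivity
    have hR := h.abs_remainder_le hK hr.le hrd hrσ (Sum.inl k) hz
    have hR' : K * n * (sparsity β₀ + 1) * ‖z - trueParam β₀ σ₀‖ ^ 2 ≤ q := by
      rw [hq]
      gcongr
    have hfd := fderiv_gammaFun (α := α) (X := X) (y := y) (fun j => β₀ j = 0) (Sum.inl k)
      (z := trueParam β₀ σ₀) hσ₀ (z - trueParam β₀ σ₀)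
    change fderiv ℝ (gammaFun α X y β₀ (Sum.inl k)) (trueParam β₀ σ₀) (z - trueParam β₀ σ₀) =
      -((infoNS α X y β₀ (trueParam β₀ σ₀)).mulVec (z - trueParam β₀ σ₀)) (Sum.inl k) at hfd
    have hz' : z - trueParam β₀ σ₀ = M₀⁻¹.mulVec (linError α pen l X y β₀ σ₀ z) := by
      rw [← hlin' z, hstat, smul_zero, Matrix.mulVec_zero, sub_zero]
    -- split the linearization error into its smooth part and the penalty slope
    set sl : Supp β₀ ⊕ Unit → ℝ := fun k =>
      Sum.elim (fun j => dpen pen l |z (Sum.inl j)| * SignType.sign (z (Sum.inl j)))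
        (fun _ => (0 : ℝ)) k with hsl
    set u : Supp β₀ ⊕ Unit → ℝ := linError α pen l X y β₀ σ₀ z + (n : ℝ) • sl with hu
    have hub : ∀ k, |u k| ≤ a + q := by
      intro k
      have hk := hsmooth z hz (η * r) hzη k
      have e : u k = _ + _ := rfl
      rw [linError_apply hn hσ₀] at e
      rw [e, Pi.smul_apply, smul_eq_mul, hsl, sub_add_cancel]
      exact hk
    have hWu := abs_mulVec_le W hub (Sum.inl k)
    have hWs := abs_mulVec_le W (hslope z hz) (Sum.inl k)
    have hirr1 := h.irrep_slope
    have hirr2 := h.irrep_rate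
    rw [← hM₀, ← hW] at hirr1 hirr2
    have hexp : (infoNS α X y β₀ (trueParam β₀ σ₀)).mulVec (z - trueParam β₀ σ₀) (Sum.inl k) =
        W.mulVec u (Sum.inl k) - n * W.mulVec sl (Sum.inl k) := by
      have e : linError α pen l X y β₀ σ₀ z = u - (n : ℝ) • sl := by
        rw [hu, add_sub_cancel_right]
      rw [hz', Matrix.mulVec_mulVec, ← hW, e, Matrix.mulVec_sub, Matrix.mulVec_smul]
      rfl
    rw [hfd, hexp] at hR
    have hWu' : rowSumNorm W * (a + q) ≤ K * (n : ℝ) ^ τ₁ * (a + q) := by gcongr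
    have hWs' : |n * W.mulVec sl (Sum.inl k)| ≤ n * (C * dpen pen l 0) := by
      rw [abs_mul, abs_of_pos hn']
      exact mul_le_mul_of_nonneg_left (hWs.trans hirr1.le) hn'.le
    have hNk := hN k
    rw [abs_le] at hR hWu hWs' hNk
    rw [abs_lt]
    constructor <;> linarith [hR.1, hR.2, hWu.1, hWu.2, hWs'.1, hWs'.2, hNk.1, hNk.2]
  refine ⟨(extend β₀ z, z (Sum.inr ())), hpos z hz,
    isStrictLocalMin_objective hn hα hpen hl (hpos z hz) hzmin hzN, ?_, ?_, ?_⟩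
  · intro j hj
    simp [extend, hj]
  · intro j hj
    simpa [extend, hj, trueParam] using abs_sub_le_of_mem_closedBall hz (Sum.inl ⟨j, hj⟩)
  · exact abs_sub_le_of_mem_closedBall hz (Sum.inr ())

end Oracle

/-! ### Tail bounds for the Gaussian scores -/

section Gaussian

variable {α : ℝ}

theorem abs_phi1_le (hα : 0 ≤ α) (u : ℝ) : |phi1 α u| ≤ |u| := by
  rw [phi1, abs_mul, Real.abs_exp]
  refine mul_le_of_le_one_right (abs_nonneg u) (Real.exp_le_one_iff.mpr ?_)
  have := mul_nonneg hα (sq_nonneg u)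
  linarith

theorem abs_phi2_le (hα : 0 ≤ α) (u : ℝ) : |phi2 α u| ≤ u ^ 2 + 1 := by
  have h1 : 0 ≤ 1 / (α + 1) := by positivity
  have h2 : 1 / (α + 1) ≤ 1 := by
    rw [div_le_one (by positivity)]
    linarith
  have h3 : |u ^ 2 - 1 / (α + 1)| ≤ u ^ 2 + 1 := by
    rw [abs_le]
    constructor <;> nlinarith [sq_nonneg u]
  rw [phi2, abs_mul, Real.abs_exp]
  refine (mul_le_of_le_one_right (abs_nonneg _) (Real.exp_le_one_iff.mpr ?_)).trans h3
  have := mul_nonneg hα (sq_nonneg u)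
  linarith

@[fun_prop]
theorem continuous_phi1 : Continuous (phi1 α) := by unfold phi1; fun_prop

@[fun_prop]
theorem continuous_phi2 : Continuous (phi2 α) := by unfold phi2; fun_prop

theorem exp_add_exp_neg_le {a b : ℝ} (h : |a| ≤ |b|) :
    Real.exp a + Real.exp (-a) ≤ Real.exp b + Real.exp (-b) := by
  have := Real.cosh_le_cosh.mpr h
  rw [Real.cosh_eq, Real.cosh_eq] at this
  linarith

/-- The score for the mean is an odd function dominated by the identity, hence at least as
concentrated as the Gaussian noise itself. -/
theorem hasSubgaussianMGF_phi1 (hα : 0 ≤ α) :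
    HasSubgaussianMGF (phi1 α) 1 (gaussianReal 0 1) := by
  have hG : ∀ t : ℝ, Integrable (fun z => Real.exp (t * z) + Real.exp (-(t * z)))
      (gaussianReal 0 1) := fun t => by
    refine (integrable_exp_mul_gaussianReal t).add ?_
    simpa only [neg_mul] using integrable_exp_mul_gaussianReal (μ := 0) (v := 1) (-t)
  have hle : ∀ t z : ℝ, Real.exp (t * phi1 α z) + Real.exp (-(t * phi1 α z)) ≤
      Real.exp (t * z) + Real.exp (-(t * z)) := fun t z => by
    refine exp_add_exp_neg_le ?_
    rw [abs_mul, abs_mul]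
    exact mul_le_mul_of_nonneg_left (abs_phi1_le hα z) (abs_nonneg t)
  have hint : ∀ t : ℝ, Integrable (fun z => Real.exp (t * phi1 α z)) (gaussianReal 0 1) := by
    intro t
    refine (hG t).mono' (by fun_prop) (ae_of_all _ fun z => ?_)
    rw [Real.norm_eq_abs, Real.abs_exp]
    exact (le_add_of_nonneg_right (Real.exp_pos _).le).trans (hle t z)
  refine ⟨hint, fun t => ?_⟩
  have hsymm : mgf (phi1 α) (gaussianReal 0 1) t = mgf (phi1 α) (gaussianReal 0 1) (-t) := by
    have hmap : (gaussianReal 0 1).map (fun x => -x) = gaussianReal 0 1 := by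
      simpa using gaussianReal_map_neg (μ := 0) (v := 1)
    simp only [mgf]
    conv_lhs => rw [← hmap]
    rw [integral_map (by fun_prop) (by fun_prop)]
    simp [phi1]
  have h1 : mgf (phi1 α) (gaussianReal 0 1) t + mgf (phi1 α) (gaussianReal 0 1) (-t) ≤
      mgf id (gaussianReal 0 1) t + mgf id (gaussianReal 0 1) (-t) := by
    simp only [mgf, id]
    rw [← integral_add (hint t) (hint (-t)), ← integral_add (integrable_exp_mul_gaussianReal t)
      (integrable_exp_mul_gaussianReal (-t))]
    simp only [neg_mul]
    refine integral_mono ?_ (hG t) (hle t)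
    have := (hint t).add (hint (-t))
    simp only [neg_mul] at this
    exact this
  rw [← hsymm, mgf_id_gaussianReal] at h1
  simp only [zero_mul, zero_add, NNReal.coe_one, one_mul, neg_sq] at h1 ⊢
  linarith

theorem integrable_gaussianReal_of_smul {f : ℝ → ℝ}
    (hf : Integrable fun x => gaussianPDFReal 0 1 x * f x) : Integrable f (gaussianReal 0 1) := by
  rw [gaussianReal_of_var_ne_zero 0 one_ne_zero, integrable_withDensity_iff_integrable_smul'
    (measurable_gaussianPDF 0 1) (ae_of_all _ fun _ => gaussianPDF_lt_top)]
  simpa only [toReal_gaussianPDF, smul_eq_mul] using hf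

theorem integrable_exp_sq_gaussianReal :
    Integrable (fun z : ℝ => 256 * Real.exp (3 / 8 * (z ^ 2 + 1))) (gaussianReal 0 1) := by
  refine integrable_gaussianReal_of_smul ?_
  have h := (integrable_exp_neg_mul_sq (b := 1 / 8) (by norm_num)).const_mul
    ((√(2 * Real.pi))⁻¹ * 256 * Real.exp (3 / 8))
  refine h.congr (ae_of_all _ fun z => ?_)
  have e : Real.exp (-(1 / 8) * z ^ 2) = Real.exp (-z ^ 2 / 2) * Real.exp (3 / 8 * z ^ 2) := by
    rw [← Real.exp_add]
    congr 1
    ring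
  simp only [gaussianPDFReal, NNReal.coe_one, mul_one, sub_zero, mul_add, Real.exp_add, e]
  ring

/-- The score for the scale is centred: `(u² - 1 / (α + 1)) exp (-(α + 1) u² / 2)` is the derivative
of a multiple of `u exp (-(α + 1) u² / 2)`. -/
theorem integral_phi2_gaussianReal (hα : 0 ≤ α) : ∫ z, phi2 α z ∂gaussianReal 0 1 = 0 := by
  have hb : 0 < (α + 1) / 2 := by positivity
  have hα1 : α + 1 ≠ 0 := by positivity
  set G : ℝ → ℝ := fun x => x * Real.exp (-((α + 1) / 2) * x ^ 2) with hG
  set G' : ℝ → ℝ := fun x => (1 - (α + 1) * x ^ 2) * Real.exp (-((α + 1) / 2) * x ^ 2) with hG'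
  have hd : ∀ x, HasDerivAt G (G' x) x := by
    intro x
    have := (hasDerivAt_id' x).fun_mul (hasDerivAt_expFactor (α := α + 1) (hasDerivAt_id' x))
    refine this.congr_deriv ?_
    simp only [hG']
    ring
  have hiG : Integrable G := integrable_mul_exp_neg_mul_sq hb
  have hiG' : Integrable G' := by
    have h1 := integrable_exp_neg_mul_sq hb
    have h2 := (integrable_rpow_mul_exp_neg_mul_sq hb (s := 2) (by norm_num)).const_mul (α + 1)
    refine (h1.sub h2).congr (ae_of_all _ fun x => ?_)
    simp only [hG', Pi.sub_apply, Real.rpow_two]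
    ring
  have h0 := integral_eq_zero_of_hasDerivAt_of_integrable hd hiG' hiG
  rw [integral_gaussianReal_eq_integral_smul one_ne_zero]
  have : ∀ x, gaussianPDFReal 0 1 x • phi2 α x = -((√(2 * Real.pi))⁻¹ / (α + 1)) * G' x := by
    intro x
    have e : Real.exp (-((α + 1) / 2) * x ^ 2) =
        Real.exp (-x ^ 2 / 2) * Real.exp (-(α / 2) * x ^ 2) := by
      rw [← Real.exp_add]
      congr 1
      ring
    simp only [gaussianPDFReal, phi2, hG', NNReal.coe_one, mul_one, sub_zero, smul_eq_mul, e]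
    field_simp
    ring
  simp only [this, integral_const_mul, h0, mul_zero]

theorem exp_le_one_add_add_sq_mul_exp (x : ℝ) :
    Real.exp x ≤ 1 + x + x ^ 2 * Real.exp |x| := by
  have hone : 1 ≤ Real.exp |x| := Real.one_le_exp (abs_nonneg x)
  rcases le_or_gt |x| 1 with h | h
  · have h1 := (abs_le.mp (Real.abs_exp_sub_one_sub_id_le h)).2
    nlinarith [sq_nonneg x]
  · have hsq : 1 ≤ x ^ 2 := by
      rw [← sq_abs]
      nlinarith
    rcases le_or_gt 0 x with hx | hx
    · rw [abs_of_nonneg hx] at *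
      nlinarith [Real.exp_pos x]
    · have h1 : Real.exp x ≤ 1 := Real.exp_le_one_iff.mpr hx.le
      rw [abs_of_neg hx] at h
      have h2 : -x ≤ x ^ 2 := by nlinarith
      nlinarith

/-- The score for the scale is subexponential. -/
theorem exists_mgf_phi2_le (hα : 0 ≤ α) : ∃ D : ℝ, 0 ≤ D ∧ ∀ t : ℝ, |t| ≤ 1 / 4 →
    Integrable (fun z => Real.exp (t * phi2 α z)) (gaussianReal 0 1) ∧
      mgf (phi2 α) (gaussianReal 0 1) t ≤ Real.exp (D * t ^ 2) := by
  set H : ℝ → ℝ := fun z => 256 * Real.exp (3 / 8 * (z ^ 2 + 1)) with hH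
  have hHint : Integrable H (gaussianReal 0 1) := integrable_exp_sq_gaussianReal
  refine ⟨∫ z, H z ∂gaussianReal 0 1, integral_nonneg fun z => by positivity, fun t ht => ?_⟩
  have habs : ∀ z, |t * phi2 α z| ≤ (z ^ 2 + 1) / 4 := fun z => by
    rw [abs_mul]
    calc |t| * |phi2 α z| ≤ 1 / 4 * (z ^ 2 + 1) :=
          mul_le_mul ht (abs_phi2_le hα z) (abs_nonneg _) (by norm_num)
      _ = _ := by ring
  have hφ : Integrable (phi2 α) (gaussianReal 0 1) := by
    refine hHint.mono' (by fun_prop) (ae_of_all _ fun z => ?_)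
    rw [Real.norm_eq_abs]
    refine (abs_phi2_le hα z).trans ?_
    have := Real.add_one_le_exp (3 / 8 * (z ^ 2 + 1))
    simp only [hH]
    nlinarith [sq_nonneg z]
  have hint : Integrable (fun z => Real.exp (t * phi2 α z)) (gaussianReal 0 1) := by
    refine hHint.mono' (by fun_prop) (ae_of_all _ fun z => ?_)
    rw [Real.norm_eq_abs, Real.abs_exp]
    have h1 : Real.exp (t * phi2 α z) ≤ Real.exp (3 / 8 * (z ^ 2 + 1)) := by
      refine Real.exp_le_exp.mpr ((le_abs_self _).trans ((habs z).trans ?_))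
      nlinarith [sq_nonneg z]
    have := Real.exp_pos (3 / 8 * (z ^ 2 + 1))
    simp only [hH]
    linarith
  refine ⟨hint, ?_⟩
  have hpt : ∀ z, Real.exp (t * phi2 α z) ≤ 1 + t * phi2 α z + t ^ 2 * H z := by
    intro z
    refine (exp_le_one_add_add_sq_mul_exp _).trans ?_
    have h1 : phi2 α z ^ 2 ≤ (z ^ 2 + 1) ^ 2 := by
      rw [← sq_abs]
      exact pow_le_pow_left₀ (abs_nonneg _) (abs_phi2_le hα z) 2
    -- `w / 16 ≤ exp (w / 16)` gives `w² ≤ 256 exp (w / 8)`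
    have h2 : (z ^ 2 + 1) ^ 2 ≤ 256 * Real.exp ((z ^ 2 + 1) / 8) := by
      have h3 := Real.add_one_le_exp ((z ^ 2 + 1) / 16)
      have h4 : (z ^ 2 + 1) / 16 ≤ Real.exp ((z ^ 2 + 1) / 16) := by linarith
      have h5 := pow_le_pow_left₀ (by positivity) h4 2
      have h6 : Real.exp ((z ^ 2 + 1) / 16) ^ 2 = Real.exp ((z ^ 2 + 1) / 8) := by
        rw [← Real.exp_nat_mul]
        congr 1
        push_cast
        ring
      rw [h6] at h5
      linarith
    have h7 : Real.exp |t * phi2 α z| ≤ Real.exp ((z ^ 2 + 1) / 4) := Real.exp_le_exp.mpr (habs z)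
    have h8 : phi2 α z ^ 2 * Real.exp |t * phi2 α z| ≤ H z := by
      calc phi2 α z ^ 2 * Real.exp |t * phi2 α z|
          ≤ 256 * Real.exp ((z ^ 2 + 1) / 8) * Real.exp ((z ^ 2 + 1) / 4) :=
            mul_le_mul (h1.trans h2) h7 (Real.exp_pos _).le (by positivity)
        _ = H z := by
            rw [mul_assoc, ← Real.exp_add]
            simp only [hH]
            congr 2
            ring
    have h9 := mul_le_mul_of_nonneg_left h8 (sq_nonneg t)
    rw [mul_pow]
    linarith
  have h1t : Integrable (fun z => 1 + t * phi2 α z) (gaussianReal 0 1) :=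
    (integrable_const 1).add (hφ.const_mul t)
  have hI : Integrable (fun z => 1 + t * phi2 α z + t ^ 2 * H z) (gaussianReal 0 1) :=
    h1t.add (hHint.const_mul _)
  calc mgf (phi2 α) (gaussianReal 0 1) t
      ≤ ∫ z, 1 + t * phi2 α z + t ^ 2 * H z ∂gaussianReal 0 1 := integral_mono hint hI hpt
    _ = 1 + t ^ 2 * ∫ z, H z ∂gaussianReal 0 1 := by
        rw [integral_add h1t (hHint.const_mul _),
          integral_add (integrable_const 1) (hφ.const_mul t), integral_const_mul,
          integral_const_mul, integral_phi2_gaussianReal hα]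
        simp
    _ ≤ Real.exp ((∫ z, H z ∂gaussianReal 0 1) * t ^ 2) := by
        have := Real.add_one_le_exp ((∫ z, H z ∂gaussianReal 0 1) * t ^ 2)
        linarith

end Gaussian

section Tails

variable {α σ₀ : ℝ} {n : ℕ}

/-- The law of the noise vector. -/
noncomputable abbrev noiseLaw (n : ℕ) (σ₀ : ℝ) : Measure (Fin n → ℝ) :=
  Measure.pi fun _ => gaussianReal 0 (σ₀ ^ 2).toNNReal

theorem gaussianReal_map_standardize (hσ₀ : 0 < σ₀) :
    (gaussianReal 0 (σ₀ ^ 2).toNNReal).map (fun u => u / σ₀) = gaussianReal 0 1 := by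
  rw [gaussianReal_map_div_const, zero_div]
  congr 1
  ext
  simp [hσ₀.ne', sq_nonneg]

theorem measurable_standardize (i : Fin n) : Measurable fun u : Fin n → ℝ => u i / σ₀ :=
  Measurable.div_const (measurable_pi_apply (X := fun _ : Fin n => ℝ) i) σ₀

theorem noiseLaw_map_eval (hσ₀ : 0 < σ₀) (i : Fin n) :
    (noiseLaw n σ₀).map (fun u => u i / σ₀) = gaussianReal 0 1 := by
  rw [← gaussianReal_map_standardize hσ₀,
    ← (measurePreserving_eval (fun _ : Fin n => gaussianReal 0 (σ₀ ^ 2).toNNReal) i).map_eq,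
    Measure.map_map (by fun_prop) (by fun_prop)]
  rfl

theorem iIndepFun_noise (f : Fin n → ℝ → ℝ) (hf : ∀ i, Measurable (f i)) :
    iIndepFun (fun i (u : Fin n → ℝ) => f i (u i)) (noiseLaw n σ₀) :=
  iIndepFun_pi fun i => (hf i).aemeasurable

theorem measure_abs_ge_le {Ω : Type*} [MeasurableSpace Ω] {ν : Measure Ω} [IsFiniteMeasure ν]
    {S : Ω → ℝ} {a q : ℝ} (h1 : ν.real {u | a ≤ S u} ≤ q) (h2 : ν.real {u | a ≤ -S u} ≤ q) :
    ν {u | a ≤ |S u|} ≤ ENNReal.ofReal (2 * q) := by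
  have hsub : {u | a ≤ |S u|} ⊆ {u | a ≤ S u} ∪ {u | a ≤ -S u} := by
    intro u hu
    simpa only [Set.mem_union, Set.mem_ofPred_eq, le_abs] using hu
  rw [← ofReal_measureReal]
  refine ENNReal.ofReal_le_ofReal ((measureReal_mono hsub).trans
    ((measureReal_union_le _ _).trans ?_))
  linarith

/-- Tail bound for the scores of the coefficients, given the design. -/
theorem measure_phi1_tail_le (hα : 0 ≤ α) (hσ₀ : 0 < σ₀) {x : Fin n → ℝ} {V a : ℝ} (hV : 0 ≤ V)
    (hx : ∑ i, x i ^ 2 ≤ V) (ha : 0 ≤ a) :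
    noiseLaw n σ₀ {u | a ≤ |∑ i, phi1 α (u i / σ₀) * x i|} ≤
      ENNReal.ofReal (2 * Real.exp (-a ^ 2 / (2 * V))) := by
  have hsub : ∀ i ∈ (Finset.univ : Finset (Fin n)), HasSubgaussianMGF
      (fun u : Fin n → ℝ => phi1 α (u i / σ₀) * x i) ((NNReal.mk (x i ^ 2) (sq_nonneg _)) * 1)
      (noiseLaw n σ₀) := by
    intro i _
    have h1 : HasSubgaussianMGF (phi1 α) 1
        ((noiseLaw n σ₀).map (fun u : Fin n → ℝ => u i / σ₀)) := by
      rw [noiseLaw_map_eval hσ₀]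
      exact hasSubgaussianMGF_phi1 hα
    have h2 := (h1.of_map (measurable_standardize i).aemeasurable).const_mul (x i)
    simp only [Function.comp, mul_comm (x i)] at h2
    exact h2
  have hsum := HasSubgaussianMGF.sum_of_iIndepFun (iIndepFun_noise (σ₀ := σ₀)
    (fun i u => phi1 α (u / σ₀) * x i) (fun i => by fun_prop)) hsub
  have hS : HasSubgaussianMGF (fun u : Fin n → ℝ => ∑ i, phi1 α (u i / σ₀) * x i) (NNReal.mk V hV)
      (noiseLaw n σ₀) := by
    refine ⟨hsum.integrable_exp_mul, fun t => (hsum.mgf_le t).trans (Real.exp_le_exp.mpr ?_)⟩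
    push_cast
    simp only [mul_one]
    gcongr
  exact measure_abs_ge_le (hS.measure_ge_le ha) (hS.neg.measure_ge_le ha)

/-- Tail bound for the score of the scale. -/
theorem exists_measure_phi2_tail_le (hα : 0 ≤ α) (hσ₀ : 0 < σ₀) : ∃ D : ℝ, 0 ≤ D ∧
    ∀ (n : ℕ) (t a : ℝ), 0 ≤ t → t ≤ 1 / 4 →
      noiseLaw n σ₀ {u | a ≤ |∑ i, phi2 α (u i / σ₀)|} ≤
        ENNReal.ofReal (2 * Real.exp (-t * a + n * (D * t ^ 2))) := by
  obtain ⟨D, hD, hmgf⟩ := exists_mgf_phi2_le hα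
  refine ⟨D, hD, fun n t a ht0 ht => ?_⟩
  have hindep := iIndepFun_noise (n := n) (σ₀ := σ₀) (fun _ u => phi2 α (u / σ₀))
    (fun i => by fun_prop)
  have hsum : (∑ i, fun u : Fin n → ℝ => phi2 α (u i / σ₀)) =
      fun u => ∑ i, phi2 α (u i / σ₀) := by
    ext u
    simp
  have key : ∀ t : ℝ, |t| ≤ 1 / 4 →
      Integrable (fun u : Fin n → ℝ => Real.exp (t * ∑ i, phi2 α (u i / σ₀))) (noiseLaw n σ₀) ∧
      mgf (fun u : Fin n → ℝ => ∑ i, phi2 α (u i / σ₀)) (noiseLaw n σ₀) t ≤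
        Real.exp (n * (D * t ^ 2)) := by
    intro t ht
    obtain ⟨hi, hm⟩ := hmgf t ht
    have hi' : ∀ i : Fin n, Integrable (fun u : Fin n → ℝ => Real.exp (t * phi2 α (u i / σ₀)))
        (noiseLaw n σ₀) := by
      intro i
      rw [← noiseLaw_map_eval (n := n) hσ₀ i] at hi
      exact (integrable_map_measure (g := fun z => Real.exp (t * phi2 α z)) (by fun_prop)
        (measurable_standardize i).aemeasurable).mp hi
    have hm' : ∀ i : Fin n, mgf (fun u : Fin n → ℝ => phi2 α (u i / σ₀)) (noiseLaw n σ₀) t ≤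
        Real.exp (D * t ^ 2) := by
      intro i
      rw [← noiseLaw_map_eval (n := n) hσ₀ i,
        mgf_map (measurable_standardize i).aemeasurable (by fun_prop)] at hm
      exact hm
    constructor
    · have := hindep.integrable_exp_mul_sum (fun i => by fun_prop) (s := Finset.univ)
        (fun i _ => hi' i)
      rwa [hsum] at this
    · have := hindep.mgf_sum (t := t) (fun i => by fun_prop) Finset.univ
      rw [hsum] at this
      rw [this, Real.exp_nat_mul]
      refine (Finset.prod_le_prod (fun i _ => mgf_nonneg) fun i _ => hm' i).trans_eq ?_
      simp
  obtain ⟨hi1, hm1⟩ := key t (by rwa [abs_of_nonneg ht0])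
  obtain ⟨hi2, hm2⟩ := key (-t) (by rwa [abs_neg, abs_of_nonneg ht0])
  refine measure_abs_ge_le ?_ ?_
  · rw [Real.exp_add]
    exact (measure_ge_le_exp_mul_mgf a ht0 hi1).trans (by gcongr)
  · rw [Real.exp_add]
    have hneg : (fun u : Fin n → ℝ => Real.exp (t * -∑ i, phi2 α (u i / σ₀))) =
        fun u => Real.exp (-t * ∑ i, phi2 α (u i / σ₀)) := by
      ext u
      rw [neg_mul_comm]
    refine (measure_ge_le_exp_mul_mgf a ht0 (by rw [hneg]; exact hi2)).trans ?_
    rw [neg_sq] at hm2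
    refine mul_le_mul_of_nonneg_left (le_trans (le_of_eq ?_) hm2) (Real.exp_pos _).le
    simp only [mgf, hneg]

/-- A bound on the conditional probabilities given an independent variable bounds the
probability. -/
theorem measure_le_of_forall_section {Ω A B : Type*} [MeasurableSpace Ω] [MeasurableSpace A]
    [MeasurableSpace B] {μ : Measure Ω} [IsProbabilityMeasure μ] {X : Ω → A} {U : Ω → B}
    (hX : Measurable X) (hU : Measurable U) (hindep : IndepFun X U μ) {T : Set (A × B)}
    (hT : MeasurableSet T) {q : ENNReal} (hq : ∀ x, μ.map U (Prod.mk x ⁻¹' T) ≤ q) :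
    μ {ω | (X ω, U ω) ∈ T} ≤ q := by
  have hpX : IsProbabilityMeasure (μ.map X) := Measure.isProbabilityMeasure_map hX.aemeasurable
  have hpU : IsProbabilityMeasure (μ.map U) := Measure.isProbabilityMeasure_map hU.aemeasurable
  have h1 : μ {ω | (X ω, U ω) ∈ T} = (μ.map X).prod (μ.map U) T := by
    rw [← (indepFun_iff_map_prod_eq_prod_map_map hX.aemeasurable hU.aemeasurable).mp hindep,
      Measure.map_apply (hX.prodMk hU) hT]
    rfl
  rw [h1, Measure.prod_apply hT]
  refine (lintegral_mono hq).trans ?_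
  simp

end Tails

/-! ### Scores at the truth and union bound -/

section ScoresAtTruth

variable {n p : ℕ} {α : ℝ} {X : Matrix (Fin n) (Fin p) ℝ} {u : Fin n → ℝ} {β₀ : Fin p → ℝ}
  {σ₀ : ℝ}

theorem extend_trueParam : extend β₀ (trueParam β₀ σ₀) = β₀ := by
  funext j
  by_cases h : β₀ j = 0 <;> simp [extend, trueParam, h]

theorem resid_trueParam (i : Fin n) :
    resid X (X.mulVec β₀ + u) (extend β₀ (trueParam β₀ σ₀)) σ₀ i = u i / σ₀ := by
  simp [resid, extend_trueParam]

theorem weight_nonneg (hα : 0 ≤ α) (hσ₀ : 0 < σ₀) : 0 ≤ weight α σ₀ := by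
  unfold weight
  split_ifs <;> positivity

theorem abs_gammaFun_coef (hα : 0 ≤ α) (hσ₀ : 0 < σ₀) (k : Fin p) :
    |gammaFun α X (X.mulVec β₀ + u) β₀ (Sum.inl k) (trueParam β₀ σ₀)| =
      weight α σ₀ * |∑ i, phi1 α (u i / σ₀) * X i k| := by
  change |weight α σ₀ * ∑ i, phi1 α (resid X (X.mulVec β₀ + u)
    (extend β₀ (trueParam β₀ σ₀)) σ₀ i) * X i k| = _
  simp only [resid_trueParam, abs_mul, abs_of_nonneg (weight_nonneg hα hσ₀)]

theorem abs_gammaFun_scale (hα : 0 ≤ α) (hσ₀ : 0 < σ₀) :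
    |gammaFun α X (X.mulVec β₀ + u) β₀ (Sum.inr ()) (trueParam β₀ σ₀)| =
      weight α σ₀ * |∑ i, phi2 α (u i / σ₀)| := by
  change |weight α σ₀ * ∑ i, phi2 α (resid X (X.mulVec β₀ + u)
    (extend β₀ (trueParam β₀ σ₀)) σ₀ i)| = _
  simp only [resid_trueParam, abs_mul, abs_of_nonneg (weight_nonneg hα hσ₀)]

theorem DataConditions.mono_const {pen : ℝ → ℝ → ℝ} {l b τ₁ τs C K K' ε : ℝ} {y : Fin n → ℝ}
    (h : DataConditions α pen l b τ₁ τs C K ε β₀ σ₀ X y) (hK : K ≤ K') (hb : 0 ≤ b) :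
    DataConditions α pen l b τ₁ τs C K' ε β₀ σ₀ X y where
  column_norm j := (h.column_norm j).trans (by gcongr)
  det_isUnit := h.det_isUnit
  inv_bound := h.inv_bound.trans (by gcongr)
  irrep_slope := h.irrep_slope
  irrep_rate := h.irrep_rate.trans (by gcongr)
  hessian_bound z hz j := (h.hessian_bound z hz j).trans (by gcongr)
  concavity := h.concavity
  entries := h.entries

theorem card_null_add_sparsity (β₀ : Fin p → ℝ) :
    (Fintype.card (Null β₀) : ℝ) = p - sparsity β₀ := by
  have h := Fintype.card_subtype_compl (fun j => β₀ j ≠ 0)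
  have h2 := Fintype.card_subtype_le (fun j => β₀ j ≠ 0)
  have h3 : Fintype.card (Null β₀) = Fintype.card {j // ¬ β₀ j ≠ 0} :=
    Fintype.card_congr (Equiv.subtypeEquivRight fun j => by simp)
  rw [Fintype.card_fin] at h h2
  rw [h3, h, Nat.cast_sub h2]
  rfl

end ScoresAtTruth

section UnionBound

variable {Ω : Type*} [MeasurableSpace Ω] {μ : Measure Ω}
  {n p : ℕ} {α σ₀ : ℝ} {X : Ω → Fin n → Fin p → ℝ} {U : Ω → Fin n → ℝ}

/-- Tail of the score of one coefficient, for a random design independent of the noise. -/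
theorem measure_coef_tail_le [IsProbabilityMeasure μ] (hα : 0 ≤ α) (hσ₀ : 0 < σ₀)
    (hX : Measurable X) (hU : Measurable U)
    (hlaw : μ.map U = noiseLaw n σ₀) (hindep : IndepFun X U μ) {V a : ℝ} (hV : 0 ≤ V) (ha : 0 ≤ a)
    (k : Fin p) :
    μ {ω | ∑ i, X ω i k ^ 2 ≤ V ∧ a ≤ |∑ i, phi1 α (U ω i / σ₀) * X ω i k|} ≤
      ENNReal.ofReal (2 * Real.exp (-a ^ 2 / (2 * V))) := by
  refine measure_le_of_forall_section hX hU hindep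
    (T := {q | ∑ i, q.1 i k ^ 2 ≤ V ∧ a ≤ |∑ i, phi1 α (q.2 i / σ₀) * q.1 i k|}) ?_ ?_
  · have h1 : Continuous fun q : (Fin n → Fin p → ℝ) × (Fin n → ℝ) => ∑ i, q.1 i k ^ 2 := by
      fun_prop
    have h2 : Continuous fun q : (Fin n → Fin p → ℝ) × (Fin n → ℝ) =>
        |∑ i, phi1 α (q.2 i / σ₀) * q.1 i k| := by
      fun_prop
    exact (measurableSet_le h1.measurable measurable_const).inter
      (measurableSet_le measurable_const h2.measurable)
  · intro x
    rw [hlaw]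
    by_cases hx : ∑ i, x i k ^ 2 ≤ V
    · refine (measure_mono fun u hu => ?_).trans
        (measure_phi1_tail_le (x := fun i => x i k) hα hσ₀ hV hx ha)
      exact hu.2
    · have : (Prod.mk x ⁻¹' {q : (Fin n → Fin p → ℝ) × (Fin n → ℝ) |
          ∑ i, q.1 i k ^ 2 ≤ V ∧ a ≤ |∑ i, phi1 α (q.2 i / σ₀) * q.1 i k|}) = ∅ :=
        Set.eq_empty_of_forall_notMem fun u hu => hx hu.1
      rw [this, measure_empty]
      exact zero_le

/-- Union bound over the scores of all parameters: `qS` for the coefficients of the support and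
the scale, `qN` for the null coefficients. -/
theorem measure_le_of_scores {β₀ : Fin p → ℝ} {T : Set Ω} {A : Fin p → Set Ω} {B : Set Ω}
    {qS qN : ℝ} (hqS : 0 ≤ qS) (hqN : 0 ≤ qN)
    (hT : T ⊆ (⋃ k : Supp β₀, A k) ∪ B ∪ ⋃ k : Null β₀, A k)
    (hS : ∀ k : Supp β₀, μ (A k) ≤ ENNReal.ofReal qS) (hB : μ B ≤ ENNReal.ofReal qS)
    (hN : ∀ k : Null β₀, μ (A k) ≤ ENNReal.ofReal qN) :
    μ T ≤ ENNReal.ofReal ((1 + sparsity β₀) * qS + (p - sparsity β₀) * qN) := by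
  have h1 : μ (⋃ k : Supp β₀, A k) ≤ ENNReal.ofReal (sparsity β₀ * qS) := by
    refine (measure_iUnion_fintype_le _ _).trans ((Finset.sum_le_sum fun k _ => hS k).trans ?_)
    rw [Finset.sum_const, Finset.card_univ, nsmul_eq_mul, ENNReal.ofReal_mul (by positivity),
      ENNReal.ofReal_natCast]
    rfl
  have h2 : μ (⋃ k : Null β₀, A k) ≤ ENNReal.ofReal ((p - sparsity β₀) * qN) := by
    refine (measure_iUnion_fintype_le _ _).trans ((Finset.sum_le_sum fun k _ => hN k).trans ?_)
    rw [Finset.sum_const, Finset.card_univ, nsmul_eq_mul, ← card_null_add_sparsity,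
      ENNReal.ofReal_mul (by positivity), ENNReal.ofReal_natCast]
  have h3 : 0 ≤ (p - sparsity β₀ : ℝ) * qN := by
    rw [← card_null_add_sparsity]
    positivity
  calc μ T ≤ μ (⋃ k : Supp β₀, A k) + μ B + μ (⋃ k : Null β₀, A k) :=
        (measure_mono hT).trans ((measure_union_le _ _).trans
          (add_le_add_left (measure_union_le _ _) _))
    _ ≤ ENNReal.ofReal (sparsity β₀ * qS) + ENNReal.ofReal qS +
        ENNReal.ofReal ((p - sparsity β₀) * qN) := by gcongr
    _ = _ := by
        rw [← ENNReal.ofReal_add (by positivity) hqS, ← ENNReal.ofReal_add (by positivity) h3]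
        congr 1
        ring

end UnionBound

section Rates

/-- The linearization error is negligible with respect to the radius `L / g`, `L = log n`,
`g = n ^ τ`, `h = √n`. -/
theorem linError_rate {N h g L b s K A δ P : ℝ} (hN : N = h ^ 2) (hh : 0 < h) (hg : 0 < g)
    (hL : 0 < L) (hb : 0 < b) (hs : 0 < s + 1) (hK : 0 ≤ K) (hA : 0 ≤ A)
    (hb1 : b ≤ δ * (h / g * √L)) (hb2 : b ≤ δ * (g / ((s + 1) * L)))
    (hP : P ≤ δ * (b⁻¹ * g⁻¹ * L)) :
    K * (b / N) * (A * (h * √L) + K * N * (s + 1) * (L / g) ^ 2 + N * P) ≤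
      (K * A + K ^ 2 + K) * δ * (L / g) := by
  have hsq : √L * √L = L := Real.mul_self_sqrt hL.le
  have h1 : b / N * (h * √L) ≤ δ * (L / g) := by
    calc b / N * (h * √L) = b * (√L / h) := by rw [hN]; field_simp
      _ ≤ δ * (h / g * √L) * (√L / h) := by gcongr
      _ = δ * (√L * √L / g) := by field_simp
      _ = _ := by rw [hsq]
  have h2 : b * ((s + 1) * (L / g) ^ 2) ≤ δ * (L / g) := by
    calc b * ((s + 1) * (L / g) ^ 2) ≤ δ * (g / ((s + 1) * L)) * ((s + 1) * (L / g) ^ 2) := by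
          gcongr
      _ = _ := by field_simp
  have h3 : b * P ≤ δ * (L / g) := by
    calc b * P ≤ b * (δ * (b⁻¹ * g⁻¹ * L)) := by gcongr
      _ = _ := by field_simp
  have e : K * (b / N) * (A * (h * √L) + K * N * (s + 1) * (L / g) ^ 2 + N * P) =
      K * A * (b / N * (h * √L)) + K ^ 2 * (b * ((s + 1) * (L / g) ^ 2)) + K * (b * P) := by
    have : N ≠ 0 := by rw [hN]; positivity
    field_simp
  rw [e]
  have h4 := mul_le_mul_of_nonneg_left h1 (mul_nonneg hK hA)
  have h5 := mul_le_mul_of_nonneg_left h2 (sq_nonneg K)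
  have h6 := mul_le_mul_of_nonneg_left h3 hK
  linarith

/-- The scores of the null coefficients are dominated by the slope of the penalty at `0`;
`E = n ^ (-τ*)`, `G = n ^ τ₁`. -/
theorem nullScore_rate {N L E G s η r K A w ρ l h q κ C₀ : ℝ} (hN : 0 < N) (hE : 0 < E)
    (hK : 0 ≤ K) (hA : 0 ≤ A) (hL1 : 1 ≤ L) (hG : 1 ≤ G)
    (hκ : 0 < κ) (hl : L ^ 2 * E ≤ l) (hρ : 3 * κ ≤ ρ)
    (hw : 0 ≤ w) (hwL : (w + K * A) * L ≤ κ * L ^ 2)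
    (hq : q = K * N * (s + 1) * (η * r) ^ 2) (hr : G * ((s + 1) * r ^ 2) ≤ C₀ * (L ^ 2 * E))
    (hs : 0 ≤ s + 1) (hη0 : 0 ≤ η) (hη1 : η ≤ 1) (hη : η * ((K + K ^ 2) * C₀) ≤ κ)
    (hGh : G * (h * √L) ≤ N * E * √L) :
    w * (N * E * √L) + q + K * G * (A * (h * √L) + q) < N * (ρ * l) := by
  have hsqrt : √L ≤ L := by
    rw [Real.sqrt_le_left (by linarith)]
    nlinarith
  have hQ : (s + 1) * r ^ 2 ≤ C₀ * (L ^ 2 * E) := by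
    refine le_trans ?_ hr
    exact le_mul_of_one_le_left (by positivity) hG
  have hη2 : η ^ 2 ≤ η := by nlinarith
  have hLE : 0 < L ^ 2 * E := by positivity
  -- quadratic remainders
  have h1 : q ≤ N * (K * C₀ * η * (L ^ 2 * E)) := by
    rw [hq]
    calc K * N * (s + 1) * (η * r) ^ 2 = N * (K * (η ^ 2 * ((s + 1) * r ^ 2))) := by ring
      _ ≤ N * (K * (η * (C₀ * (L ^ 2 * E)))) := by gcongr
      _ = _ := by ring
  have h2 : K * G * q ≤ N * (K ^ 2 * C₀ * η * (L ^ 2 * E)) := by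
    rw [hq]
    calc K * G * (K * N * (s + 1) * (η * r) ^ 2) =
          N * (K ^ 2 * (η ^ 2 * (G * ((s + 1) * r ^ 2)))) := by ring
      _ ≤ N * (K ^ 2 * (η * (C₀ * (L ^ 2 * E)))) := by gcongr
      _ = _ := by ring
  have h3 : q + K * G * q ≤ N * (κ * (L ^ 2 * E)) := by
    have := mul_le_mul_of_nonneg_left hη (mul_nonneg hN.le hLE.le)
    nlinarith
  -- stochastic terms
  have h4 : w * (N * E * √L) ≤ N * E * (w * L) := by
    calc w * (N * E * √L) = N * E * (w * √L) := by ring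
      _ ≤ _ := by gcongr
  have h5 : K * G * (A * (h * √L)) ≤ N * E * (K * A * L) := by
    calc K * G * (A * (h * √L)) = K * A * (G * (h * √L)) := by ring
      _ ≤ K * A * (N * E * √L) := by gcongr
      _ ≤ K * A * (N * E * L) := by gcongr
      _ = _ := by ring
  have h6 : N * E * ((w + K * A) * L) ≤ N * E * (κ * L ^ 2) := by gcongr
  have h7 : N * (3 * κ * (L ^ 2 * E)) ≤ N * (ρ * l) := by
    have hρ0 : 0 ≤ ρ := by linarith
    gcongr
  have h8 : 0 < N * (κ * (L ^ 2 * E)) := by positivity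
  linarith

end Rates

/-! ### Rates and the probability bound -/

section Asymptotics

theorem rpow_sparsity_le {N T τ τ₀ τ₁ : ℝ} (hN : 1 ≤ N) (hT : T ≤ 2 * τ - τ₀ - τ₁) :
    N ^ τ₁ * N ^ τ₀ * ((N ^ τ)⁻¹ * (N ^ τ)⁻¹) ≤ N ^ (-T) := by
  have hN0 : 0 < N := by linarith
  rw [← Real.rpow_neg hN0.le, ← Real.rpow_add hN0, ← Real.rpow_add hN0, ← Real.rpow_add hN0]
  exact Real.rpow_le_rpow_of_exponent_le hN (by linarith)

theorem rpow_mul_sqrt_le {N T τ₁ : ℝ} (hN : 1 ≤ N) (hT : T ≤ 1 / 2 - τ₁) :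
    N ^ τ₁ * √N ≤ N * N ^ (-T) := by
  have hN0 : 0 < N := by linarith
  have h1 : N * N ^ (-T) = N ^ (1 + -T) := by rw [Real.rpow_add hN0, Real.rpow_one]
  rw [Real.sqrt_eq_rpow, ← Real.rpow_add hN0, h1]
  exact Real.rpow_le_rpow_of_exponent_le hN (by linarith)

/-- The Hessian of the scores stays small compared with the information on the cube of radius
`L / g`. -/
theorem contraction_rate {N L g b s K δ : ℝ} (hN : 0 < N) (hg : 0 < g) (hL : 0 < L)
    (hs : 0 < s + 1) (hb2 : b ≤ δ * (g / ((s + 1) * L))) (hδ : K ^ 2 * δ < 1) :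
    K * (b / N) * (K * N * (s + 1) * (L / g)) < 1 := by
  have e : K * (b / N) * (K * N * (s + 1) * (L / g)) = K ^ 2 * (b * ((s + 1) * (L / g))) := by
    field_simp
  have h1 : b * ((s + 1) * (L / g)) ≤ δ := by
    calc b * ((s + 1) * (L / g)) ≤ δ * (g / ((s + 1) * L)) * ((s + 1) * (L / g)) := by gcongr
      _ = δ := by field_simp
  rw [e]
  exact (mul_le_mul_of_nonneg_left h1 (sq_nonneg K)).trans_lt hδ

/-- The bound on the curvature of the scores of the null coefficients, with `G = n ^ τ₁` and
`E = n ^ (-τ*)`. -/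
theorem remainder_rate {N L E g s C₁ τ τ₀ τ₁ T : ℝ} (hN : 1 ≤ N) (hg : g = N ^ τ)
    (hE : E = N ^ (-T)) (hT : T ≤ 2 * τ - τ₀ - τ₁) (hC₁ : 0 < C₁) (hs : s + 1 ≤ C₁ * N ^ τ₀) :
    N ^ τ₁ * ((s + 1) * (L / g) ^ 2) ≤ C₁ * (L ^ 2 * E) := by
  have hN0 : 0 < N := by linarith
  have hg0 : 0 < g := hg ▸ Real.rpow_pos_of_pos hN0 τ
  have h3 : N ^ τ₁ * N ^ τ₀ * (g⁻¹ * g⁻¹) ≤ E := by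
    rw [hg, hE]
    exact rpow_sparsity_le hN hT
  calc N ^ τ₁ * ((s + 1) * (L / g) ^ 2) ≤ N ^ τ₁ * (C₁ * N ^ τ₀ * (L / g) ^ 2) := by gcongr
    _ = C₁ * (L ^ 2 * (N ^ τ₁ * N ^ τ₀ * (g⁻¹ * g⁻¹))) := by
        rw [div_pow, div_eq_mul_inv, pow_two g, mul_inv]
        ring
    _ ≤ C₁ * (L ^ 2 * E) := by gcongr

set_option maxHeartbeats 1000000 in
/-- For large `n` the rate conditions of the deterministic argument hold on the cube of radius
`n ^ (-τ) log n`, when the score on the support is of order `√(n log n)` and the score off the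
support of order `n ^ (1 - τ*) √(log n)`. -/
theorem eventually_rates {p : ℕ → ℕ} {β₀ : (n : ℕ) → Fin (p n) → ℝ} {σ₀ : ℝ} (hσ₀ : 0 < σ₀)
    {pen : ℝ → ℝ → ℝ} (hpen : PenaltyCondition pen) {l : ℕ → ℝ}
    (hs1 : ∀ n, 1 ≤ sparsity (β₀ n)) {τ τ₀ τ₁ : ℝ} (hτ : 0 < τ) (hτ₁ : 0 ≤ τ₁)
    (hτ₀ : (fun n => (sparsity (β₀ n) : ℝ)) =O[atTop] fun n : ℕ => (n : ℝ) ^ τ₀)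
    {b : ℕ → ℝ} (hb_pos : ∀ n, 0 < b n)
    (hb : b =o[atTop] fun n : ℕ => min ((n : ℝ) ^ (1 / 2 - τ) * √(Real.log n))
      ((n : ℝ) ^ τ / (((sparsity (β₀ n) : ℝ) + 1) * Real.log n)))
    (hdpen : (fun n => dpen pen (l n) (halfMinSignal (β₀ n))) =o[atTop]
      fun n : ℕ => (b n)⁻¹ * (n : ℝ) ^ (-τ) * Real.log n)
    (hl : ∀ᶠ n : ℕ in atTop, Real.log n ^ 2 * (n : ℝ) ^ (-tauStar τ τ₀ τ₁) ≤ l n)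
    {C K' A w : ℝ} (hC : C < 1) (hK0 : 0 < K') (hA0 : 0 ≤ A) (hw0 : 0 ≤ w) :
    ∃ η < 1, ∀ᶠ n : ℕ in atTop,
      0 < l n ∧ 0 < (n : ℝ) ^ (-τ) * Real.log n ∧ (n : ℝ) ^ (-τ) * Real.log n < σ₀ ∧
      K' * (b n / n) * (A * (√n * √(Real.log n)) +
        K' * n * (sparsity (β₀ n) + 1) * ((n : ℝ) ^ (-τ) * Real.log n) ^ 2 +
        n * dpen pen (l n) (halfMinSignal (β₀ n))) ≤ η * ((n : ℝ) ^ (-τ) * Real.log n) ∧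
      K' * (b n / n) *
        (K' * n * (sparsity (β₀ n) + 1) * ((n : ℝ) ^ (-τ) * Real.log n)) < 1 ∧
      w * (n * (n : ℝ) ^ (-tauStar τ τ₀ τ₁) * √(Real.log n)) +
        K' * n * (sparsity (β₀ n) + 1) * (η * ((n : ℝ) ^ (-τ) * Real.log n)) ^ 2 +
        K' * (n : ℝ) ^ τ₁ * (A * (√n * √(Real.log n)) +
          K' * n * (sparsity (β₀ n) + 1) * (η * ((n : ℝ) ^ (-τ) * Real.log n)) ^ 2) <
        (1 - C) * n * dpen pen (l n) 0 := by
  obtain ⟨ρ, hρ, hslope⟩ := hpen.slope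
  obtain ⟨C₁, hC₁, hsC₁⟩ := hτ₀.exists_pos
  -- `η` is the relative error of the stationary point, `δ` the rate of `b`
  set κ := (1 - C) * ρ / 3 with hκdef
  have hC1 : 0 < 1 - C := by linarith
  have hκ : 0 < κ := by positivity
  set Q := (K' + K' ^ 2) * (2 * C₁) with hQ
  have hQ0 : 0 < Q := by positivity
  set η := min (1 / 2) (κ / Q) with hη
  have hη0 : 0 < η := lt_min (by norm_num) (by positivity)
  have hη1 : η < 1 := (min_le_left _ _).trans_lt (by norm_num)
  have hηQ : η * Q ≤ κ := (le_div_iff₀ hQ0).mp (min_le_right _ _)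
  set δ := η / (K' * A + K' ^ 2 + K') with hδ
  have hden : 0 < K' * A + K' ^ 2 + K' := by positivity
  have hδ0 : 0 < δ := by positivity
  set T := tauStar τ τ₀ τ₁ with hT
  have hT1 : T ≤ 1 / 2 - τ₁ := by
    rw [hT, tauStar]
    linarith [min_le_left (1 / 2) (2 * τ - τ₀)]
  have hT2 : T ≤ 2 * τ - τ₀ - τ₁ := by
    rw [hT, tauStar]
    linarith [min_le_right (1 / 2) (2 * τ - τ₀)]
  refine ⟨η, hη1, ?_⟩
  have hlogtop : Tendsto (fun n : ℕ => Real.log n) atTop atTop :=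
    Real.tendsto_log_atTop.comp tendsto_natCast_atTop_atTop
  have hlogτ : ∀ᶠ n : ℕ in atTop, ‖Real.log n‖ ≤ σ₀ / 2 * ‖(n : ℝ) ^ τ‖ :=
    ((isLittleO_log_rpow_atTop hτ).comp_tendsto tendsto_natCast_atTop_atTop).def
      (half_pos hσ₀)
  filter_upwards [eventually_ge_atTop 1, hlogtop.eventually_ge_atTop 1,
    hlogtop.eventually_ge_atTop ((w + K' * A) / κ), hlogτ, hsC₁.bound, hb.def hδ0,
    hdpen.def hδ0, hl] with n hn1 hL1 hLκ hLτ hs' hb' hdpen' hl'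
  set L := Real.log n with hLdef
  set N : ℝ := (n : ℝ) with hNdef
  set s : ℝ := (sparsity (β₀ n) : ℝ) with hsdef
  have hN1 : 1 ≤ N := by
    rw [hNdef]
    exact_mod_cast hn1
  have hN0 : 0 < N := by linarith
  have hL0 : 0 < L := by linarith
  have hs1' : 1 ≤ s := by
    rw [hsdef]
    exact_mod_cast hs1 n
  set h := √N with hh
  have hh0 : 0 < h := Real.sqrt_pos.mpr hN0
  have hhN : N = h ^ 2 := (Real.sq_sqrt hN0.le).symm
  set g := N ^ τ with hg
  have hg0 : 0 < g := Real.rpow_pos_of_pos hN0 τ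
  set E := N ^ (-T) with hE
  have hE0 : 0 < E := Real.rpow_pos_of_pos hN0 _
  have hr : N ^ (-τ) * L = L / g := by
    rw [Real.rpow_neg hN0.le, mul_comm, div_eq_mul_inv]
  set r := L / g with hrdef
  have hr0 : 0 < r := by positivity
  have hrσ : r < σ₀ := by
    rw [Real.norm_eq_abs, Real.norm_eq_abs, abs_of_pos hL0, abs_of_pos hg0] at hLτ
    rw [hrdef, div_lt_iff₀ hg0]
    nlinarith
  have hl0 : 0 < l n := lt_of_lt_of_le (by positivity) hl'
  -- rates of `b` and of the penalty slope
  have hhalf : N ^ (1 / 2 - τ) = h / g := by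
    rw [Real.rpow_sub hN0, hh, Real.sqrt_eq_rpow]
  rw [Real.norm_eq_abs, Real.norm_eq_abs, abs_of_pos (hb_pos n), hhalf, abs_of_pos
    (lt_min (by positivity) (by positivity))] at hb'
  have hb1 : b n ≤ δ * (h / g * √L) :=
    hb'.trans (mul_le_mul_of_nonneg_left (min_le_left _ _) hδ0.le)
  have hb2 : b n ≤ δ * (g / ((s + 1) * L)) :=
    hb'.trans (mul_le_mul_of_nonneg_left (min_le_right _ _) hδ0.le)
  have hP : dpen pen (l n) (halfMinSignal (β₀ n)) ≤ δ * ((b n)⁻¹ * g⁻¹ * L) := by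
    have hbn := hb_pos n
    rw [Real.norm_eq_abs, Real.norm_eq_abs, Real.rpow_neg hN0.le,
      abs_of_pos (show 0 < (b n)⁻¹ * (N ^ τ)⁻¹ * L by positivity)] at hdpen'
    exact (le_abs_self _).trans hdpen'
  have hrate1 : K' * (b n / N) * (A * (h * √L) + K' * N * (s + 1) * r ^ 2 +
      N * dpen pen (l n) (halfMinSignal (β₀ n))) ≤ η * r := by
    refine (linError_rate hhN hh0 hg0 hL0 (hb_pos n) (by linarith) hK0.le hA0 hb1 hb2
      hP).trans_eq ?_
    rw [hδ, mul_div_cancel₀ _ hden.ne']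
  have hrate2 : K' * (b n / N) * (K' * N * (s + 1) * r) < 1 := by
    refine contraction_rate hN0 hg0 hL0 (by linarith) hb2 ?_
    have h2 : K' ^ 2 * δ ≤ η := by
      rw [hδ, ← mul_div_assoc, div_le_iff₀ hden, mul_comm]
      refine mul_le_mul_of_nonneg_left ?_ hη0.le
      linarith [mul_nonneg hK0.le hA0]
    exact h2.trans_lt hη1
  have hrate3 : w * (N * E * √L) + K' * N * (s + 1) * (η * r) ^ 2 + K' * N ^ τ₁ *
      (A * (h * √L) + K' * N * (s + 1) * (η * r) ^ 2) < (1 - C) * N * dpen pen (l n) 0 := by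
    have hd0 : dpen pen (l n) 0 = ρ * l n := (div_eq_iff hl0.ne').mp (hslope _ hl0)
    have h1 : s ≤ C₁ * N ^ τ₀ := by
      rw [Real.norm_eq_abs, Real.norm_eq_abs, abs_of_nonneg (by positivity),
        abs_of_pos (Real.rpow_pos_of_pos hN0 _)] at hs'
      exact hs'
    have hρκ : 3 * κ ≤ (1 - C) * ρ := by
      rw [hκdef]
      linarith
    have hwL : (w + K' * A) * L ≤ κ * L ^ 2 := by
      rw [div_le_iff₀ hκ] at hLκ
      calc (w + K' * A) * L ≤ L * κ * L := by gcongr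
        _ = κ * L ^ 2 := by ring
    have hrem : N ^ τ₁ * ((s + 1) * r ^ 2) ≤ 2 * C₁ * (L ^ 2 * E) :=
      remainder_rate hN1 hg hE hT2 (by positivity) (by linarith)
    have hGh : N ^ τ₁ * (h * √L) ≤ N * E * √L := by
      rw [← mul_assoc]
      exact mul_le_mul_of_nonneg_right (rpow_mul_sqrt_le hN1 hT1) (Real.sqrt_nonneg L)
    have hfin := nullScore_rate hN0 hE0 hK0.le hA0 hL1 (Real.one_le_rpow hN1 hτ₁) hκ hl' hρκ
      hw0 hwL rfl hrem (by linarith) hη0.le hη1.le hηQ hGh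
    rw [hd0]
    calc _ < _ := hfin
      _ = _ := by ring
  rw [hr]
  exact ⟨hl0, hr0, hrσ, hrate1, hrate2, hrate3⟩

end Asymptotics

section ProbabilityBound

variable {Ω : Type*} [MeasurableSpace Ω] {μ : Measure Ω} [IsProbabilityMeasure μ]
  {n p : ℕ} {β₀ : Fin p → ℝ} {σ₀ α : ℝ} {X : Ω → Fin n → Fin p → ℝ} {U : Ω → Fin n → ℝ}
  {pen : ℝ → ℝ → ℝ} {l b τ₁ T C K K' ε D r η : ℝ}

/-- At a fixed sample size: the probability that the conditions on the data hold but no minimizer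
with the oracle properties exists. Outside this event no score exceeds its Gaussian-type
threshold. -/
theorem measure_no_oracleMinimizer_le (hn2 : 2 ≤ n) (hσ₀ : 0 < σ₀) (hX : Measurable X)
    (hU : Measurable U) (hlaw : μ.map U = noiseLaw n σ₀) (hindep : IndepFun X U μ) (hα : 0 ≤ α)
    (hpen : PenaltyCondition pen) (hl0 : 0 < l) (hs1 : 1 ≤ sparsity β₀) (hb : 0 ≤ b)
    (hK : K ≤ K') (hK0 : 0 < K') (hε0 : 0 < ε) (hε : ε < 1 / 2) (hD : 0 ≤ D)
    (htail : ∀ t a : ℝ, 0 ≤ t → t ≤ 1 / 4 →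
      noiseLaw n σ₀ {u | a ≤ |∑ i, phi2 α (u i / σ₀)|} ≤
        ENNReal.ofReal (2 * Real.exp (-t * a + n * (D * t ^ 2))))
    (hLn : Real.log n ≤ 1 / 16 * n)
    (hr0 : 0 < r) (hd : r ≤ halfMinSignal β₀) (hrσ : r < σ₀) (hη1 : η < 1)
    (hrate1 : K' * (b / n) * (weight α σ₀ * (2 * K' + (D + 1)) * (√n * √(Real.log n)) +
      K' * n * (sparsity β₀ + 1) * r ^ 2 + n * dpen pen l (halfMinSignal β₀)) ≤ η * r)
    (hrate2 : K' * (b / n) * (K' * n * (sparsity β₀ + 1) * r) < 1)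
    (hrate3 : weight α σ₀ * (2 * K') * (n * (n : ℝ) ^ (-T) * √(Real.log n)) +
      K' * n * (sparsity β₀ + 1) * (η * r) ^ 2 +
      K' * (n : ℝ) ^ τ₁ * (weight α σ₀ * (2 * K' + (D + 1)) * (√n * √(Real.log n)) +
        K' * n * (sparsity β₀ + 1) * (η * r) ^ 2) < (1 - C) * n * dpen pen l 0) :
    μ {ω | DataConditions α pen l b τ₁ T C K ε β₀ σ₀ (X ω)
        (Matrix.mulVec (X ω) β₀ + U ω) ∧
      ¬ ∃ θ, OracleMinimizer α pen l r β₀ σ₀ (X ω) (Matrix.mulVec (X ω) β₀ + U ω) θ} ≤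
      ENNReal.ofReal (2 * ((1 + (sparsity β₀ : ℝ)) / n + ((p : ℝ) - sparsity β₀) *
        Real.exp (-((n : ℝ) ^ (1 - 2 * T) * Real.log n)))) := by
  have hw := weight_nonneg hα hσ₀
  set L := Real.log n with hLdef
  set N : ℝ := (n : ℝ) with hNdef
  have hn0 : n ≠ 0 := by omega
  have hN0 : 0 < N := Nat.cast_pos.mpr (by omega)
  have hL0 : 0 < L := Real.log_pos (Nat.one_lt_cast.mpr (by omega))
  set h := √N with hh
  have hh0 : 0 < h := Real.sqrt_pos.mpr hN0
  have hhN : N = h ^ 2 := (Real.sq_sqrt hN0.le).symm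
  set E := N ^ (-T) with hE
  have hE0 : 0 < E := Real.rpow_pos_of_pos hN0 _
  set A := weight α σ₀ * (2 * K' + (D + 1)) with hA
  set w := weight α σ₀ * (2 * K') with hwdef
  -- thresholds for the unweighted scores
  have hsqrt2 : √2 ≤ 2 := by
    rw [Real.sqrt_le_left (by norm_num)]
    norm_num
  set V := K' ^ 2 * N with hV
  have hV0 : 0 < V := by positivity
  set aS := K' * h * √(2 * L) with haS
  set aN := K' * h * √(2 * (N ^ (1 - 2 * T) * L)) with haN
  set aσ := (D + 1) * (h * √L) with haσ
  have hpow : N ^ (1 - 2 * T) = (h * E) ^ 2 := by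
    rw [mul_pow, ← hhN, hE, ← Real.rpow_natCast, ← Real.rpow_mul hN0.le]
    nth_rw 2 [← Real.rpow_one N]
    rw [← Real.rpow_add hN0]
    congr 1
    push_cast
    ring
  have hexpS : Real.exp (-aS ^ 2 / (2 * V)) = 1 / N := by
    have e : -aS ^ 2 / (2 * V) = -L := by
      rw [haS, hV, mul_pow, mul_pow, ← hhN, Real.sq_sqrt (by positivity)]
      field_simp
    rw [e, Real.exp_neg, hLdef, Real.exp_log hN0, one_div]
  have hexpN : Real.exp (-aN ^ 2 / (2 * V)) = Real.exp (-(N ^ (1 - 2 * T) * L)) := by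
    have hp0 : 0 ≤ N ^ (1 - 2 * T) := Real.rpow_nonneg hN0.le _
    congr 1
    rw [haN, hV, mul_pow, mul_pow, ← hhN, Real.sq_sqrt (by positivity)]
    field_simp
  have hSle : weight α σ₀ * aS ≤ A * (h * √L) := by
    have h1 : aS ≤ 2 * K' * (h * √L) := by
      rw [haS, Real.sqrt_mul (by norm_num)]
      calc K' * h * (√2 * √L) ≤ K' * h * (2 * √L) := by gcongr
        _ = _ := by ring
    rw [hA, mul_assoc]
    refine mul_le_mul_of_nonneg_left ?_ hw
    have : 0 ≤ (D + 1) * (h * √L) := by positivity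
    linarith
  have hσle : weight α σ₀ * aσ ≤ A * (h * √L) := by
    rw [hA, mul_assoc]
    refine mul_le_mul_of_nonneg_left ?_ hw
    have : 0 ≤ 2 * K' * (h * √L) := by positivity
    linarith
  have hNle : weight α σ₀ * aN ≤ w * (N * E * √L) := by
    rw [hwdef, mul_assoc]
    refine mul_le_mul_of_nonneg_left ?_ hw
    rw [haN, hpow, Real.sqrt_mul (by norm_num), Real.sqrt_mul (by positivity),
      Real.sqrt_sq (by positivity)]
    calc K' * h * (√2 * (h * E * √L)) ≤ K' * h * (2 * (h * E * √L)) := by gcongr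
      _ = 2 * K' * (h ^ 2 * E * √L) := by ring
      _ = _ := by rw [← hhN]
  have hbound := measure_le_of_scores (μ := μ) (β₀ := β₀)
    (T := {ω | DataConditions α pen l b τ₁ T C K ε β₀ σ₀ (X ω)
        (Matrix.mulVec (X ω) β₀ + U ω) ∧
      ¬ ∃ θ, OracleMinimizer α pen l r β₀ σ₀ (X ω) (Matrix.mulVec (X ω) β₀ + U ω) θ})
    (A := fun k => {ω | ∑ i, X ω i k ^ 2 ≤ V ∧ (if β₀ k ≠ 0 then aS else aN) ≤
      |∑ i, phi1 α (U ω i / σ₀) * X ω i k|})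
    (B := {ω | aσ ≤ |∑ i, phi2 α (U ω i / σ₀)|})
    (qS := 2 * (1 / N)) (qN := 2 * Real.exp (-(N ^ (1 - 2 * T) * L)))
    (by positivity) (by positivity) ?_ ?_ ?_ ?_
  · refine hbound.trans_eq (congrArg ENNReal.ofReal ?_)
    ring
  · rintro ω ⟨hdata, hnot⟩
    by_contra hω
    simp only [Set.mem_union, Set.mem_iUnion, Set.mem_ofPred_eq, not_or, not_exists, not_and,
      not_le] at hω
    obtain ⟨⟨hωS, hωσ⟩, hωN⟩ := hω
    have hdata' := hdata.mono_const hK hb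
    have hcol : ∀ k, ∑ i, X ω i k ^ 2 ≤ V := by
      intro k
      have h1 := hdata'.column_norm k
      have h2 : √(∑ i, X ω i k ^ 2) ^ 2 ≤ (K' * √N) ^ 2 := by gcongr
      rwa [Real.sq_sqrt (Finset.sum_nonneg fun i _ => sq_nonneg _), mul_pow, ← hh, ← hhN] at h2
    refine hnot (hdata'.exists_oracleMinimizer hn0 hα hpen hl0 hs1 hσ₀ hK0.le
      hε0 hε hr0 hd hrσ hη1 (a := A * (h * √L)) (aN := w * (N * E * √L))
      (by
        rintro (k | k)
        · refine (abs_gammaFun_coef hα hσ₀ (k : Fin p)).le.trans ?_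
          have h1 := hωS k (hcol k)
          rw [if_pos k.2] at h1
          exact (mul_le_mul_of_nonneg_left h1.le hw).trans hSle
        · refine (abs_gammaFun_scale hα hσ₀).le.trans ?_
          exact (mul_le_mul_of_nonneg_left hωσ.le hw).trans hσle)
      (by
        intro k
        refine (abs_gammaFun_coef hα hσ₀ (k : Fin p)).le.trans ?_
        have h1 := hωN k (hcol k)
        rw [if_neg (not_not.mpr k.2)] at h1
        exact (mul_le_mul_of_nonneg_left h1.le hw).trans hNle)
      hrate1 hrate2 hrate3)
  · intro k
    simp only [if_pos k.2]
    rw [← hexpS]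
    exact measure_coef_tail_le hα hσ₀ hX hU hlaw hindep hV0.le (by positivity) _
  · have ht : √L / h ≤ 1 / 4 := by
      rw [div_le_iff₀ hh0]
      refine Real.sqrt_le_iff.mpr ⟨by positivity, ?_⟩
      rw [mul_pow, ← hhN]
      linarith
    have h1 := htail (√L / h) aσ (by positivity) ht
    have hpre : {ω | aσ ≤ |∑ i, phi2 α (U ω i / σ₀)|} =
        U ⁻¹' {u | aσ ≤ |∑ i, phi2 α (u i / σ₀)|} := rfl
    have hmeas : MeasurableSet {u : Fin n → ℝ | aσ ≤ |∑ i, phi2 α (u i / σ₀)|} := by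
      have hc : Continuous fun u : Fin n → ℝ => |∑ i, phi2 α (u i / σ₀)| := by fun_prop
      exact measurableSet_le measurable_const hc.measurable
    rw [hpre, ← Measure.map_apply hU hmeas, hlaw]
    refine h1.trans_eq (congrArg (fun x => ENNReal.ofReal (2 * x)) ?_)
    have e : -(√L / h) * aσ + n * (D * (√L / h) ^ 2) = -L := by
      have hsq : √L ^ 2 = L := Real.sq_sqrt hL0.le
      rw [haσ, ← hNdef, hhN]
      have : -(√L / h) * ((D + 1) * (h * √L)) + h ^ 2 * (D * (√L / h) ^ 2) = -(√L ^ 2) := by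
        field_simp
        ring
      rw [this, hsq]
    rw [e, Real.exp_neg, hLdef, Real.exp_log hN0, one_div]
  · intro k
    simp only [if_neg (not_not.mpr k.2)]
    rw [← hexpN]
    exact measure_coef_tail_le hα hσ₀ hX hU hlaw hindep hV0.le (by positivity) _

end ProbabilityBound

end RPRegression

theorem theorem8
    {Ω : Type*} [MeasurableSpace Ω] (μ : Measure Ω) [IsProbabilityMeasure μ]
    -- dimension, true parameters, (possibly random) design and Gaussian noise
    (p : ℕ → ℕ) (β₀ : (n : ℕ) → Fin (p n) → ℝ) (σ₀ : ℝ) (hσ₀ : 0 < σ₀)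
    (X : (n : ℕ) → Ω → Fin n → Fin (p n) → ℝ) (U : (n : ℕ) → Ω → Fin n → ℝ)
    (hX : ∀ n, Measurable (X n)) (hU : ∀ n, Measurable (U n))
    (hlaw : ∀ n, μ.map (U n) = Measure.pi fun _ => gaussianReal 0 (σ₀ ^ 2).toNNReal)
    (hindep : ∀ n, IndepFun (X n) (U n) μ)
    -- tuning parameter, penalty, regularization parameter
    (α : ℝ) (hα : 0 ≤ α) (pen : ℝ → ℝ → ℝ) (hpen : PenaltyCondition pen) (l : ℕ → ℝ)
    -- sparsity and dimensionality
    (hs1 : ∀ n, 1 ≤ sparsity (β₀ n))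
    (hs : (fun n => (sparsity (β₀ n) : ℝ)) =o[atTop] fun n : ℕ => (n : ℝ))
    (τ τ₀ τ₁ : ℝ) (hτ : τ ∈ Set.Ioc 0 (1 / 2 : ℝ)) (hτ₁ : τ₁ ∈ Set.Icc 0 (1 / 2 : ℝ))
    (hτ₀ : (fun n => (sparsity (β₀ n) : ℝ)) =O[atTop] fun n : ℕ => (n : ℝ) ^ τ₀)
    (hp : (fun n => Real.log (p n)) =O[atTop]
      fun n : ℕ => (n : ℝ) ^ (1 - 2 * tauStar τ τ₀ τ₁))
    -- conditions on `b`, on the minimum signal and on the regularization parameter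
    (b : ℕ → ℝ) (hb_pos : ∀ n, 0 < b n) (hb_top : Tendsto b atTop atTop)
    (hb : b =o[atTop] fun n : ℕ => min ((n : ℝ) ^ (1 / 2 - τ) * √(Real.log n))
      ((n : ℝ) ^ τ / (((sparsity (β₀ n) : ℝ) + 1) * Real.log n)))
    (hd : ∀ᶠ n : ℕ in atTop, Real.log n / (n : ℝ) ^ τ ≤ halfMinSignal (β₀ n))
    (hdpen : (fun n => dpen pen (l n) (halfMinSignal (β₀ n))) =o[atTop]
      fun n : ℕ => (b n)⁻¹ * (n : ℝ) ^ (-τ) * Real.log n)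
    (hl : ∀ᶠ n : ℕ in atTop, Real.log n ^ 2 * (n : ℝ) ^ (-tauStar τ τ₀ τ₁) ≤ l n)
    -- the constants of the conditions on the data
    (C K : ℝ) (hC : C ∈ Set.Ioo (0 : ℝ) 1) (ε : ℕ → ℝ) (hε_pos : ∀ n, 0 < ε n)
    (hε : Tendsto ε atTop (𝓝 0)) :
    ∃ (θ : (n : ℕ) → (Fin n → Fin (p n) → ℝ) → (Fin n → ℝ) → (Fin (p n) → ℝ) × ℝ) (M : ℝ),
      ∀ᶠ n : ℕ in atTop,
        μ {ω | ∃ y : Fin n → ℝ, y = Matrix.mulVec (X n ω) (β₀ n) + U n ω ∧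
            DataConditions α pen (l n) (b n) τ₁ (tauStar τ τ₀ τ₁) C K (ε n)
              (β₀ n) σ₀ (X n ω) y ∧
            ¬ OracleMinimizer α pen (l n) (M * ((n : ℝ) ^ (-τ) * Real.log n))
              (β₀ n) σ₀ (X n ω) y (θ n (X n ω) y)}
          ≤ ENNReal.ofReal (2 * ((1 + (sparsity (β₀ n) : ℝ)) / n +
              ((p n : ℝ) - sparsity (β₀ n)) *
                Real.exp (-((n : ℝ) ^ (1 - 2 * tauStar τ τ₀ τ₁) * Real.log n)))) := by
  classical
  obtain ⟨D, hD, htail⟩ := exists_measure_phi2_tail_le (α := α) (σ₀ := σ₀) hα hσ₀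
  have hw := weight_nonneg hα hσ₀
  -- the conditions on the data are monotone in `K`, so that `K` may be taken positive
  have hK0 : 0 < max K 1 := one_pos.trans_le (le_max_right K 1)
  obtain ⟨η, hη1, hrates⟩ := eventually_rates (C := C) (K' := max K 1)
    (A := weight α σ₀ * (2 * max K 1 + (D + 1))) (w := weight α σ₀ * (2 * max K 1)) hσ₀ hpen hs1
    hτ.1 hτ₁.1 hτ₀ hb_pos hb hdpen hl hC.2 hK0 (by positivity) (by positivity)
  -- any minimizer with the required properties is an estimator
  let θ : (n : ℕ) → (Fin n → Fin (p n) → ℝ) → (Fin n → ℝ) → (Fin (p n) → ℝ) × ℝ := fun n X y =>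
    if h : ∃ θ, OracleMinimizer α pen (l n) (1 * ((n : ℝ) ^ (-τ) * Real.log n)) (β₀ n) σ₀ X y θ
    then h.choose else 0
  have hθ : ∀ n X y, (∃ θ, OracleMinimizer α pen (l n) (1 * ((n : ℝ) ^ (-τ) * Real.log n))
      (β₀ n) σ₀ X y θ) → OracleMinimizer α pen (l n) (1 * ((n : ℝ) ^ (-τ) * Real.log n))
      (β₀ n) σ₀ X y (θ n X y) := by
    intro n X y h
    have e : θ n X y = h.choose := dif_pos h
    rw [e]
    exact h.choose_spec
  have hlogn : ∀ᶠ n : ℕ in atTop, ‖Real.log n‖ ≤ 1 / 16 * ‖(n : ℝ)‖ :=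
    (Real.isLittleO_log_id_atTop.comp_tendsto tendsto_natCast_atTop_atTop).def (by norm_num)
  refine ⟨θ, 1, ?_⟩
  filter_upwards [eventually_ge_atTop 2, hlogn, hrates, hd,
    hε.eventually_lt_const (show (0 : ℝ) < 1 / 2 by norm_num)]
    with n hn2 hLn ⟨hl0, hr0, hrσ, hrate1, hrate2, hrate3⟩ hd' hεn
  have hr : Real.log n / (n : ℝ) ^ τ = (n : ℝ) ^ (-τ) * Real.log n := by
    rw [Real.rpow_neg (Nat.cast_nonneg n), mul_comm, div_eq_mul_inv]
  rw [hr] at hd'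
  rw [Real.norm_eq_abs, Real.norm_eq_abs, Nat.abs_cast] at hLn
  refine (measure_mono ?_).trans (measure_no_oracleMinimizer_le hn2 hσ₀ (hX n) (hU n) (hlaw n)
    (hindep n) hα hpen hl0 (hs1 n) (hb_pos n).le (le_max_left K 1) hK0 (hε_pos n) hεn hD (htail n)
    ((le_abs_self _).trans hLn) hr0 hd' hrσ hη1 hrate1 hrate2 hrate3)
  rintro ω ⟨y, rfl, hdata, hnot⟩
  refine ⟨hdata, fun h => hnot (hθ n _ _ ?_)⟩
  rwa [one_mul]
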